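/- **Setting.** An MDP $M$ has states $\mathcal S=\{1,\dots,S\}$, actions $\mathcal A=\{1,\dots,A\}$, transition probabilities $P_{s,a}\in\Delta^{\mathcal S}$, and a reward distribution on $[0,1]$ for each $(s,a)$, with mean $r_{s,a}$. At step $t$ the agent is in $s_t$, plays $a_t$, receives a reward $r_t$ drawn from the reward distribution of $(s_t,a_t)$, and moves to $s_{t+1}\sim P_{s_t,a_t}$. The agent knows the means $r_{s,a}$ but not $P$. $M$ is *weak-communicating* if there is a set $C$ of states that are accessible from each other (each under some stationary policy), and every state outside $C$ is transient under every stationary policy. For a stationary (randomized) policy $\pi$ let $\rho_\pi(s)=\lim_{n\to\infty}\frac1n\mathbb E_\pi[\sum_{t=1}^n r_{s_t,a_t}\mid s_1=s]$ and let $\rho^*=\max_\pi\rho_\pi(s)$, which is independent of $s$ for weak-communicating $M$. An optimal bias function is a solution $h^*\in\mathbb R^S$ of $h^*_s+\rho^*=\max_a(r_{s,a}+P_{s,a}^Th^*)$ for all $s$. Write $sp(v)=\max_{s,s'}|v_s-v_{s'}|$ and $V(x,h)=\sum_s x_sh_s^2-(x^Th)^2$. The regret from the initial state $s_1$ is $\mathcal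 R(T)=T\rho^*-\sum_{t=1}^T r_{s_t,a_t}$. **Algorithm EBF** with inputs $H,\delta_0,T$; put $\gamma=\log(2/\delta_0)$. It runs in episodes. An episode ends as soon as some $(s,a)$ has been visited in it at least $\max\{1,n\}$ times, where $n$ is the number of visits of $(s,a)$ before the episode. At the start of an episode let $N$ be the number of past steps, $N_{s,a}=\max\{1,\#\{t\le N:(s_t,a_t)=(s,a)\}\}$, $\hat P_{s,a,s'}=\#\{t\le N:(s_t,a_t,s_{t+1})=(s,a,s')\}/N_{s,a}$ and $\hat\rho=\sum_{t\le N}r_t/\max\{N,1\}$. For $s\ne s'$ let $ts_1$ be the first visit of $s$, $te_k$ the first visit of $s'$ after $ts_k$, $ts_{k+1}$ the first visit of $s$ after $te_k$, let $c(s,s')$ be the number of $k$ for which $te_k\le N+1$, and $$L_1(h,s,s')=\sum_{k=1}^{c(s,s')}\Big(h_{s'}-h_s+\sum_{ts_k\le i<te_k}(r_i-\hat\rho)\Big).$$ Let $\mathcal H$ be the set of all $h\in[0,H]^S$ with $|L_1(h,s,s')|\le 48HS\sqrt{AT\gamma}+(\sqrt{2\gamma T}+1)H$ for all $s\neq s'$.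 Let $\mathcal M$ be the set of all $(\pi,P',h',\rho)$ with $\pi$ a deterministic policy, $P'\in\mathbb R^{S\times A\times S}$, $h'\in\mathcal H$, $\rho\in\mathbb R$ such that for all $s,a,s'$ $$|P'_{s,a,s'}-\hat P_{s,a,s'}|\le 2\sqrt{\hat P_{s,a,s'}\gamma/N_{s,a}}+3\gamma/N_{s,a}+4\gamma^{3/4}/N_{s,a}^{3/4},\qquad |P'_{s,a}-\hat P_{s,a}|_1\le\sqrt{14S\gamma/N_{s,a}},$$ $$|(P'_{s,a}-\hat P_{s,a})^Th'|\le 2\sqrt{V(\hat P_{s,a},h')\gamma/N_{s,a}}+12H\gamma/N_{s,a}+10H\gamma^{3/4}/N_{s,a}^{3/4},$$ $$P'^{\,T}_{s,\pi(s)}h'+r_{s,\pi(s)}=\max_{a}\big(P'^{\,T}_{s,a}h'+r_{s,a}\big)=h'_s+\rho.$$ EBF picks an element of $\mathcal M$ with maximal $\rho$ (ties broken arbitrarily; the choice is arbitrary if $\mathcal M=\varnothing$) and follows its policy $\pi$ during the episode. **Theorem.** There is a polynomial $p_1$ in four variables such that the following holds. (i) Let $S,A,T$ be natural numbers and $H$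 a real number with $S,A,H\ge20$, let $0<\delta<1$, and suppose $T\ge p_1(S,A,H,\log(1/\delta))$. For every weak-communicating MDP $M$ with $S$ states and $A$ actions that has an optimal bias function $h^*$ with $sp(h^*)\le H$, and every initial state, EBF with inputs $H$, $\delta_0=\delta/(20S^3A^2T\log T)$ and $T$ satisfies, with probability at least $1-\delta$, $$\mathcal R(T)\le 490\sqrt{SAHT\log\Big(\frac{40S^2A^2T\log T}{\delta}\Big)}.$$ (ii) With $\delta=1/T$ the expected regret is $\tilde O(\sqrt{SAHT})$: there are absolute constants $C$ and $m$ such that for all natural numbers $S,A,T$ and real $H$ with $S,A,H\ge20$ and $T\ge p_1(S,A,H,\log T)$, and all $M$ and initial states as in (i), EBF with inputs $H$, $\delta_0=(1/T)/(20S^3A^2T\log T)$ and $T$ satisfies $\mathbb E[\mathcal R(T)]\le C\sqrt{SAHT}\,(\log T)^m$. -/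

import Mathlib

open MeasureTheory ProbabilityTheory Filter

noncomputable section

/-- A finite MDP with states `1, …, S` and actions `1, …, A`: transition probabilities `P_{s,a}` and,
for each state-action pair, a reward distribution on `[0,1]`. -/
structure MDP (S A : ℕ) where
  trans : Fin S → Fin A → Fin S → ℝ
  trans_nonneg : ∀ s a s', 0 ≤ trans s a s'
  trans_sum : ∀ s a, ∑ s', trans s a s' = 1
  rewardLaw : Fin S → Fin A → Measure ℝ
  rewardLaw_prob : ∀ s a, IsProbabilityMeasure (rewardLaw s a)
  rewardLaw_supp : ∀ s a, rewardLaw s a (Set.Icc 0 1)ᶜ = 0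

/-- A stationary (possibly randomized) policy `π : 𝒮 → Δ^𝒜`. -/
abbrev StatPolicy (S A : ℕ) : Type := Fin S → stdSimplex ℝ (Fin A)

/-- The span `sp(v) = max_{s,s'} |v_s - v_{s'}|`. -/
def vecSpan {S : ℕ} (v : Fin S → ℝ) : ℝ := ⨆ p : Fin S × Fin S, |v p.1 - v p.2|

namespace MDP

variable {S A : ℕ}

/-- The mean reward `r_{s,a} = E[r(s,a)]`. -/
def meanReward (M : MDP S A) (s : Fin S) (a : Fin A) : ℝ := ∫ x, x ∂(M.rewardLaw s a)

/-- The transition matrix `P_π`. -/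
def polMatrix (M : MDP S A) (π : StatPolicy S A) : Matrix (Fin S) (Fin S) ℝ :=
  fun s s' => ∑ a, (π s).1 a * M.trans s a s'

/-- The reward vector `r_π`. -/
def polReward (M : MDP S A) (π : StatPolicy S A) : Fin S → ℝ :=
  fun s => ∑ a, (π s).1 a * M.meanReward s a

/-- The expected reward collected in `n` steps under `π` from the initial state `s`, namely
`∑_{t < n} (P_π ^ t r_π)(s)`. -/
def expReward (M : MDP S A) (π : StatPolicy S A) (n : ℕ) (s : Fin S) : ℝ :=
  ∑ t ∈ Finset.range n, ((M.polMatrix π ^ t).mulVec (M.polReward π)) s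

/-- The average reward `ρ_π(s)`. In a finite chain the limit of the averages exists, so that this
`liminf` is that limit. -/
def avgReward (M : MDP S A) (π : StatPolicy S A) (s : Fin S) : ℝ :=
  liminf (fun n : ℕ => M.expReward π n s / n) atTop

/-- The optimal average reward `ρ*(s)`. -/
def optReward (M : MDP S A) (s : Fin S) : ℝ := ⨆ π : StatPolicy S A, M.avgReward π s

/-- Weakly communicating: the states of some set `C` are accessible from each other, each under some
policy, and every other state is transient (finite expected number of visits) under every policy. -/
def IsWeaklyCommunicating (M : MDP S A) : Prop :=
  ∃ C : Set (Fin S),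
    (∀ s ∈ C, ∀ s' ∈ C, ∃ (π : StatPolicy S A) (n : ℕ), 0 < (M.polMatrix π ^ n) s s') ∧
    (∀ s ∉ C, ∀ π : StatPolicy S A, Summable fun n : ℕ => (M.polMatrix π ^ n) s s)

/-- `h` is an optimal bias function: it solves the average reward optimality equation
`h_s + ρ = max_a (r_{s,a} + P_{s,a}ᵀ h)`. The constant `ρ` is then necessarily the optimal average
reward. -/
def IsOptimalBias (M : MDP S A) (h : Fin S → ℝ) : Prop :=
  ∃ ρ : ℝ, ∀ s, h s + ρ = ⨆ a : Fin A, (M.meanReward s a + ∑ s', M.trans s a s' * h s')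

end MDP

namespace EBF

variable {S A : ℕ}

/-! In this section `st i`, `ac i`, `rw i` are the state, the action and the reward at step `i`, steps
being numbered from `0`. The trajectory after `N` steps consists of `st 0, …, st N`, of
`ac 0, …, ac (N-1)` and of `rw 0, …, rw (N-1)`; nothing below depends on later values. -/

/-- The number of visits of `(s,a)` at the times in `I`. -/
def visits (st : ℕ → Fin S) (ac : ℕ → Fin A) (I : Finset ℕ) (s : Fin S) (a : Fin A) : ℕ :=
  (I.filter fun i => st i = s ∧ ac i = a).card

/-- The start of the episode that contains step `t`. The episode that started at `e` ends when some
pair has been visited in it at least as often as before it (and at least once). -/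
def episodeStart (st : ℕ → Fin S) (ac : ℕ → Fin A) : ℕ → ℕ
  | 0 => 0
  | t + 1 =>
    let e := episodeStart st ac t
    if ∃ s a, max (visits st ac (Finset.range e) s a) 1 ≤ visits st ac (Finset.Ico e (t + 1)) s a
    then t + 1 else e

/-- `N_{s,a} = max {number of visits of (s,a) in the first N steps, 1}`. -/
def cnt (st : ℕ → Fin S) (ac : ℕ → Fin A) (N : ℕ) (s : Fin S) (a : Fin A) : ℝ :=
  max (visits st ac (Finset.range N) s a : ℝ) 1

/-- The empirical transition probabilities. -/
def empTrans (st : ℕ → Fin S) (ac : ℕ → Fin A) (N : ℕ) (s : Fin S) (a : Fin A) (s' : Fin S) : ℝ :=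
  (((Finset.range N).filter fun i => st i = s ∧ ac i = a ∧ st (i + 1) = s').card : ℝ) /
    cnt st ac N s a

/-- The empirical average reward. -/
def empReward (rw : ℕ → ℝ) (N : ℕ) : ℝ := (∑ i ∈ Finset.range N, rw i) / max (N : ℝ) 1

/-- The first time `i ≥ t` at which the state is `x`, if there is one up to time `N`, and `N + 1`
otherwise. -/
def nextVisit (st : ℕ → Fin S) (N : ℕ) (x : Fin S) (t : ℕ) : ℕ :=
  sInf (insert (N + 1) {i | t ≤ i ∧ st i = x})

/-- The pairs `(ts_k, te_k)` (with `k` counted from `0`): `ts_k` is the first visit of `s` after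
`te_{k-1}` (from the start if `k = 0`), and `te_k` is the first visit of `s'` after `ts_k`. -/
def arrivalSeg (st : ℕ → Fin S) (N : ℕ) (s s' : Fin S) : ℕ → ℕ × ℕ
  | 0 =>
    let b := nextVisit st N s 0
    (b, nextVisit st N s' (b + 1))
  | k + 1 =>
    let b := nextVisit st N s ((arrivalSeg st N s s' k).2 + 1)
    (b, nextVisit st N s' (b + 1))

/-- The count of arrivals `c(s,s',ℒ)`: the number of `k` such that `te_k` is a time of the trajectory.
These `k` form an initial segment of `{0, …, N}`. -/
def arrivals (st : ℕ → Fin S) (N : ℕ) (s s' : Fin S) : ℕ :=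
  ((Finset.range (N + 1)).filter fun k => (arrivalSeg st N s s' k).2 ≤ N).card

/-- The statistic `L₁(h,s,s',ℒ)`. -/
def biasStat (st : ℕ → Fin S) (rw : ℕ → ℝ) (N : ℕ) (h : Fin S → ℝ) (s s' : Fin S) : ℝ :=
  ∑ k ∈ Finset.range (arrivals st N s s'),
    ((h s' - h s) +
      ∑ i ∈ Finset.Ico (arrivalSeg st N s s' k).1 (arrivalSeg st N s s' k).2, (rw i - empReward rw N))

/-- The confidence set `ℋ` of the optimal bias function. -/
def biasSet (H γ : ℝ) (T A : ℕ) (st : ℕ → Fin S) (rw : ℕ → ℝ) (N : ℕ) : Set (Fin S → ℝ) :=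
  {h | (∀ s, 0 ≤ h s ∧ h s ≤ H) ∧
    ∀ s s', s ≠ s' → |biasStat st rw N h s s'| ≤
      48 * S * √(A * T * γ) * H + (√(2 * γ * T) + 1) * H}

/-- The variance `V(x,h) = ∑ x_s h_s² - (xᵀh)²`. -/
def vecVar (x h : Fin S → ℝ) : ℝ := ∑ s, x s * h s ^ 2 - (∑ s, x s * h s) ^ 2

/-- A 4-tuple `(π, P', h', ρ)` with a deterministic policy `π`. -/
structure Candidate (S A : ℕ) where
  policy : Fin S → Fin A
  trans : Fin S → Fin A → Fin S → ℝ
  bias : Fin S → ℝ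
  gain : ℝ

/-- The confidence set `ℳ` that BuildCS returns from the trajectory of the first `N` steps. Here `r`
is the (known) mean reward function. -/
def confSet (r : Fin S → Fin A → ℝ) (H γ : ℝ) (T : ℕ)
    (st : ℕ → Fin S) (ac : ℕ → Fin A) (rw : ℕ → ℝ) (N : ℕ) : Set (Candidate S A) :=
  {c | c.bias ∈ biasSet H γ T A st rw N ∧
    (∀ s a s', |c.trans s a s' - empTrans st ac N s a s'| ≤
      2 * √(empTrans st ac N s a s' * γ / cnt st ac N s a) + 3 * γ / cnt st ac N s a
        + 4 * γ ^ (3 / 4 : ℝ) / cnt st ac N s a ^ (3 / 4 : ℝ)) ∧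
    (∀ s a, ∑ s', |c.trans s a s' - empTrans st ac N s a s'| ≤ √(14 * S * γ / cnt st ac N s a)) ∧
    (∀ s a, |∑ s', (c.trans s a s' - empTrans st ac N s a s') * c.bias s'| ≤
      2 * √(vecVar (empTrans st ac N s a) c.bias * γ / cnt st ac N s a)
        + 12 * H * γ / cnt st ac N s a
        + 10 * H * γ ^ (3 / 4 : ℝ) / cnt st ac N s a ^ (3 / 4 : ℝ)) ∧
    (∀ s, ∑ s', c.trans s (c.policy s) s' * c.bias s' + r s (c.policy s)
        = ⨆ a : Fin A, (∑ s', c.trans s a s' * c.bias s' + r s a)) ∧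
    (∀ s, ⨆ a : Fin A, (∑ s', c.trans s a s' * c.bias s' + r s a) = c.bias s + c.gain)}

/-- An execution of EBF with inputs `H`, `δ`, `T` (so `γ = log (2/δ)`) in the MDP `M` from the state
`s₁`, on the probability space `(Ω, μ)`. The σ-algebra `filt t` is the information that is available
when the action of step `t` is chosen, and `cand t` is the 4-tuple that is in force at step `t`.

At the start of an episode `cand t` maximizes the gain over the confidence set, with ties broken in any
way (in the event that the confidence set is empty, the choice is arbitrary); during an episode it does
not change. The state `st (t+1)` and the reward `rw t` are drawn from the transition
probabilities and from the reward distribution at `(st t, ac t)`, whatever happened before. -/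
structure Run (M : MDP S A) (s₁ : Fin S) (H δ : ℝ) (T : ℕ)
    {Ω : Type*} [mΩ : MeasurableSpace Ω] (μ : Measure Ω) where
  filt : Filtration ℕ mΩ
  st : ℕ → Ω → Fin S
  ac : ℕ → Ω → Fin A
  rw : ℕ → Ω → ℝ
  cand : ℕ → Ω → Candidate S A
  st_meas : ∀ t, t ≤ T → Measurable[filt t] (st t)
  rw_meas : ∀ t, t < T → Measurable[filt (t + 1)] (rw t)
  policy_meas : ∀ t, t < T → Measurable[filt t] fun ω => (cand t ω).policy
  trans_meas : ∀ t, t < T → Measurable[filt t] fun ω => (cand t ω).trans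
  bias_meas : ∀ t, t < T → Measurable[filt t] fun ω => (cand t ω).bias
  gain_meas : ∀ t, t < T → Measurable[filt t] fun ω => (cand t ω).gain
  st_zero : ∀ ω, st 0 ω = s₁
  ac_eq : ∀ t, t < T → ∀ ω, ac t ω = (cand t ω).policy (st t ω)
  cand_new : ∀ t, t < T → ∀ ω,
    episodeStart (fun i => st i ω) (fun i => ac i ω) t = t →
    (confSet M.meanReward H (Real.log (2 / δ)) T
      (fun i => st i ω) (fun i => ac i ω) (fun i => rw i ω) t).Nonempty →
    cand t ω ∈ confSet M.meanReward H (Real.log (2 / δ)) T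
      (fun i => st i ω) (fun i => ac i ω) (fun i => rw i ω) t ∧
    ∀ c ∈ confSet M.meanReward H (Real.log (2 / δ)) T
      (fun i => st i ω) (fun i => ac i ω) (fun i => rw i ω) t, c.gain ≤ (cand t ω).gain
  cand_same : ∀ t, t + 1 < T → ∀ ω,
    episodeStart (fun i => st i ω) (fun i => ac i ω) (t + 1) ≠ t + 1 → cand (t + 1) ω = cand t ω
  st_law : ∀ t, t < T → ∀ s' : Fin S,
    μ[(st (t + 1) ⁻¹' {s'}).indicator (fun _ => (1 : ℝ)) | filt t]
      =ᵐ[μ] fun ω => M.trans (st t ω) (ac t ω) s'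
  rw_law : ∀ t, t < T → ∀ B : Set ℝ, MeasurableSet B →
    μ[(rw t ⁻¹' B).indicator (fun _ => (1 : ℝ)) | filt t]
      =ᵐ[μ] fun ω => (M.rewardLaw (st t ω) (ac t ω)).real B

/-- The regret `ℛ(T) = T ρ* - ∑_{t ≤ T} r_{s_t,a_t}` of a run. -/
def Run.regret {M : MDP S A} {s₁ : Fin S} {H δ : ℝ} {T : ℕ}
    {Ω : Type*} [MeasurableSpace Ω] {μ : Measure Ω} (R : Run M s₁ H δ T μ) (ω : Ω) : ℝ :=
  T * M.optReward s₁ - ∑ t ∈ Finset.range T, M.meanReward (R.st t ω) (R.ac t ω)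

/-- The confidence parameter that is passed to EBF so that the total failure probability is `δ`. -/
def inputConf (S A T : ℕ) (δ : ℝ) : ℝ :=
  δ / (20 * (S : ℝ) ^ 3 * (A : ℝ) ^ 2 * T * Real.log T)

end EBF

end

/-!
The proof is optimism in the face of uncertainty, with a Bernstein-type control of the variances.

Let `(h, ρ)` solve the optimality equation, with `h` shifted so that its values lie in `[0,H]`. Then
`ρ` dominates the gain of every policy (`IsBiasPair.optReward_le`), so that it suffices to bound
`∑ (ρ - r_{s_t,a_t})`.

*Concentration.* All deviation bounds come from one exponential supermartingale
(`Run.integral_exp_freedman_le`) for the increments `f_i(s_{i+1}) - P_iᵀ f_i` of a predictable family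
`f`, and its analogue for the rewards (`Run.integral_exp_rewardExponent_le`). Predictability allows
restricting to the first `n` visits of a state-action pair, which gives Bernstein's inequality for the
empirical transition probabilities without stopping times, and to the segments that enter `L₁`: whether
step `i` lies in such a segment is known at step `i` (`inSegment`). A union bound over about
`29 S²AT` exponents, each with failure probability `exp (-γ) = δ₀/2`, shows that trajectories are
typical in the sense of `IsTypical` (`Run.measureReal_not_isTypical_le`). The rest is deterministic.

*Optimism.* By induction over the steps, `h` belongs to `ℋ` at the start of each episode: as long as
EBF was optimistic, the `ℓ¹` constraint alone bounds the regret so far by `23 HS√(ATγ)`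
(`sum_regret_le_crude`), and `L₁(h,s,s')` is the sum of martingales, of `ρ - ρ̂`, and of the
nonnegative gaps of the actions played, all of which are controlled by that regret (`mem_biasSet`). The
true transition probabilities with `h` then form an element of `ℳ` with gain `ρ`, so that the chosen
candidate has gain at least `ρ` (`isOptimistic`).

*The leading term.* Optimism bounds the regret of step `t` by `(P' - P)ᵀh'` up to a martingale and a
telescoping sum. For `h, h'` in `ℋ` the difference of the two statistics is
`c(s,s')((h'_{s'} - h'_s) - (h_{s'} - h_s))`, and `c(s,s')` is at least the number of transitions from
`s` to `s'`. Hence the increments of `h'` and `h` agree along frequent transitions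
(`empTrans_mul_sq_le`), and the variance of `h'` may be replaced by that of `h` up to lower order terms
(`candidate_error_le`). What remains is `√γ ∑ √(V(P_{s_t,a_t}, h) / N)`, and
`∑ V(P_{s_t,a_t}, h) ≤ 3HT` (`sum_vecVar_le`), since `V(P,h) = (Pᵀh² - h²) + (h - Pᵀh)(h + Pᵀh)`
where the first part telescopes up to a martingale, and `h - Pᵀh` is at most `1` plus the gap. The
Cauchy–Schwarz inequality yields `√(SAHTγ)` (`sum_regret_le`).

The martingale that is left over, of the increments of `h' = h + (h' - h)`, is of lower order too: its
variance is again `O(HT)` for `h`, and small for `h' - h` (`vecVar_sub_le`). All other terms are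
of lower order in `T`, with coefficients polynomial in the remaining parameters and `γ`, and a
polynomial lower bound on `T` makes them small against the leading term.
-/

noncomputable section

/-! ### Variances under a probability vector -/

section Variance

variable {S : ℕ} {x f : Fin S → ℝ}

theorem vecVar_eq_sub (hx : ∑ s, x s = 1) (c : ℝ) :
    EBF.vecVar x f = ∑ s, x s * (f s - c) ^ 2 - (∑ s, x s * f s - c) ^ 2 := by
  have h1 : ∑ s, x s * (f s - c) ^ 2
      = ∑ s, x s * f s ^ 2 - 2 * c * ∑ s, x s * f s + c ^ 2 * ∑ s, x s := by
    rw [Finset.mul_sum, Finset.mul_sum, ← Finset.sum_sub_distrib, ← Finset.sum_add_distrib]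
    exact Finset.sum_congr rfl fun s _ => by ring
  rw [h1, hx, EBF.vecVar]
  ring

theorem vecVar_eq_centered (hx : ∑ s, x s = 1) :
    EBF.vecVar x f = ∑ s, x s * (f s - ∑ s', x s' * f s') ^ 2 := by
  rw [vecVar_eq_sub hx (∑ s', x s' * f s')]
  ring

theorem vecVar_le_sum_sq (hx : ∑ s, x s = 1) (c : ℝ) :
    EBF.vecVar x f ≤ ∑ s, x s * (f s - c) ^ 2 := by
  rw [vecVar_eq_sub hx c]
  nlinarith [sq_nonneg (∑ s, x s * f s - c)]

theorem vecVar_nonneg (hx0 : ∀ s, 0 ≤ x s) (hx : ∑ s, x s = 1) : 0 ≤ EBF.vecVar x f := by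
  rw [vecVar_eq_centered hx]
  exact Finset.sum_nonneg fun s _ => mul_nonneg (hx0 s) (sq_nonneg _)

theorem sum_mul_mem_Icc (hx0 : ∀ s, 0 ≤ x s) (hx : ∑ s, x s = 1) {a b : ℝ}
    (hf : ∀ s, a ≤ f s ∧ f s ≤ b) : a ≤ ∑ s, x s * f s ∧ ∑ s, x s * f s ≤ b := by
  have ha : ∑ s, x s * a = a := by rw [← Finset.sum_mul, hx, one_mul]
  have hb : ∑ s, x s * b = b := by rw [← Finset.sum_mul, hx, one_mul]
  constructor
  · rw [← ha]
    exact Finset.sum_le_sum fun s _ => mul_le_mul_of_nonneg_left (hf s).1 (hx0 s)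
  · rw [← hb]
    exact Finset.sum_le_sum fun s _ => mul_le_mul_of_nonneg_left (hf s).2 (hx0 s)

theorem abs_sub_sum_mul_le (hx0 : ∀ s, 0 ≤ x s) (hx : ∑ s, x s = 1) {b : ℝ}
    (hf : ∀ s s', |f s - f s'| ≤ b) (s : Fin S) : |f s - ∑ s', x s' * f s'| ≤ b := by
  have h := sum_mul_mem_Icc hx0 hx (f := f) (a := f s - b) (b := f s + b)
    (fun s' => ⟨by linarith [(abs_le.1 (hf s s')).2], by linarith [(abs_le.1 (hf s s')).1]⟩)
  exact abs_le.2 ⟨by linarith [h.2], by linarith [h.1]⟩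

theorem vecVar_le_sq (hx0 : ∀ s, 0 ≤ x s) (hx : ∑ s, x s = 1) {b : ℝ}
    (hf : ∀ s s', |f s - f s'| ≤ b) : EBF.vecVar x f ≤ b ^ 2 := by
  rw [vecVar_eq_centered hx]
  refine (sum_mul_mem_Icc hx0 hx (a := 0) fun s => ⟨sq_nonneg _, ?_⟩).2
  rw [← sq_abs]
  exact pow_le_pow_left₀ (abs_nonneg _) (abs_sub_sum_mul_le hx0 hx hf s) 2

/-- The exponential moment of a centered variable `c (f - xᵀf)` with values in an interval of length
`1`, by `exp y ≤ 1 + y + y²` for `|y| ≤ 1`. -/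
theorem sum_mul_exp_le (hx0 : ∀ s, 0 ≤ x s) (hx : ∑ s, x s = 1) {c : ℝ}
    (hf : ∀ s s', |c| * |f s - f s'| ≤ 1) :
    ∑ s, x s * Real.exp (c * (f s - ∑ s', x s' * f s')) ≤ Real.exp (c ^ 2 * EBF.vecVar x f) := by
  set m := ∑ s', x s' * f s' with hm
  have hb : ∀ s, |c * (f s - m)| ≤ 1 := fun s => by
    have h := abs_sub_sum_mul_le hx0 hx (f := fun s => c * f s) (b := 1)
      (fun s s' => by rw [← mul_sub, abs_mul]; exact hf s s') s
    have e : ∑ s', x s' * (c * f s') = c * m := by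
      rw [hm, Finset.mul_sum]; exact Finset.sum_congr rfl fun s _ => by ring
    simp only [e] at h
    rwa [mul_sub]
  have h1 : ∀ s, x s * Real.exp (c * (f s - m))
      ≤ x s * (1 + c * (f s - m) + (c * (f s - m)) ^ 2) := fun s => by
    refine mul_le_mul_of_nonneg_left ?_ (hx0 s)
    linarith [(abs_le.1 (Real.abs_exp_sub_one_sub_id_le (hb s))).2]
  have h2 : ∑ s, x s * (1 + c * (f s - m) + (c * (f s - m)) ^ 2)
      = 1 + c ^ 2 * EBF.vecVar x f := by
    rw [vecVar_eq_centered hx, ← hm, Finset.mul_sum]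
    have e : ∀ s, x s * (1 + c * (f s - m) + (c * (f s - m)) ^ 2)
        = x s * (1 - c * m) + c * (x s * f s) + c ^ 2 * (x s * (f s - m) ^ 2) := fun s => by ring
    simp only [e]
    rw [Finset.sum_add_distrib, Finset.sum_add_distrib, ← Finset.sum_mul, ← Finset.mul_sum, hx,
      ← hm]
    ring
  calc _ ≤ 1 + c ^ 2 * EBF.vecVar x f := h2 ▸ Finset.sum_le_sum fun s _ => h1 s
    _ ≤ _ := by linarith [Real.add_one_le_exp (c ^ 2 * EBF.vecVar x f)]

end Variance

/-! ### Exponential supermartingales along a run -/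

/-- The conditional mean `P_{s,a}ᵀ f` of `f` at the next state. -/
def MDP.nextMean {S A : ℕ} (M : MDP S A) (s : Fin S) (a : Fin A) (f : Fin S → ℝ) : ℝ :=
  ∑ s', M.trans s a s' * f s'

namespace EBF.Run

variable {S A : ℕ} {M : MDP S A} {s₁ : Fin S} {H δ : ℝ} {T : ℕ} {Ω : Type*}
  [mΩ : MeasurableSpace Ω] {μ : Measure Ω} (R : Run M s₁ H δ T μ)

theorem ac_meas {t : ℕ} (ht : t < T) : Measurable[R.filt t] (R.ac t) := by
  have h : R.ac t = (fun p : (Fin S → Fin A) × Fin S => p.1 p.2) ∘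
      fun ω => ((R.cand t ω).policy, R.st t ω) := by
    funext ω; exact R.ac_eq t ht ω
  rw [h]
  exact (measurable_of_finite _).comp
    (Measurable.prodMk (R.policy_meas t ht) (R.st_meas t ht.le))

theorem st_meas' {i t : ℕ} (hit : i ≤ t) (ht : t ≤ T) : Measurable[R.filt t] (R.st i) :=
  (R.st_meas i (hit.trans ht)).mono (R.filt.mono hit) le_rfl

theorem ac_meas' {i t : ℕ} (hit : i ≤ t) (ht : i < T) : Measurable[R.filt t] (R.ac i) :=
  (R.ac_meas ht).mono (R.filt.mono hit) le_rfl

/-- A function of the current state and action is known when the action is chosen. -/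
theorem meas_st_ac {i t : ℕ} (hit : i ≤ t) (ht : t ≤ T) (hi : i < T) {β : Type*}
    [MeasurableSpace β] (F : Fin S → Fin A → β) :
    Measurable[R.filt t] fun ω => F (R.st i ω) (R.ac i ω) :=
  (measurable_of_finite fun p : Fin S × Fin A => F p.1 p.2).comp
    (Measurable.prodMk (R.st_meas' hit ht) (R.ac_meas' hit hi))

theorem meas_apply_st {i t : ℕ} (hit : i ≤ t) (ht : t ≤ T) {g : Ω → Fin S → ℝ}
    (hg : ∀ s, Measurable[R.filt t] fun ω => g ω s) :
    Measurable[R.filt t] fun ω => g ω (R.st i ω) := by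
  have h : (fun ω => g ω (R.st i ω)) = fun ω => ∑ s, if R.st i ω = s then g ω s else 0 := by
    funext ω; simp
  rw [h]
  refine Finset.measurable_sum _ fun s _ => Measurable.ite ?_ (hg s) measurable_const
  exact (R.st_meas' hit ht) (measurableSet_singleton s)

theorem meas_nextMean {t : ℕ} (ht : t < T) {g : Ω → Fin S → ℝ}
    (hg : ∀ s, Measurable[R.filt t] fun ω => g ω s) :
    Measurable[R.filt t] fun ω => M.nextMean (R.st t ω) (R.ac t ω) (g ω) :=
  Finset.measurable_sum _ fun s' _ =>
    (R.meas_st_ac le_rfl ht.le ht fun s a => M.trans s a s').mul (hg s')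

theorem meas_vecVar {t : ℕ} (ht : t < T) {g : Ω → Fin S → ℝ}
    (hg : ∀ s, Measurable[R.filt t] fun ω => g ω s) :
    Measurable[R.filt t] fun ω => vecVar (M.trans (R.st t ω) (R.ac t ω)) (g ω) :=
  (R.meas_nextMean ht (g := fun ω s => g ω s ^ 2) fun s => (hg s).pow_const 2).sub
    ((R.meas_nextMean ht hg).pow_const 2)

/-- The martingale difference `f_i(s_{i+1}) - P_iᵀ f_i` of a predictable family `f`. -/
def incr (f : ℕ → Ω → Fin S → ℝ) (i : ℕ) (ω : Ω) : ℝ :=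
  f i ω (R.st (i + 1) ω) - M.nextMean (R.st i ω) (R.ac i ω) (f i ω)

/-- The conditional variance of `incr`. -/
def condVar (f : ℕ → Ω → Fin S → ℝ) (i : ℕ) (ω : Ω) : ℝ :=
  vecVar (M.trans (R.st i ω) (R.ac i ω)) (f i ω)

/-- The exponent of the supermartingale of Freedman's inequality. -/
def freedman (c : ℝ) (f : ℕ → Ω → Fin S → ℝ) (n : ℕ) (ω : Ω) : ℝ :=
  ∑ i ∈ Finset.range n, (c * R.incr f i ω - c ^ 2 * R.condVar f i ω)

/-- The centered reward of step `i`. -/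
def rewardIncr (i : ℕ) (ω : Ω) : ℝ := R.rw i ω - M.meanReward (R.st i ω) (R.ac i ω)

/-- The exponent of the supermartingale for the rewards at the steps `i` with `ω ∈ J i`. -/
def rewardExponent (c : ℝ) (J : ℕ → Set Ω) (n : ℕ) (ω : Ω) : ℝ :=
  ∑ i ∈ Finset.range n, (c * (J i).indicator (R.rewardIncr i) ω - c ^ 2)

theorem meas_freedman {c : ℝ} {f : ℕ → Ω → Fin S → ℝ}
    (hf : ∀ i < T, ∀ s, Measurable[R.filt i] fun ω => f i ω s) {n : ℕ} (hn : n ≤ T) :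
    Measurable[R.filt n] (R.freedman c f n) := by
  refine Finset.measurable_sum _ fun i hi => ?_
  have hi' := Finset.mem_range.1 hi
  have hiT := hi'.trans_le hn
  have hmono : R.filt i ≤ R.filt n := R.filt.mono hi'.le
  refine Measurable.sub (Measurable.const_mul (Measurable.sub ?_ ?_) _) (Measurable.const_mul ?_ _)
  · exact R.meas_apply_st hi' hn fun s => (hf i hiT s).mono hmono le_rfl
  · exact (R.meas_nextMean hiT (hf i hiT)).mono hmono le_rfl
  · exact (R.meas_vecVar hiT (hf i hiT)).mono hmono le_rfl

theorem freedman_step_le {c : ℝ} {f : ℕ → Ω → Fin S → ℝ}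
    (hb : ∀ i ω s s', |c| * |f i ω s - f i ω s'| ≤ 1) (i : ℕ) (ω : Ω) (s : Fin S) :
    c * (f i ω s - M.nextMean (R.st i ω) (R.ac i ω) (f i ω)) - c ^ 2 * R.condVar f i ω ≤ 1 := by
  have hV : 0 ≤ R.condVar f i ω := vecVar_nonneg (M.trans_nonneg _ _) (M.trans_sum _ _)
  have h := abs_sub_sum_mul_le (M.trans_nonneg (R.st i ω) (R.ac i ω)) (M.trans_sum _ _)
    (f := fun s => c * f i ω s) (b := 1)
    (fun s s' => by rw [← mul_sub, abs_mul]; exact hb i ω s s') s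
  have e : ∑ s', M.trans (R.st i ω) (R.ac i ω) s' * (c * f i ω s')
      = c * M.nextMean (R.st i ω) (R.ac i ω) (f i ω) := by
    rw [MDP.nextMean, Finset.mul_sum]; exact Finset.sum_congr rfl fun s _ => by ring
  simp only [e] at h
  nlinarith [(abs_le.1 h).2, mul_nonneg (sq_nonneg c) hV]

theorem freedman_le {c : ℝ} {f : ℕ → Ω → Fin S → ℝ}
    (hb : ∀ i ω s s', |c| * |f i ω s - f i ω s'| ≤ 1) (n : ℕ) (ω : Ω) :
    R.freedman c f n ω ≤ n := by
  calc R.freedman c f n ω ≤ ∑ i ∈ Finset.range n, (1 : ℝ) :=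
        Finset.sum_le_sum fun i _ => R.freedman_step_le hb i ω _
    _ = n := by simp

theorem meas_rewardExponent {c : ℝ} {J : ℕ → Set Ω}
    (hJ : ∀ i < T, MeasurableSet[R.filt i] (J i)) {n : ℕ} (hn : n ≤ T) :
    Measurable[R.filt n] (R.rewardExponent c J n) := by
  refine Finset.measurable_sum _ fun i hi => ?_
  have hi' := Finset.mem_range.1 hi
  have hiT := hi'.trans_le hn
  have hmono : R.filt i ≤ R.filt n := R.filt.mono hi'.le
  refine Measurable.sub (Measurable.const_mul (Measurable.indicator (Measurable.sub ?_ ?_) ?_) _)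
    measurable_const
  · exact (R.rw_meas i hiT).mono (R.filt.mono hi') le_rfl
  · exact R.meas_st_ac hi'.le hn hiT M.meanReward
  · exact hmono _ (hJ i hiT)

variable [IsProbabilityMeasure μ]

/-- The law of the next state, applied to a function that is known when the action is chosen. -/
theorem integral_apply_st_succ {t : ℕ} (ht : t < T) {g : Ω → Fin S → ℝ}
    (hg : ∀ s, Measurable[R.filt t] fun ω => g ω s) {C : ℝ} (hC : ∀ ω s, |g ω s| ≤ C) :
    ∫ ω, g ω (R.st (t + 1) ω) ∂μ = ∫ ω, M.nextMean (R.st t ω) (R.ac t ω) (g ω) ∂μ := by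
  have hm := R.filt.le t
  have hgi : ∀ s, Integrable (fun ω => g ω s) μ := fun s =>
    Integrable.of_bound ((hg s).mono hm le_rfl).aestronglyMeasurable C
      (Eventually.of_forall fun ω => hC ω s)
  have hset : ∀ s, MeasurableSet (R.st (t + 1) ⁻¹' {s}) := fun s =>
    (R.st_meas (t + 1) ht).mono (R.filt.le _) le_rfl (measurableSet_singleton s)
  have hind : ∀ s, Integrable ((R.st (t + 1) ⁻¹' {s}).indicator fun _ => (1 : ℝ)) μ := fun s =>
    (integrable_const 1).indicator (hset s)
  have hprod : ∀ s, Integrable ((fun ω => g ω s) *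
      (R.st (t + 1) ⁻¹' {s}).indicator fun _ => (1 : ℝ)) μ := fun s => by
    refine ((hgi s).indicator (hset s)).congr (Eventually.of_forall fun ω => ?_)
    by_cases h : ω ∈ R.st (t + 1) ⁻¹' {s} <;> simp [h]
  have hone : ∀ s, ∫ ω, ((fun ω => g ω s) *
      (R.st (t + 1) ⁻¹' {s}).indicator fun _ => (1 : ℝ)) ω ∂μ
        = ∫ ω, M.trans (R.st t ω) (R.ac t ω) s * g ω s ∂μ := fun s => by
    rw [← integral_condExp hm]
    refine integral_congr_ae ?_
    filter_upwards [condExp_mul_of_stronglyMeasurable_left (hg s).stronglyMeasurable (hprod s)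
      (hind s), R.st_law t ht s] with ω h1 h2
    rw [h1, Pi.mul_apply, h2, mul_comm]
  have hsplit : ∀ ω, g ω (R.st (t + 1) ω) = ∑ s, ((fun ω => g ω s) *
      (R.st (t + 1) ⁻¹' {s}).indicator fun _ => (1 : ℝ)) ω := fun ω => by
    rw [Finset.sum_eq_single (R.st (t + 1) ω)]
    · simp
    · intro s _ hs
      simp [Set.indicator_of_notMem, hs.symm]
    · simp
  have hint : ∀ s, Integrable (fun ω => M.trans (R.st t ω) (R.ac t ω) s * g ω s) μ := fun s => by
    refine (hgi s).bdd_mul (c := 1)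
      (((R.meas_st_ac le_rfl ht.le ht fun s' a => M.trans s' a s).mono hm le_rfl).aestronglyMeasurable)
      (Eventually.of_forall fun ω => ?_)
    rw [Real.norm_eq_abs, abs_of_nonneg (M.trans_nonneg _ _ _)]
    rw [← M.trans_sum (R.st t ω) (R.ac t ω)]
    exact Finset.single_le_sum (fun s' _ => M.trans_nonneg _ _ s') (Finset.mem_univ s)
  simp only [hsplit, MDP.nextMean]
  rw [integral_finsetSum _ fun s _ => hprod s, integral_finsetSum _ fun s _ => hint s]
  exact Finset.sum_congr rfl fun s _ => hone s

/-- The exponential supermartingale: one step multiplies the conditional expectation by at most `1`,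
by `sum_mul_exp_le`. -/
theorem integral_exp_freedman_le {c : ℝ} {f : ℕ → Ω → Fin S → ℝ}
    (hf : ∀ i < T, ∀ s, Measurable[R.filt i] fun ω => f i ω s)
    (hb : ∀ i ω s s', |c| * |f i ω s - f i ω s'| ≤ 1) {n : ℕ} (hn : n ≤ T) :
    Integrable (fun ω => Real.exp (R.freedman c f n ω)) μ ∧
      ∫ ω, Real.exp (R.freedman c f n ω) ∂μ ≤ 1 := by
  have hint : ∀ n ≤ T, Integrable (fun ω => Real.exp (R.freedman c f n ω)) μ := fun n hn => by
    refine Integrable.of_bound (((R.meas_freedman hf hn).mono (R.filt.le n) le_rfl).exp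
      |>.aestronglyMeasurable) (Real.exp n) (Eventually.of_forall fun ω => ?_)
    rw [Real.norm_eq_abs, Real.abs_exp]
    exact Real.exp_le_exp.2 (R.freedman_le hb n ω)
  refine ⟨hint n hn, ?_⟩
  induction n with
  | zero => simp [freedman]
  | succ n ih =>
    have hn' : n < T := hn
    set g : Ω → Fin S → ℝ := fun ω s => Real.exp (R.freedman c f n ω +
      (c * (f n ω s - M.nextMean (R.st n ω) (R.ac n ω) (f n ω)) - c ^ 2 * R.condVar f n ω))
      with hg
    have e1 : ∀ ω, Real.exp (R.freedman c f (n + 1) ω) = g ω (R.st (n + 1) ω) := fun ω => by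
      rw [hg, freedman, Finset.sum_range_succ]; rfl
    simp only [e1]
    rw [R.integral_apply_st_succ hn' (C := Real.exp (n + 1))]
    · refine le_trans (integral_mono_of_nonneg (Eventually.of_forall fun ω => ?_) (hint n hn'.le)
        (Eventually.of_forall fun ω => ?_)) (ih hn'.le)
      · exact Finset.sum_nonneg fun s _ => mul_nonneg (M.trans_nonneg _ _ _) (Real.exp_pos _).le
      · have h := sum_mul_exp_le (M.trans_nonneg (R.st n ω) (R.ac n ω)) (M.trans_sum _ _)
          (hb n ω)
        have e2 : M.nextMean (R.st n ω) (R.ac n ω) (g ω)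
            = Real.exp (R.freedman c f n ω) * Real.exp (-(c ^ 2 * R.condVar f n ω)) *
              ∑ s, M.trans (R.st n ω) (R.ac n ω) s * Real.exp (c * (f n ω s -
                ∑ s', M.trans (R.st n ω) (R.ac n ω) s' * f n ω s')) := by
          rw [MDP.nextMean, Finset.mul_sum]
          refine Finset.sum_congr rfl fun s _ => ?_
          simp only [hg, Real.exp_add, sub_eq_add_neg, MDP.nextMean]
          ring
        beta_reduce
        rw [e2]
        calc _ ≤ Real.exp (R.freedman c f n ω) * Real.exp (-(c ^ 2 * R.condVar f n ω)) *
              Real.exp (c ^ 2 * R.condVar f n ω) := by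
              exact mul_le_mul_of_nonneg_left h (by positivity)
          _ = _ := by rw [mul_assoc, ← Real.exp_add]; simp
    · intro s
      refine Measurable.exp (Measurable.add (R.meas_freedman hf hn'.le) (Measurable.sub
        (Measurable.const_mul (Measurable.sub (hf n hn' s) ?_) _) (Measurable.const_mul ?_ _)))
      · exact R.meas_nextMean hn' (hf n hn')
      · exact R.meas_vecVar hn' (hf n hn')
    · intro ω s
      rw [hg, Real.abs_exp]
      exact Real.exp_le_exp.2 (add_le_add (R.freedman_le hb n ω) (R.freedman_step_le hb n ω s))

/-- The law of the reward, tested against a weight that lives on a single state-action pair: the push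
forward of `W μ` by the reward is a multiple of the reward distribution. -/
theorem integral_mul_reward {t : ℕ} (ht : t < T) {W : Ω → NNReal} (hW : Measurable[R.filt t] W)
    (hWi : Integrable (fun ω => (W ω : ℝ)) μ) {s : Fin S} {a : Fin A}
    (hsa : ∀ ω, W ω ≠ 0 → R.st t ω = s ∧ R.ac t ω = a) {φ : ℝ → ℝ} (hφ : Measurable φ) :
    ∫ ω, (W ω : ℝ) * φ (R.rw t ω) ∂μ = (∫ ω, (W ω : ℝ) ∂μ) * ∫ x, φ x ∂(M.rewardLaw s a) := by
  have hm := R.filt.le t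
  have hWm : Measurable W := hW.mono hm le_rfl
  have hr : Measurable (R.rw t) := (R.rw_meas t ht).mono (R.filt.le _) le_rfl
  have := M.rewardLaw_prob s a
  have hset : ∀ B : Set ℝ, MeasurableSet B →
      ∫ ω in R.rw t ⁻¹' B, (W ω : ℝ) ∂μ = (∫ ω, (W ω : ℝ) ∂μ) * (M.rewardLaw s a).real B := by
    intro B hB
    have hBm := hr hB
    have hprod : Integrable ((fun ω => (W ω : ℝ)) *
        (R.rw t ⁻¹' B).indicator fun _ => (1 : ℝ)) μ := by
      refine (hWi.indicator hBm).congr (Eventually.of_forall fun ω => ?_)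
      by_cases h : ω ∈ R.rw t ⁻¹' B <;> simp [h]
    rw [← integral_indicator hBm, ← integral_mul_const]
    have e : (R.rw t ⁻¹' B).indicator (fun ω => (W ω : ℝ)) = (fun ω => (W ω : ℝ)) *
        (R.rw t ⁻¹' B).indicator fun _ => (1 : ℝ) := by
      funext ω
      by_cases h : ω ∈ R.rw t ⁻¹' B <;> simp [h]
    rw [e, ← integral_condExp hm]
    refine integral_congr_ae ?_
    filter_upwards [condExp_mul_of_stronglyMeasurable_left
      (hW.coe_nnreal_real).stronglyMeasurable hprod ((integrable_const 1).indicator hBm),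
      R.rw_law t ht B hB] with ω h1 h2
    rw [h1, Pi.mul_apply, h2]
    by_cases h0 : W ω = 0
    · simp [h0]
    · rw [(hsa ω h0).1, (hsa ω h0).2]
  have hν : (μ.withDensity fun ω => (W ω : ENNReal)).map (R.rw t)
      = (∫⁻ ω, W ω ∂μ) • M.rewardLaw s a := by
    have hfin : ∫⁻ ω, (W ω : ENNReal) ∂μ ≠ ⊤ := by
      simpa using hWi.lintegral_lt_top.ne
    refine Measure.ext fun B hB => ?_
    rw [Measure.map_apply hr hB, withDensity_apply _ (hr hB), Measure.smul_apply, smul_eq_mul]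
    have hl : ∫⁻ ω in R.rw t ⁻¹' B, (W ω : ENNReal) ∂μ ≠ ⊤ :=
      ((setLIntegral_le_lintegral _ _).trans_lt hfin.lt_top).ne
    refine (ENNReal.toReal_eq_toReal_iff' hl
      (ENNReal.mul_ne_top hfin (measure_ne_top _ _))).1 ?_
    have := hset B hB
    rw [integral_eq_lintegral_of_nonneg_ae (Eventually.of_forall fun _ => by positivity)
      hWm.coe_nnreal_real.aestronglyMeasurable, integral_eq_lintegral_of_nonneg_ae
      (Eventually.of_forall fun _ => by positivity)
      hWm.coe_nnreal_real.aestronglyMeasurable] at this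
    simpa [ENNReal.toReal_mul, Measure.real] using this
  have h1 : ∫ ω, (W ω : ℝ) * φ (R.rw t ω) ∂μ
      = ∫ ω, φ (R.rw t ω) ∂(μ.withDensity fun ω => (W ω : ENNReal)) := by
    rw [integral_withDensity_eq_integral_smul hWm]
    rfl
  rw [h1, ← integral_map (φ := R.rw t) hr.aemeasurable hφ.aestronglyMeasurable, hν,
    integral_smul_measure, smul_eq_mul]
  congr 1
  rw [integral_eq_lintegral_of_nonneg_ae (Eventually.of_forall fun _ => by positivity)
      hWm.coe_nnreal_real.aestronglyMeasurable]
  simp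

theorem ae_reward_mem {t : ℕ} (ht : t < T) : ∀ᵐ ω ∂μ, R.rw t ω ∈ Set.Icc (0 : ℝ) 1 := by
  have hB : MeasurableSet (Set.Icc (0 : ℝ) 1)ᶜ := measurableSet_Icc.compl
  have hr : Measurable (R.rw t) := (R.rw_meas t ht).mono (R.filt.le _) le_rfl
  have h := R.rw_law t ht _ hB
  have h0 : ∫ ω, (R.rw t ⁻¹' (Set.Icc (0 : ℝ) 1)ᶜ).indicator (fun _ => (1 : ℝ)) ω ∂μ = 0 := by
    rw [← integral_condExp (R.filt.le t)]
    rw [integral_congr_ae h]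
    simp [Measure.real, M.rewardLaw_supp]
  rw [integral_indicator_const _ (hr hB)] at h0
  have h1 : μ (R.rw t ⁻¹' (Set.Icc (0 : ℝ) 1)ᶜ) = 0 := by
    simpa [measureReal_eq_zero_iff] using h0
  filter_upwards [measure_eq_zero_iff_ae_notMem.1 h1] with ω hω
  simpa using hω

theorem meanReward_mem (s : Fin S) (a : Fin A) :
    0 ≤ M.meanReward s a ∧ M.meanReward s a ≤ 1 := by
  have := M.rewardLaw_prob s a
  have hae : ∀ᵐ x ∂(M.rewardLaw s a), x ∈ Set.Icc (0 : ℝ) 1 := by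
    filter_upwards [measure_eq_zero_iff_ae_notMem.1 (M.rewardLaw_supp s a)] with x hx
    simpa using hx
  refine ⟨integral_nonneg_of_ae (hae.mono fun x hx => hx.1), ?_⟩
  have hi : Integrable (fun x : ℝ => x) (M.rewardLaw s a) :=
    Integrable.of_bound measurable_id.aestronglyMeasurable 1 (hae.mono fun x hx => by
      rw [Real.norm_eq_abs, abs_of_nonneg hx.1]; exact hx.2)
  calc M.meanReward s a ≤ ∫ _, (1 : ℝ) ∂(M.rewardLaw s a) :=
        integral_mono_ae hi (integrable_const _) (hae.mono fun x hx => hx.2)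
    _ = 1 := by simp

/-- Hoeffding's lemma for the reward distributions. -/
theorem integral_exp_reward_le (c : ℝ) (s : Fin S) (a : Fin A) :
    ∫ x, Real.exp (c * (x - M.meanReward s a)) ∂(M.rewardLaw s a) ≤ Real.exp (c ^ 2) := by
  have := M.rewardLaw_prob s a
  have hae : ∀ᵐ x ∂(M.rewardLaw s a), x ∈ Set.Icc (0 : ℝ) 1 := by
    filter_upwards [measure_eq_zero_iff_ae_notMem.1 (M.rewardLaw_supp s a)] with x hx
    simpa using hx
  have h := (hasSubgaussianMGF_of_mem_Icc (X := fun x : ℝ => x) aemeasurable_id hae).mgf_le c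
  refine h.trans (Real.exp_le_exp.2 ?_)
  norm_num
  nlinarith [sq_nonneg c]

/-- The exponential supermartingale of the rewards; the conditional expectation is computed separately
on the event of each state-action pair. -/
theorem integral_exp_rewardExponent_le {c : ℝ} {J : ℕ → Set Ω}
    (hJ : ∀ i < T, MeasurableSet[R.filt i] (J i)) {n : ℕ} (hn : n ≤ T) :
    Integrable (fun ω => Real.exp (R.rewardExponent c J n ω)) μ ∧
      ∫ ω, Real.exp (R.rewardExponent c J n ω) ∂μ ≤ 1 := by
  have hinc : ∀ i < T, ∀ᵐ ω ∂μ, c * R.rewardIncr i ω ≤ |c| := fun i hi => by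
    filter_upwards [R.ae_reward_mem hi] with ω hω
    have hr := meanReward_mem (M := M) (R.st i ω) (R.ac i ω)
    have : |R.rewardIncr i ω| ≤ 1 :=
      abs_le.2 ⟨by rw [rewardIncr]; linarith [hω.1], by rw [rewardIncr]; linarith [hω.2]⟩
    calc c * R.rewardIncr i ω ≤ |c * R.rewardIncr i ω| := le_abs_self _
      _ ≤ |c| := by rw [abs_mul]; exact mul_le_of_le_one_right (abs_nonneg c) this
  have hint : ∀ n ≤ T, Integrable (fun ω => Real.exp (R.rewardExponent c J n ω)) μ := fun n hn => by
    refine Integrable.of_bound (((R.meas_rewardExponent hJ hn).mono (R.filt.le n) le_rfl).exp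
      |>.aestronglyMeasurable) (Real.exp (n * |c|)) ?_
    have hall : ∀ᵐ ω ∂μ, ∀ i ∈ Finset.range n, c * R.rewardIncr i ω ≤ |c| := by
      rw [Finset.eventually_all]
      exact fun i hi => hinc i ((Finset.mem_range.1 hi).trans_le hn)
    filter_upwards [hall] with ω hω
    rw [Real.norm_eq_abs, Real.abs_exp]
    refine Real.exp_le_exp.2 ?_
    calc R.rewardExponent c J n ω ≤ ∑ i ∈ Finset.range n, |c| := by
          refine Finset.sum_le_sum fun i hi => ?_
          by_cases h : ω ∈ J i
          · rw [Set.indicator_of_mem h]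
            linarith [hω i hi, sq_nonneg c]
          · rw [Set.indicator_of_notMem h]
            linarith [abs_nonneg c, sq_nonneg c]
      _ = n * |c| := by simp
  refine ⟨hint n hn, ?_⟩
  induction n with
  | zero => simp [rewardExponent]
  | succ n ih =>
    have hn' : n < T := hn
    have hm := R.filt.le n
    set D : Fin S × Fin A → Set Ω := fun p => J n ∩ {ω | R.st n ω = p.1 ∧ R.ac n ω = p.2} with hD
    have hDm : ∀ p, MeasurableSet[R.filt n] (D p) := fun p =>
      (hJ n hn').inter (((R.st_meas' le_rfl hn'.le) (measurableSet_singleton p.1)).inter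
        ((R.ac_meas hn') (measurableSet_singleton p.2)))
    set E : Ω → NNReal := fun ω => Real.toNNReal (Real.exp (R.rewardExponent c J n ω - c ^ 2))
      with hE
    have hEr : ∀ ω, (E ω : ℝ) = Real.exp (R.rewardExponent c J n ω) * Real.exp (-c ^ 2) :=
      fun ω => by
        rw [hE, Real.coe_toNNReal _ (Real.exp_pos _).le, sub_eq_add_neg, Real.exp_add]
    have hEm : Measurable[R.filt n] E :=
      (((R.meas_rewardExponent hJ hn'.le).sub measurable_const).exp).real_toNNReal
    have hEi : Integrable (fun ω => (E ω : ℝ)) μ := by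
      simp only [hEr]; exact (hint n hn'.le).mul_const _
    set W : Fin S × Fin A → Ω → NNReal := fun p => (D p).indicator E with hWdef
    have hWr : ∀ p, (fun ω => (W p ω : ℝ)) = (D p).indicator fun ω => (E ω : ℝ) := fun p => by
      funext ω
      by_cases h : ω ∈ D p <;> simp [hWdef, h]
    have hWi : ∀ p, Integrable (fun ω => (W p ω : ℝ)) μ := fun p => by
      rw [hWr]; exact hEi.indicator (hm _ (hDm p))
    set φ : Fin S × Fin A → ℝ → ℝ := fun p x => Real.exp (c * (x - M.meanReward p.1 p.2)) with hφ
    have hφm : ∀ p, Measurable (φ p) := fun p => by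
      simp only [hφ]; fun_prop
    have hone : ∀ p, ∫ ω, (W p ω : ℝ) * φ p (R.rw n ω) ∂μ
        ≤ ∫ ω, (W p ω : ℝ) * Real.exp (c ^ 2) ∂μ := fun p => by
      rw [R.integral_mul_reward hn' (hEm.indicator (hDm p)) (hWi p) (s := p.1) (a := p.2) ?_
        (hφm p), integral_mul_const]
      · refine mul_le_mul_of_nonneg_left (integral_exp_reward_le c p.1 p.2) ?_
        exact integral_nonneg fun ω => by positivity
      · intro ω hω
        by_contra hcon
        exact hω (Set.indicator_of_notMem (fun h => hcon h.2) _)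
    have hprod : ∀ p, Integrable (fun ω => (W p ω : ℝ) * φ p (R.rw n ω)) μ := fun p => by
      refine (hWi p).mul_bdd (c := Real.exp |c|)
        (((hφm p).comp ((R.rw_meas n hn').mono (R.filt.le _) le_rfl)).aestronglyMeasurable) ?_
      filter_upwards [R.ae_reward_mem hn'] with ω hω
      have hr := meanReward_mem (M := M) p.1 p.2
      rw [Real.norm_eq_abs, Real.abs_exp]
      refine Real.exp_le_exp.2 ((le_abs_self _).trans ?_)
      rw [abs_mul]
      exact mul_le_of_le_one_right (abs_nonneg c)
        (abs_le.2 ⟨by linarith [hω.1], by linarith [hω.2]⟩)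
    have hrest : Integrable ((J n)ᶜ.indicator fun ω => (E ω : ℝ)) μ :=
      hEi.indicator (hm _ (hJ n hn').compl)
    have hsplit : ∀ ω, Real.exp (R.rewardExponent c J (n + 1) ω)
        = (J n)ᶜ.indicator (fun ω => (E ω : ℝ)) ω + ∑ p, (W p ω : ℝ) * φ p (R.rw n ω) := fun ω => by
      rw [rewardExponent, Finset.sum_range_succ, ← rewardExponent]
      by_cases h : ω ∈ J n
      · rw [Finset.sum_eq_single (R.st n ω, R.ac n ω)]
        · have hmem : ω ∈ D (R.st n ω, R.ac n ω) := ⟨h, rfl, rfl⟩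
          simp only [hWdef, Set.indicator_of_mem hmem, hEr, hφ, Set.indicator_of_mem h,
            Set.indicator_of_notMem (show ω ∉ (J n)ᶜ from fun h' => h' h), rewardIncr,
            ← Real.exp_add]
          rw [zero_add]
          congr 1
          ring
        · intro p _ hp
          have : ω ∉ D p := fun h' => hp (Prod.ext h'.2.1.symm h'.2.2.symm)
          simp [hWdef, Set.indicator_of_notMem this]
        · simp
      · have : ∀ p, ω ∉ D p := fun p h' => h h'.1
        rw [Finset.sum_eq_zero fun p _ => by simp [hWdef, Set.indicator_of_notMem (this p)],
          Set.indicator_of_mem (show ω ∈ (J n)ᶜ from h), Set.indicator_of_notMem h, hEr,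
          ← Real.exp_add]
        ring_nf
    have hcover : ∀ ω, (J n)ᶜ.indicator (fun ω => (E ω : ℝ)) ω + ∑ p, (W p ω : ℝ) * Real.exp (c ^ 2)
        ≤ Real.exp (R.rewardExponent c J n ω) := fun ω => by
      by_cases h : ω ∈ J n
      · rw [Finset.sum_eq_single (R.st n ω, R.ac n ω)]
        · have hmem : ω ∈ D (R.st n ω, R.ac n ω) := ⟨h, rfl, rfl⟩
          simp only [hWdef, Set.indicator_of_mem hmem, hEr,
            Set.indicator_of_notMem (show ω ∉ (J n)ᶜ from fun h' => h' h), ← Real.exp_add]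
          rw [zero_add]
          exact Real.exp_le_exp.2 (by linarith)
        · intro p _ hp
          have : ω ∉ D p := fun h' => hp (Prod.ext h'.2.1.symm h'.2.2.symm)
          simp [hWdef, Set.indicator_of_notMem this]
        · simp
      · have : ∀ p, ω ∉ D p := fun p h' => h h'.1
        rw [Finset.sum_eq_zero fun p _ => by simp [hWdef, Set.indicator_of_notMem (this p)],
          Set.indicator_of_mem (show ω ∈ (J n)ᶜ from h), hEr, add_zero]
        exact mul_le_of_le_one_right (Real.exp_pos _).le
          (Real.exp_le_one_iff.2 (by linarith [sq_nonneg c]))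
    simp only [hsplit]
    rw [integral_add hrest (integrable_finsetSum _ fun p _ => hprod p),
      integral_finsetSum _ fun p _ => hprod p]
    calc _ ≤ ∫ ω, (J n)ᶜ.indicator (fun ω => (E ω : ℝ)) ω ∂μ
            + ∑ p, ∫ ω, (W p ω : ℝ) * Real.exp (c ^ 2) ∂μ :=
          add_le_add_right (Finset.sum_le_sum fun p _ => hone p) _
      _ = ∫ ω, ((J n)ᶜ.indicator (fun ω => (E ω : ℝ)) ω
            + ∑ p, (W p ω : ℝ) * Real.exp (c ^ 2)) ∂μ := by
          rw [integral_add hrest (integrable_finsetSum _ fun p _ => (hWi p).mul_const _),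
            integral_finsetSum _ fun p _ => (hWi p).mul_const _]
      _ ≤ ∫ ω, Real.exp (R.rewardExponent c J n ω) ∂μ :=
          integral_mono (hrest.add (integrable_finsetSum _ fun p _ => (hWi p).mul_const _))
            (hint n hn'.le) hcover
      _ ≤ 1 := ih hn'.le

end EBF.Run

/-- Markov's inequality and a union bound for finitely many exponential moments. -/
theorem measureReal_exists_ge_le {Ω : Type*} [MeasurableSpace Ω] {μ : Measure Ω}
    [IsProbabilityMeasure μ] {ι : Type*} [Fintype ι] {Y : ι → Ω → ℝ}
    (h : ∀ j, Integrable (fun ω => Real.exp (Y j ω)) μ ∧ ∫ ω, Real.exp (Y j ω) ∂μ ≤ 1) (γ : ℝ) :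
    μ.real {ω | ∃ j, γ ≤ Y j ω} ≤ Fintype.card ι * Real.exp (-γ) := by
  have h1 : ∀ j, μ.real {ω | γ ≤ Y j ω} ≤ Real.exp (-γ) := fun j => by
    have h2 := mul_meas_ge_le_integral_of_nonneg
      (Eventually.of_forall fun ω => (Real.exp_pos (Y j ω)).le) (h j).1 (Real.exp γ)
    simp only [Real.exp_le_exp] at h2
    rw [Real.exp_neg, ← one_div, le_div_iff₀ (Real.exp_pos γ), mul_comm]
    exact h2.trans (h j).2
  have e : {ω | ∃ j, γ ≤ Y j ω} = ⋃ j, {ω | γ ≤ Y j ω} := by ext; simp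
  rw [e]
  calc _ ≤ ∑ j, μ.real {ω | γ ≤ Y j ω} := measureReal_iUnion_fintype_le _
    _ ≤ ∑ _j : ι, Real.exp (-γ) := Finset.sum_le_sum fun j _ => h1 j
    _ = _ := by simp

namespace EBF

/-! ### Visits, episodes and the weights `1 / N_{s,a}` -/

section Visits

variable {S A : ℕ} (st : ℕ → Fin S) (ac : ℕ → Fin A)

theorem visits_succ (t : ℕ) (s : Fin S) (a : Fin A) :
    visits st ac (Finset.range (t + 1)) s a
      = visits st ac (Finset.range t) s a + if st t = s ∧ ac t = a then 1 else 0 := by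
  unfold visits
  rw [Finset.range_add_one, Finset.filter_insert]
  split_ifs with h
  · rw [Finset.card_insert_of_notMem (by simp)]
  · rfl

theorem visits_mono {m n : ℕ} (h : m ≤ n) (s : Fin S) (a : Fin A) :
    visits st ac (Finset.range m) s a ≤ visits st ac (Finset.range n) s a :=
  Finset.card_le_card (Finset.filter_subset_filter _ (Finset.range_subset_range.2 h))

theorem visits_le (n : ℕ) (s : Fin S) (a : Fin A) : visits st ac (Finset.range n) s a ≤ n :=
  (Finset.card_filter_le _ _).trans (by simp)

theorem visits_range_add_Ico {e t : ℕ} (h : e ≤ t) (s : Fin S) (a : Fin A) :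
    visits st ac (Finset.range e) s a + visits st ac (Finset.Ico e t) s a
      = visits st ac (Finset.range t) s a := by
  unfold visits
  rw [← Finset.card_union_of_disjoint]
  · rw [← Finset.filter_union, Finset.range_eq_Ico, Finset.Ico_union_Ico_eq_Ico (Nat.zero_le _) h,
      Finset.range_eq_Ico]
  · refine Finset.disjoint_filter_filter ?_
    rw [Finset.range_eq_Ico]
    exact Finset.Ico_disjoint_Ico_consecutive _ _ _

/-- Regrouping a sum over time by state-action pairs and visit numbers. -/
theorem sum_visits (g : Fin S → Fin A → ℝ) (F : ℕ → ℝ) (n : ℕ) :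
    ∑ t ∈ Finset.range n, g (st t) (ac t) * F (visits st ac (Finset.range t) (st t) (ac t))
      = ∑ s, ∑ a, g s a * ∑ j ∈ Finset.range (visits st ac (Finset.range n) s a), F j := by
  induction n with
  | zero => simp [visits]
  | succ n ih =>
    rw [Finset.sum_range_succ, ih]
    have h : ∀ s a, g s a * ∑ j ∈ Finset.range (visits st ac (Finset.range (n + 1)) s a), F j
        = g s a * ∑ j ∈ Finset.range (visits st ac (Finset.range n) s a), F j
          + if st n = s then
              if ac n = a then g s a * F (visits st ac (Finset.range n) s a) else 0 else 0 := by
      intro s a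
      rw [visits_succ]
      by_cases h1 : st n = s <;> by_cases h2 : ac n = a <;>
        simp [h1, h2, Finset.sum_range_succ, mul_add]
    simp only [h, Finset.sum_add_distrib]
    congr 1
    rw [Finset.sum_eq_single (st n) (fun s _ hs => by simp [hs.symm]) (by simp)]
    simp

theorem episodeStart_le (t : ℕ) : episodeStart st ac t ≤ t := by
  induction t with
  | zero => simp [episodeStart]
  | succ t ih =>
    rw [episodeStart]
    split_ifs
    · exact le_rfl
    · exact ih.trans (Nat.le_succ t)

theorem visits_episode_lt (t : ℕ) (s : Fin S) (a : Fin A) :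
    visits st ac (Finset.Ico (episodeStart st ac t) t) s a
      < max (visits st ac (Finset.range (episodeStart st ac t)) s a) 1 := by
  induction t with
  | zero => simp [episodeStart, visits]
  | succ t ih =>
    rw [episodeStart]
    split_ifs with h
    · simp [visits]
    · push Not at h
      exact h s a

theorem episodeStart_succ_of_ne {t : ℕ} (h : episodeStart st ac (t + 1) ≠ t + 1) :
    episodeStart st ac (t + 1) = episodeStart st ac t := by
  rw [episodeStart] at h ⊢
  split_ifs at h ⊢ with hc
  · exact absurd rfl h
  · rfl

theorem exists_of_episodeStart_succ {t : ℕ} (h : episodeStart st ac (t + 1) = t + 1) :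
    ∃ s a, max (visits st ac (Finset.range (episodeStart st ac t)) s a) 1
        ≤ visits st ac (Finset.Ico (episodeStart st ac t) (t + 1)) s a := by
  by_contra hc
  rw [episodeStart] at h
  rw [if_neg hc] at h
  have := episodeStart_le st ac t
  omega

theorem one_le_cnt (N : ℕ) (s : Fin S) (a : Fin A) : 1 ≤ cnt st ac N s a := le_max_right _ _

theorem cnt_pos (N : ℕ) (s : Fin S) (a : Fin A) : 0 < cnt st ac N s a :=
  zero_lt_one.trans_le (one_le_cnt st ac N s a)

/-- The weight `1 / N_{s_t,a_t}` of step `t`, with the count at the start of the episode. -/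
def weight (t : ℕ) : ℝ := (cnt st ac (episodeStart st ac t) (st t) (ac t))⁻¹

theorem weight_pos (t : ℕ) : 0 < weight st ac t := inv_pos.2 (cnt_pos _ _ _ _ _)

/-- Within an episode a count at most doubles. -/
theorem weight_le (t : ℕ) :
    weight st ac t ≤ 2 * ((visits st ac (Finset.range t) (st t) (ac t) : ℝ) + 1)⁻¹ := by
  have h1 := visits_episode_lt st ac t (st t) (ac t)
  have h2 := visits_range_add_Ico st ac (episodeStart_le st ac t) (st t) (ac t)
  set e := episodeStart st ac t
  set m := visits st ac (Finset.range e) (st t) (ac t) with hm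
  have h3 : visits st ac (Finset.range t) (st t) (ac t) + 1 ≤ 2 * max m 1 := by omega
  have h4 : ((visits st ac (Finset.range t) (st t) (ac t) : ℝ) + 1)
      ≤ 2 * cnt st ac e (st t) (ac t) := by
    have : ((visits st ac (Finset.range t) (st t) (ac t) + 1 : ℕ) : ℝ)
        ≤ ((2 * max m 1 : ℕ) : ℝ) := by exact_mod_cast h3
    push_cast at this
    rw [cnt, ← hm]
    exact this
  rw [weight, ← one_div, ← div_eq_mul_inv, div_le_div_iff₀ (cnt_pos _ _ _ _ _) (by positivity)]
  linarith

theorem sum_inv_sqrt_le (n : ℕ) :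
    ∑ j ∈ Finset.range n, √(((j : ℝ) + 1)⁻¹) ≤ 2 * √n := by
  induction n with
  | zero => simp
  | succ n ih =>
    rw [Finset.sum_range_succ]
    have h0 : 0 < √((n : ℝ) + 1) := Real.sqrt_pos.2 (by positivity)
    have h1 : √((n : ℝ) + 1) ^ 2 = n + 1 := Real.sq_sqrt (by positivity)
    have h2 : √(n : ℝ) ^ 2 = n := Real.sq_sqrt (by positivity)
    have h3 : √(((n : ℝ) + 1)⁻¹) ≤ 2 * √((n : ℝ) + 1) - 2 * √(n : ℝ) := by
      rw [Real.sqrt_inv, ← one_div, div_le_iff₀ h0]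
      nlinarith [sq_nonneg (√((n : ℝ) + 1) - √(n : ℝ))]
    push_cast
    linarith

theorem sum_inv_le {n T : ℕ} (hn : n ≤ T) :
    ∑ j ∈ Finset.range n, ((j : ℝ) + 1)⁻¹ ≤ 1 + Real.log T := by
  have h : ∑ j ∈ Finset.range n, ((j : ℝ) + 1)⁻¹ ≤ ∑ j ∈ Finset.range T, ((j : ℝ) + 1)⁻¹ :=
    Finset.sum_le_sum_of_subset_of_nonneg (Finset.range_subset_range.2 hn)
      fun _ _ _ => by positivity
  refine h.trans ?_
  have := harmonic_le_one_add_log T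
  simpa [harmonic] using this

theorem sum_weight_le {n T : ℕ} (hn : n ≤ T) :
    ∑ t ∈ Finset.range n, weight st ac t ≤ 2 * (S * A * (1 + Real.log T)) := by
  have h := sum_visits st ac (fun _ _ => 2) (fun j => ((j : ℝ) + 1)⁻¹) n
  refine (Finset.sum_le_sum fun t _ => weight_le st ac t).trans (h.le.trans ?_)
  calc _ ≤ ∑ _s : Fin S, ∑ _a : Fin A, 2 * (1 + Real.log T) := by
        refine Finset.sum_le_sum fun s _ => Finset.sum_le_sum fun a _ => ?_
        exact mul_le_mul_of_nonneg_left (sum_inv_le ((visits_le st ac n s a).trans hn))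
          (by norm_num)
    _ = _ := by simp; ring

/-- The sum of `√(g² / N)` along a trajectory; there is no logarithmic factor, since `g` depends on
the state-action pair only. -/
theorem sum_sqrt_weight_mul_le {g : Fin S → Fin A → ℝ} (hg : ∀ s a, 0 ≤ g s a) (n : ℕ) :
    ∑ t ∈ Finset.range n, √(weight st ac t) * g (st t) (ac t)
      ≤ 3 * √(S * A * ∑ t ∈ Finset.range n, g (st t) (ac t) ^ 2) := by
  have h1 : ∀ t, √(weight st ac t) * g (st t) (ac t) ≤ √2 * (g (st t) (ac t) *
      √(((visits st ac (Finset.range t) (st t) (ac t) : ℝ) + 1)⁻¹)) := fun t => by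
    have := Real.sqrt_le_sqrt (weight_le st ac t)
    rw [Real.sqrt_mul (by norm_num)] at this
    calc _ ≤ (√2 * √(((visits st ac (Finset.range t) (st t) (ac t) : ℝ) + 1)⁻¹)) *
            g (st t) (ac t) := mul_le_mul_of_nonneg_right this (hg _ _)
      _ = _ := by ring
  have h2 := sum_visits st ac g (fun j => √(((j : ℝ) + 1)⁻¹)) n
  have h3 := sum_visits st ac (fun s a => g s a ^ 2) (fun _ => 1) n
  simp only [mul_one, Finset.sum_const, Finset.card_range, nsmul_eq_mul] at h3
  have h4 : ∑ s, ∑ a, g s a * √(visits st ac (Finset.range n) s a : ℝ)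
      ≤ √(S * A * ∑ t ∈ Finset.range n, g (st t) (ac t) ^ 2) := by
    refine Real.le_sqrt_of_sq_le ?_
    rw [h3, ← Finset.sum_product', ← Finset.sum_product']
    refine (sq_sum_le_card_mul_sum_sq).trans (le_of_eq ?_)
    simp only [Finset.card_product, Finset.card_univ, Fintype.card_fin, Nat.cast_mul]
    congr 1
    exact Finset.sum_congr rfl fun p _ => by rw [mul_pow, Real.sq_sqrt (by positivity)]
  have hs : √2 * 2 ≤ (3 : ℝ) := by
    have : √2 ≤ 3 / 2 := by rw [Real.sqrt_le_left (by norm_num)]; norm_num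
    linarith
  calc _ ≤ √2 * ∑ s, ∑ a, g s a * ∑ j ∈ Finset.range (visits st ac (Finset.range n) s a),
          √(((j : ℝ) + 1)⁻¹) := by
        rw [← h2, Finset.mul_sum]; exact Finset.sum_le_sum fun t _ => h1 t
    _ ≤ √2 * ∑ s, ∑ a, 2 * (g s a * √(visits st ac (Finset.range n) s a : ℝ)) := by
        refine mul_le_mul_of_nonneg_left (Finset.sum_le_sum fun s _ => Finset.sum_le_sum
          fun a _ => ?_) (Real.sqrt_nonneg 2)
        calc _ ≤ g s a * (2 * √(visits st ac (Finset.range n) s a : ℝ)) :=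
              mul_le_mul_of_nonneg_left (sum_inv_sqrt_le _) (hg s a)
          _ = _ := by ring
    _ = √2 * 2 * ∑ s, ∑ a, g s a * √(visits st ac (Finset.range n) s a : ℝ) := by
        simp only [← Finset.mul_sum]; ring
    _ ≤ 3 * ∑ s, ∑ a, g s a * √(visits st ac (Finset.range n) s a : ℝ) :=
        mul_le_mul_of_nonneg_right hs (Finset.sum_nonneg fun s _ => Finset.sum_nonneg fun a _ =>
          mul_nonneg (hg s a) (Real.sqrt_nonneg _))
    _ ≤ _ := mul_le_mul_of_nonneg_left h4 (by norm_num)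

theorem sum_sqrt_weight_le {n T : ℕ} (hn : n ≤ T) :
    ∑ t ∈ Finset.range n, √(weight st ac t) ≤ 3 * √(S * A * T) := by
  have h := sum_sqrt_weight_mul_le st ac (g := fun _ _ => 1) (fun _ _ => zero_le_one) n
  simp only [mul_one, one_pow, Finset.sum_const, Finset.card_range, nsmul_eq_mul] at h
  refine h.trans (mul_le_mul_of_nonneg_left (Real.sqrt_le_sqrt ?_) (by norm_num))
  exact mul_le_mul_of_nonneg_left (by exact_mod_cast hn) (by positivity)

/-- By the Cauchy–Schwarz inequality the sum of `N^{-3/4}` is of order `T^{1/4}`. -/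
theorem sum_weight_three_quarters_le {n T : ℕ} (hn : n ≤ T) :
    ∑ t ∈ Finset.range n, √(√(weight st ac t)) ^ 3
      ≤ √(2 * (S * A * (1 + Real.log T))) * √(3 * √(S * A * T)) := by
  have h := Real.sum_mul_le_sqrt_mul_sqrt (Finset.range n) (fun t => √(weight st ac t))
    (fun t => √(√(weight st ac t)))
  have e1 : ∀ t, √(weight st ac t) ^ 2 = weight st ac t := fun t =>
    Real.sq_sqrt (weight_pos st ac t).le
  have e2 : ∀ t, √(√(weight st ac t)) ^ 2 = √(weight st ac t) := fun t =>
    Real.sq_sqrt (Real.sqrt_nonneg _)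
  simp only [e1, e2] at h
  have e3 : ∀ t, √(√(weight st ac t)) ^ 3 = √(weight st ac t) * √(√(weight st ac t)) := fun t => by
    rw [pow_succ, e2]
  simp only [e3]
  exact h.trans (mul_le_mul (Real.sqrt_le_sqrt (sum_weight_le st ac hn))
    (Real.sqrt_le_sqrt (sum_sqrt_weight_le st ac hn)) (Real.sqrt_nonneg _) (Real.sqrt_nonneg _))

/-- Every new episode increases the binary length of the count of some state-action pair. -/
theorem card_episodes_le_size (n : ℕ) :
    ((Finset.range n).filter fun i => episodeStart st ac (i + 1) = i + 1).card
      ≤ ∑ s, ∑ a, (visits st ac (Finset.range (episodeStart st ac n)) s a).size := by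
  induction n with
  | zero => simp
  | succ n ih =>
    rw [Finset.range_add_one, Finset.filter_insert]
    split_ifs with h
    · rw [Finset.card_insert_of_notMem (by simp)]
      obtain ⟨s₀, a₀, h₀⟩ := exists_of_episodeStart_succ st ac h
      have hle : episodeStart st ac n ≤ n + 1 := (episodeStart_le st ac n).trans (Nat.le_succ n)
      have hmono : ∀ s a, (visits st ac (Finset.range (episodeStart st ac n)) s a).size
          ≤ (visits st ac (Finset.range (n + 1)) s a).size := fun s a =>
        Nat.size_le_size (visits_mono st ac hle s a)
      have hlt : (visits st ac (Finset.range (episodeStart st ac n)) s₀ a₀).size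
          < (visits st ac (Finset.range (n + 1)) s₀ a₀).size := by
        have h2 := visits_range_add_Ico st ac hle s₀ a₀
        set m := visits st ac (Finset.range (episodeStart st ac n)) s₀ a₀
        rw [Nat.lt_size]
        by_cases hm : m = 0
        · simp only [hm, Nat.size_zero, pow_zero]; omega
        · obtain ⟨k, hk⟩ : ∃ k, m.size = k + 1 :=
            Nat.exists_eq_succ_of_ne_zero (Nat.size_pos.2 (Nat.pos_of_ne_zero hm)).ne'
          have : 2 ^ k ≤ m := Nat.lt_size.1 (by omega)
          rw [hk, pow_succ]
          omega
      rw [h]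
      refine lt_of_le_of_lt ih ?_
      refine Finset.sum_lt_sum (fun s _ => Finset.sum_le_sum fun a _ => hmono s a)
        ⟨s₀, Finset.mem_univ _, Finset.sum_lt_sum (fun a _ => hmono s₀ a)
          ⟨a₀, Finset.mem_univ _, hlt⟩⟩
    · rw [episodeStart_succ_of_ne st ac h]
      exact ih

theorem size_le_log {n T : ℕ} (hn : n ≤ T) (hT : 1 ≤ T) : (n.size : ℝ) ≤ 2 * (1 + Real.log T) := by
  have hlog : 0 ≤ Real.log T := Real.log_nonneg (by exact_mod_cast hT)
  rcases Nat.eq_zero_or_pos n with h0 | h0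
  · simp only [h0, Nat.size_zero, Nat.cast_zero]; positivity
  · obtain ⟨k, hk⟩ : ∃ k, n.size = k + 1 :=
      Nat.exists_eq_succ_of_ne_zero (Nat.size_pos.2 h0).ne'
    have h1 : 2 ^ k ≤ T := (Nat.lt_size.1 (by omega)).trans hn
    have h2 : (k : ℝ) * Real.log 2 ≤ Real.log T := by
      rw [← Real.log_pow]
      exact Real.log_le_log (by positivity) (by exact_mod_cast h1)
    rw [hk]
    push_cast
    nlinarith [Real.log_two_gt_d9, (Nat.cast_nonneg k : (0 : ℝ) ≤ k)]

theorem card_episodes_le {n T : ℕ} (hn : n ≤ T) (hT : 1 ≤ T) :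
    (((Finset.range n).filter fun i => episodeStart st ac (i + 1) = i + 1).card : ℝ)
      ≤ 2 * (S * A * (1 + Real.log T)) := by
  have h := card_episodes_le_size st ac n
  calc _ ≤ ((∑ s, ∑ a, (visits st ac (Finset.range (episodeStart st ac n)) s a).size : ℕ) : ℝ) := by
        exact_mod_cast h
    _ ≤ ∑ _s : Fin S, ∑ _a : Fin A, 2 * (1 + Real.log T) := by
        push_cast
        refine Finset.sum_le_sum fun s _ => Finset.sum_le_sum fun a _ => size_le_log ?_ hT
        exact (visits_le st ac _ s a).trans ((episodeStart_le st ac n).trans hn)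
    _ = _ := by simp; ring

/-- Telescoping of functions with values in `[0,H]` that change at the start of an episode only. -/
theorem sum_telescope_le {H : ℝ} (hH : 0 ≤ H) {h : ℕ → Fin S → ℝ} {n T : ℕ} (hn : n ≤ T)
    (hT : 1 ≤ T) (hh : ∀ t < n, ∀ s, 0 ≤ h t s ∧ h t s ≤ H)
    (hc : ∀ t, t + 1 < n → episodeStart st ac (t + 1) ≠ t + 1 → h (t + 1) = h t) :
    ∑ t ∈ Finset.range n, (h t (st (t + 1)) - h t (st t))
      ≤ H * (2 * (S * A * (1 + Real.log T)) + 1) := by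
  have key : ∀ m, m < n → ∑ t ∈ Finset.range (m + 1), (h t (st (t + 1)) - h t (st t))
      ≤ H * ((Finset.range m).filter fun i => episodeStart st ac (i + 1) = i + 1).card
        + h m (st (m + 1)) := by
    intro m
    induction m with
    | zero => intro hm; simp [(hh 0 hm _).1]
    | succ m ih =>
      intro hm
      have h1 := ih (by omega)
      rw [Finset.sum_range_succ]
      have hins : (Finset.range (m + 1)).filter (fun i => episodeStart st ac (i + 1) = i + 1)
          = if episodeStart st ac (m + 1) = m + 1
            then insert m ((Finset.range m).filter fun i => episodeStart st ac (i + 1) = i + 1)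
            else (Finset.range m).filter fun i => episodeStart st ac (i + 1) = i + 1 := by
        rw [Finset.range_add_one, Finset.filter_insert]
      rw [hins]
      split_ifs with hs
      · rw [Finset.card_insert_of_notMem (by simp)]
        push_cast
        have h2 := (hh m (by omega) (st (m + 1))).2
        have h3 := (hh (m + 1) hm (st (m + 1))).1
        linarith
      · rw [hc m hm hs]
        linarith
  have hlog : 0 ≤ Real.log T := Real.log_nonneg (by exact_mod_cast hT)
  rcases Nat.eq_zero_or_pos n with h0 | h0
  · subst h0
    simp only [Finset.range_zero, Finset.sum_empty]
    positivity
  · obtain ⟨m, rfl⟩ : ∃ m, n = m + 1 := ⟨n - 1, by omega⟩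
    have h1 := key m (by omega)
    have h2 := card_episodes_le st ac (n := m) (T := T) (by omega) hT
    have h3 := (hh m (by omega) (st (m + 1))).2
    nlinarith [mul_le_mul_of_nonneg_left h2 hH]

end Visits

/-! ### The segments between arrivals -/

section Segments

variable {S : ℕ} (st : ℕ → Fin S)

theorem nextVisit_le {N : ℕ} {x : Fin S} {t i : ℕ} (hi : t ≤ i) (hx : st i = x) :
    nextVisit st N x t ≤ i :=
  Nat.sInf_le (Set.mem_insert_of_mem _ ⟨hi, hx⟩)

theorem nextVisit_spec {N : ℕ} {x : Fin S} {t : ℕ} (h : nextVisit st N x t ≤ N) :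
    t ≤ nextVisit st N x t ∧ st (nextVisit st N x t) = x := by
  rcases Nat.sInf_mem (s := insert (N + 1) {i | t ≤ i ∧ st i = x}) (Set.insert_nonempty _ _)
    with h1 | h1
  · rw [nextVisit] at h
    omega
  · exact h1

theorem nextVisit_not {N : ℕ} {x : Fin S} {t i : ℕ} (h1 : t ≤ i) (h2 : i < nextVisit st N x t) :
    st i ≠ x := fun h => absurd (nextVisit_le st (N := N) h1 h) (not_le.2 h2)

/-- Whether step `i` lies in a segment that starts with a visit of `s` and ends with the next visit
of `s'`. Unlike membership in a completed segment, this is known at step `i`. -/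
def inSegment (s s' : Fin S) : ℕ → Prop
  | 0 => st 0 = s
  | i + 1 => st (i + 1) = s ∨ (inSegment s s' i ∧ st (i + 1) ≠ s')

theorem inSegment_of_visit {s : Fin S} (s' : Fin S) {i : ℕ} (h : st i = s) :
    inSegment st s s' i := by
  cases i with
  | zero => exact h
  | succ i => exact Or.inl h

open Classical in
/-- The first completed segment after a time `t₀` that is not within a segment: it is the set of the
times up to the arrival `e` at which `inSegment` holds. -/
theorem sum_inSegment_of_nextVisit {s s' : Fin S} (hss : s ≠ s') {N t₀ b e : ℕ}
    (h₀ : t₀ = 0 ∨ ∃ i, t₀ = i + 1 ∧ ¬ inSegment st s s' i)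
    (hb : b = nextVisit st N s t₀) (he : e = nextVisit st N s' (b + 1)) (heN : e ≤ N) :
    t₀ ≤ b ∧ b < e ∧ st b = s ∧ st e = s' ∧ ¬ inSegment st s s' e ∧
      ∀ x : ℕ → ℝ, ∑ i ∈ Finset.Ico t₀ (e + 1), (if inSegment st s s' i then x i else 0)
        = ∑ i ∈ Finset.Ico b e, x i := by
  obtain ⟨he1, he2⟩ := nextVisit_spec st (he ▸ heN)
  rw [← he] at he1 he2
  obtain ⟨hb1, hb2⟩ := nextVisit_spec st (N := N) (x := s) (t := t₀) (by omega)
  rw [← hb] at hb1 hb2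
  have hout : ∀ i, t₀ ≤ i → i < b → ¬ inSegment st s s' i := by
    intro i hi
    induction i, hi using Nat.le_induction with
    | base =>
      intro hlt
      have hne := nextVisit_not st le_rfl (hb ▸ hlt)
      rcases h₀ with h | ⟨j, hj, hj'⟩
      · subst h; exact hne
      · subst hj
        rintro (h | h)
        · exact hne h
        · exact hj' h.1
    | succ i hi ih =>
      intro hlt
      have hne := nextVisit_not st (hi.trans (Nat.le_succ i)) (hb ▸ hlt)
      rintro (h | h)
      · exact hne h
      · exact ih (by omega) h.1
  have hin : ∀ i, b ≤ i → i < e → inSegment st s s' i := by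
    intro i hi
    induction i, hi using Nat.le_induction with
    | base => intro _; exact inSegment_of_visit st s' hb2
    | succ i hi ih =>
      intro hlt
      exact Or.inr ⟨ih (by omega), nextVisit_not st (by omega) (he ▸ hlt)⟩
  have hend : ¬ inSegment st s s' e := by
    obtain ⟨k, hk⟩ : ∃ k, e = k + 1 := ⟨e - 1, by omega⟩
    subst hk
    rintro (h | h)
    · exact hss (h.symm.trans he2)
    · exact h.2 he2
  refine ⟨hb1, by omega, hb2, he2, hend, fun x => ?_⟩
  rw [Finset.sum_Ico_succ_top (by omega), if_neg hend, add_zero,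
    ← Finset.sum_Ico_consecutive _ hb1 (by omega : b ≤ e)]
  rw [Finset.sum_eq_zero fun i hi => if_neg (hout i (Finset.mem_Ico.1 hi).1 (Finset.mem_Ico.1 hi).2),
    zero_add]
  exact Finset.sum_congr rfl fun i hi =>
    if_pos (hin i (Finset.mem_Ico.1 hi).1 (Finset.mem_Ico.1 hi).2)

theorem arrivalSeg_snd_le_of_succ {N k : ℕ} {s s' : Fin S}
    (h : (arrivalSeg st N s s' (k + 1)).2 ≤ N) : (arrivalSeg st N s s' k).2 ≤ N := by
  simp only [arrivalSeg] at h
  have h1 := nextVisit_spec st h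
  have h2 := nextVisit_spec st (N := N) (x := s) (t := (arrivalSeg st N s s' k).2 + 1) (by omega)
  omega

open Classical in
/-- The segments up to the `k`-th arrival make up the times at which `inSegment` holds. -/
theorem arrivalSeg_spec {s s' : Fin S} (hss : s ≠ s') {N : ℕ} (k : ℕ)
    (h : (arrivalSeg st N s s' k).2 ≤ N) :
    k ≤ (arrivalSeg st N s s' k).2 ∧
    (arrivalSeg st N s s' k).1 < (arrivalSeg st N s s' k).2 ∧
    st (arrivalSeg st N s s' k).1 = s ∧ st (arrivalSeg st N s s' k).2 = s' ∧
    ¬ inSegment st s s' (arrivalSeg st N s s' k).2 ∧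
    ∀ x : ℕ → ℝ, ∑ j ∈ Finset.range (k + 1), ∑ i ∈ Finset.Ico (arrivalSeg st N s s' j).1
        (arrivalSeg st N s s' j).2, x i
      = ∑ i ∈ Finset.range ((arrivalSeg st N s s' k).2 + 1),
          if inSegment st s s' i then x i else 0 := by
  induction k with
  | zero =>
    obtain ⟨h1, h2, h3, h4, h5, h6⟩ := sum_inSegment_of_nextVisit st hss (N := N) (t₀ := 0)
      (Or.inl rfl) rfl rfl h
    refine ⟨Nat.zero_le _, h2, h3, h4, h5, fun x => ?_⟩
    rw [Finset.sum_range_one, Finset.range_eq_Ico]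
    exact (h6 x).symm
  | succ k ih =>
    obtain ⟨i1, i2, i3, i4, i5, i6⟩ := ih (arrivalSeg_snd_le_of_succ st h)
    obtain ⟨h1, h2, h3, h4, h5, h6⟩ := sum_inSegment_of_nextVisit st hss (N := N)
      (t₀ := (arrivalSeg st N s s' k).2 + 1) (Or.inr ⟨_, rfl, i5⟩) rfl rfl h
    have h1' : (arrivalSeg st N s s' k).2 + 1 ≤ (arrivalSeg st N s s' (k + 1)).1 := h1
    have h2' : (arrivalSeg st N s s' (k + 1)).1 < (arrivalSeg st N s s' (k + 1)).2 := h2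
    refine ⟨by omega, h2, h3, h4, h5, fun x => ?_⟩
    rw [Finset.sum_range_succ, i6 x, Finset.range_eq_Ico, Finset.range_eq_Ico,
      ← Finset.sum_Ico_consecutive _ (Nat.zero_le _)
        (by omega : (arrivalSeg st N s s' k).2 + 1 ≤ (arrivalSeg st N s s' (k + 1)).2 + 1)]
    congr 1
    exact (h6 x).symm

theorem lt_arrivals_iff {s s' : Fin S} (hss : s ≠ s') {N k : ℕ} :
    k < arrivals st N s s' ↔ (arrivalSeg st N s s' k).2 ≤ N := by
  have hdown : ∀ k, (arrivalSeg st N s s' k).2 ≤ N → ∀ j ≤ k, (arrivalSeg st N s s' j).2 ≤ N := by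
    intro k
    induction k with
    | zero => intro h j hj; rwa [Nat.le_zero.1 hj]
    | succ k ih =>
      intro h j hj
      rcases Nat.lt_or_eq_of_le hj with h' | h'
      · exact ih (arrivalSeg_snd_le_of_succ st h) j (by omega)
      · rwa [h']
  have hlt : ∀ k, (arrivalSeg st N s s' k).2 ≤ N → k < arrivals st N s s' := by
    intro k h
    have : Finset.range (k + 1) ⊆ (Finset.range (N + 1)).filter
        fun k => (arrivalSeg st N s s' k).2 ≤ N := by
      intro j hj
      have hj' := hdown k h j (by simpa [Nat.lt_succ_iff] using hj)
      have := (arrivalSeg_spec st hss j hj').1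
      simp only [Finset.mem_filter, Finset.mem_range]
      exact ⟨by omega, hj'⟩
    have := Finset.card_le_card this
    rw [Finset.card_range] at this
    exact this
  refine ⟨fun h => ?_, hlt k⟩
  have hsub : (Finset.range (N + 1)).filter (fun k => (arrivalSeg st N s s' k).2 ≤ N)
      ⊆ Finset.range (arrivals st N s s') := fun j hj =>
    Finset.mem_range.2 (hlt j (Finset.mem_filter.1 hj).2)
  have heq := Finset.eq_of_subset_of_card_le hsub (by rw [Finset.card_range]; rfl)
  have : k ∈ Finset.range (arrivals st N s s') := Finset.mem_range.2 h
  rw [← heq] at this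
  exact (Finset.mem_filter.1 this).2

open Classical in
/-- `L₁` as a sum of a predictable selection of steps, up to the last arrival `τ`; the difference
`h_{s'} - h_s` is written as the sum of the increments of `h` over the segment. -/
theorem biasStat_eq_sum {s s' : Fin S} (hss : s ≠ s') (N : ℕ) :
    ∃ τ ≤ N, ∀ (rw : ℕ → ℝ) (h : Fin S → ℝ), biasStat st rw N h s s'
      = ∑ i ∈ Finset.range τ, if inSegment st s s' i then
          h (st (i + 1)) - h (st i) + (rw i - empReward rw N) else 0 := by
  have hseg : ∀ (rw : ℕ → ℝ) (h : Fin S → ℝ), biasStat st rw N h s s'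
      = ∑ k ∈ Finset.range (arrivals st N s s'), ∑ i ∈ Finset.Ico (arrivalSeg st N s s' k).1
          (arrivalSeg st N s s' k).2, (h (st (i + 1)) - h (st i) + (rw i - empReward rw N)) := by
    intro rw h
    refine Finset.sum_congr rfl fun k hk => ?_
    obtain ⟨_, h2, h3, h4, _⟩ := arrivalSeg_spec st hss k
      ((lt_arrivals_iff st hss).1 (Finset.mem_range.1 hk))
    rw [Finset.sum_add_distrib, Finset.sum_Ico_sub (fun i => h (st i)) h2.le, h3, h4]
  rcases Nat.eq_zero_or_pos (arrivals st N s s') with h0 | h0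
  · exact ⟨0, Nat.zero_le _, fun rw h => by rw [hseg, h0]; simp⟩
  · obtain ⟨c, hc⟩ : ∃ c, arrivals st N s s' = c + 1 := ⟨arrivals st N s s' - 1, by omega⟩
    have hcN : (arrivalSeg st N s s' c).2 ≤ N := (lt_arrivals_iff st hss).1 (by omega)
    obtain ⟨_, _, _, _, h5, h6⟩ := arrivalSeg_spec st hss c hcN
    refine ⟨_, hcN, fun rw h => ?_⟩
    rw [hseg, hc, h6, Finset.sum_range_succ, if_neg h5, add_zero]

/-- Every transition from `s` to `s'` completes a segment, and each segment contains one arrival at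
`s'` only. -/
theorem card_transitions_le_arrivals {s s' : Fin S} (hss : s ≠ s') (N : ℕ) :
    ((Finset.range N).filter fun i => st i = s ∧ st (i + 1) = s').card ≤ arrivals st N s s' := by
  classical
  have hbefore : ∀ e : ℕ, (∀ i, e ≤ i → i < N → ¬ (st i = s ∧ st (i + 1) = s')) →
      (((Finset.range N).filter fun i => st i = s ∧ st (i + 1) = s').card : ℝ)
        ≤ ∑ i ∈ Finset.range e, if inSegment st s s' i then
          (if st (i + 1) = s' then (1 : ℝ) else 0) else 0 := by
    intro e he
    have hsub : (Finset.range N).filter (fun i => st i = s ∧ st (i + 1) = s')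
        ⊆ (Finset.range e).filter fun i => inSegment st s s' i ∧ st (i + 1) = s' := by
      intro i hi
      simp only [Finset.mem_filter, Finset.mem_range] at hi ⊢
      refine ⟨?_, inSegment_of_visit st s' hi.2.1, hi.2.2⟩
      by_contra hcon
      exact he i (by omega) hi.1 hi.2
    have h1 : (((Finset.range e).filter fun i => inSegment st s s' i ∧ st (i + 1) = s').card : ℝ)
        = ∑ i ∈ Finset.range e, if inSegment st s s' i then
          (if st (i + 1) = s' then (1 : ℝ) else 0) else 0 := by
      rw [Finset.card_filter]
      push_cast
      refine Finset.sum_congr rfl fun i _ => ?_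
      by_cases h1 : inSegment st s s' i <;> by_cases h2 : st (i + 1) = s' <;> simp [h1, h2]
    rw [← h1]
    exact_mod_cast Finset.card_le_card hsub
  have hlast : ∀ t₀, (∀ k, (arrivalSeg st N s s' k).1 = nextVisit st N s t₀ →
      k = arrivals st N s s' → ∀ i, t₀ ≤ i → i < N → ¬ (st i = s ∧ st (i + 1) = s')) := by
    rintro t₀ k hk hkc i hi hiN ⟨h1, h2⟩
    have hb : (arrivalSeg st N s s' k).1 ≤ i := hk ▸ nextVisit_le st hi h1
    have hsnd : (arrivalSeg st N s s' k).2
        = nextVisit st N s' ((arrivalSeg st N s s' k).1 + 1) := by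
      cases k <;> rfl
    have he : (arrivalSeg st N s s' k).2 ≤ i + 1 := hsnd ▸ nextVisit_le st (by omega) h2
    have := (lt_arrivals_iff st hss (N := N) (k := k)).2 (by omega)
    omega
  rcases Nat.eq_zero_or_pos (arrivals st N s s') with h0 | h0
  · have := hbefore 0 (fun i => hlast 0 0 rfl h0.symm i)
    simp only [Finset.range_zero, Finset.sum_empty] at this
    exact_mod_cast this.trans (Nat.cast_nonneg _)
  · obtain ⟨c, hc⟩ : ∃ c, arrivals st N s s' = c + 1 := ⟨arrivals st N s s' - 1, by omega⟩
    obtain ⟨_, _, _, _, h5, h6⟩ := arrivalSeg_spec st hss c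
      ((lt_arrivals_iff st hss (N := N)).1 (by omega))
    have h7 := hbefore ((arrivalSeg st N s s' c).2 + 1)
      (fun i => hlast _ (c + 1) rfl hc.symm i)
    rw [← h6] at h7
    have h8 : ∀ k ∈ Finset.range (c + 1), ∑ i ∈ Finset.Ico (arrivalSeg st N s s' k).1
        (arrivalSeg st N s s' k).2, (if st (i + 1) = s' then (1 : ℝ) else 0) ≤ 1 := by
      intro k hk
      obtain ⟨_, g2, _⟩ := arrivalSeg_spec st hss k
        ((lt_arrivals_iff st hss).1 (by rw [hc]; exact Finset.mem_range.1 hk))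
      have hsnd : (arrivalSeg st N s s' k).2
          = nextVisit st N s' ((arrivalSeg st N s s' k).1 + 1) := by
        cases k <;> rfl
      rw [Finset.sum_eq_single ((arrivalSeg st N s s' k).2 - 1)]
      · split_ifs <;> norm_num
      · intro i hi hne
        rw [Finset.mem_Ico] at hi
        refine if_neg (nextVisit_not st (N := N) (t := (arrivalSeg st N s s' k).1 + 1)
          (by omega) ?_)
        rw [← hsnd]
        omega
      · intro hn
        exact absurd (Finset.mem_Ico.2 ⟨by omega, by omega⟩) hn
    have h9 := h7.trans (Finset.sum_le_sum h8)
    simp only [Finset.sum_const, Finset.card_range, nsmul_eq_mul, mul_one] at h9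
    rw [hc]
    exact_mod_cast h9

/-- The rewards cancel in the difference of two values of `L₁`. -/
theorem biasStat_sub (rw : ℕ → ℝ) (N : ℕ) (h h' : Fin S → ℝ) (s s' : Fin S) :
    biasStat st rw N h s s' - biasStat st rw N h' s s'
      = arrivals st N s s' * ((h s' - h s) - (h' s' - h' s)) := by
  unfold biasStat
  rw [← Finset.sum_sub_distrib]
  simp
  ring

end Segments

/-! ### Empirical transition probabilities -/

section Empirical

variable {S A : ℕ} (M : MDP S A) (st : ℕ → Fin S) (ac : ℕ → Fin A)

/-- The sum of `f(s_{i+1}) - P_{s,a}ᵀ f` over the visits `i < t` of `(s,a)`. -/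
def visitDev (f : Fin S → ℝ) (t : ℕ) (s : Fin S) (a : Fin A) : ℝ :=
  ∑ i ∈ Finset.range t, if st i = s ∧ ac i = a then f (st (i + 1)) - M.nextMean s a f else 0

/-- The deviations of `f`, with values in `[0,b]`, satisfy Bernstein's inequality up to time `T`. -/
def BernsteinBound (γ : ℝ) (T : ℕ) (f : Fin S → ℝ) (b : ℝ) : Prop :=
  ∀ t ≤ T, ∀ s a, |visitDev M st ac f t s a|
    ≤ 2 * √(visits st ac (Finset.range t) s a * vecVar (M.trans s a) f * γ) + b * γ

/-- The number `(γ / N_{s,a})^{1/4}`, in powers of which all error terms are expressed. -/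
def rate (γ : ℝ) (N : ℕ) (s : Fin S) (a : Fin A) : ℝ := √(√(γ / cnt st ac N s a))

variable {γ : ℝ}

theorem rate_nonneg (N : ℕ) (s : Fin S) (a : Fin A) : 0 ≤ rate st ac γ N s a := Real.sqrt_nonneg _

theorem rate_sq (N : ℕ) (s : Fin S) (a : Fin A) :
    rate st ac γ N s a ^ 2 = √(γ / cnt st ac N s a) := Real.sq_sqrt (Real.sqrt_nonneg _)

theorem rate_pow_four (hγ : 0 ≤ γ) (N : ℕ) (s : Fin S) (a : Fin A) :
    rate st ac γ N s a ^ 4 = γ / cnt st ac N s a := by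
  rw [show (4 : ℕ) = 2 * 2 from rfl, pow_mul, rate_sq,
    Real.sq_sqrt (div_nonneg hγ (cnt_pos _ _ _ _ _).le)]

theorem rate_cube (hγ : 0 ≤ γ) (N : ℕ) (s : Fin S) (a : Fin A) :
    rate st ac γ N s a ^ 3 = γ ^ (3 / 4 : ℝ) / cnt st ac N s a ^ (3 / 4 : ℝ) := by
  rw [← Real.div_rpow hγ (cnt_pos _ _ _ _ _).le, rate, Real.sqrt_eq_rpow, Real.sqrt_eq_rpow,
    ← Real.rpow_mul (div_nonneg hγ (cnt_pos _ _ _ _ _).le), ← Real.rpow_natCast,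
    ← Real.rpow_mul (div_nonneg hγ (cnt_pos _ _ _ _ _).le)]
  norm_num

theorem sqrt_mul_div_cnt (hγ : 0 ≤ γ) {v : ℝ} (N : ℕ) (s : Fin S) (a : Fin A) :
    √(v * γ / cnt st ac N s a) = √v * rate st ac γ N s a ^ 2 := by
  rw [rate_sq, mul_div_assoc, Real.sqrt_mul' _ (div_nonneg hγ (cnt_pos _ _ _ _ _).le)]

theorem empTrans_nonneg (N : ℕ) (s : Fin S) (a : Fin A) (s' : Fin S) :
    0 ≤ empTrans st ac N s a s' := div_nonneg (Nat.cast_nonneg _) (cnt_pos _ _ _ _ _).le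

theorem sum_empTrans_mul (f : Fin S → ℝ) (N : ℕ) (s : Fin S) (a : Fin A) :
    ∑ s', empTrans st ac N s a s' * f s'
      = (∑ i ∈ Finset.range N, if st i = s ∧ ac i = a then f (st (i + 1)) else 0)
        / cnt st ac N s a := by
  have h : ∀ s', empTrans st ac N s a s' * f s' = (∑ i ∈ Finset.range N,
      if st i = s ∧ ac i = a then (if st (i + 1) = s' then f s' else 0) else 0)
        / cnt st ac N s a := by
    intro s'
    rw [empTrans, div_mul_eq_mul_div, Finset.card_filter]
    push_cast
    rw [Finset.sum_mul]
    congr 1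
    refine Finset.sum_congr rfl fun i _ => ?_
    by_cases h1 : st i = s <;> by_cases h2 : ac i = a <;> by_cases h3 : st (i + 1) = s' <;>
      simp [h1, h2, h3]
  simp only [h]
  rw [← Finset.sum_div, Finset.sum_comm]
  congr 1
  refine Finset.sum_congr rfl fun i _ => ?_
  by_cases h1 : st i = s ∧ ac i = a <;> simp [h1]

theorem sum_empTrans (N : ℕ) (s : Fin S) (a : Fin A) :
    ∑ s', empTrans st ac N s a s'
      = visits st ac (Finset.range N) s a / cnt st ac N s a := by
  have h := sum_empTrans_mul st ac (fun _ => 1) N s a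
  simp only [mul_one] at h
  rw [h, visits, Finset.card_filter]
  push_cast
  rfl

/-- The empirical transition probabilities are `0` before the first visit, and form a probability
vector afterwards. -/
theorem empTrans_cases (N : ℕ) (s : Fin S) (a : Fin A) :
    ((∀ s', empTrans st ac N s a s' = 0) ∧ visits st ac (Finset.range N) s a = 0 ∧
      cnt st ac N s a = 1) ∨
    (∑ s', empTrans st ac N s a s' = 1 ∧
      cnt st ac N s a = visits st ac (Finset.range N) s a) := by
  rcases Nat.eq_zero_or_pos (visits st ac (Finset.range N) s a) with h | h
  · left
    refine ⟨fun s' => ?_, h, by simp [cnt, h]⟩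
    have h1 := sum_empTrans st ac N s a
    rw [h, Nat.cast_zero, zero_div] at h1
    exact (Finset.sum_eq_zero_iff_of_nonneg fun s' _ => empTrans_nonneg st ac N s a s').1 h1 s'
      (Finset.mem_univ _)
  · right
    have h1 : cnt st ac N s a = visits st ac (Finset.range N) s a :=
      max_eq_left (by exact_mod_cast h)
    refine ⟨?_, h1⟩
    rw [sum_empTrans, h1, div_self]
    exact_mod_cast h.ne'

theorem sum_empTrans_le_one (N : ℕ) (s : Fin S) (a : Fin A) :
    ∑ s', empTrans st ac N s a s' ≤ 1 := by
  rw [sum_empTrans]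
  exact (div_le_one (cnt_pos _ _ _ _ _)).2 (le_max_left _ _)

theorem sum_empTrans_mul_mem {f : Fin S → ℝ} {b : ℝ} (hf : ∀ s, 0 ≤ f s ∧ f s ≤ b)
    (N : ℕ) (s : Fin S) (a : Fin A) :
    0 ≤ ∑ s', empTrans st ac N s a s' * f s' ∧ ∑ s', empTrans st ac N s a s' * f s' ≤ b := by
  rcases empTrans_cases st ac N s a with h | h
  · simp only [h.1, zero_mul, Finset.sum_const_zero]
    exact ⟨le_rfl, (hf s).1.trans (hf s).2⟩
  · exact sum_mul_mem_Icc (empTrans_nonneg st ac N s a) h.1 hf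

variable {M st ac} {T : ℕ} {f : Fin S → ℝ} {b : ℝ}

/-- Bernstein's inequality for the empirical transition probabilities. It holds for a pair without
visits as well, where `N_{s,a} = 1` and the last term is at least `b`. -/
theorem BernsteinBound.abs_sum_le (hB : BernsteinBound M st ac γ T f b) (hγ : 1 ≤ γ)
    (hf : ∀ s, 0 ≤ f s ∧ f s ≤ b) {N : ℕ} (hN : N ≤ T) (s : Fin S) (a : Fin A) :
    |∑ s', (empTrans st ac N s a s' - M.trans s a s') * f s'|
      ≤ 2 * (√(vecVar (M.trans s a) f) * rate st ac γ N s a ^ 2)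
        + b * rate st ac γ N s a ^ 4 := by
  have hγ0 : 0 ≤ γ := zero_le_one.trans hγ
  have hb : 0 ≤ b := (hf s).1.trans (hf s).2
  simp only [sub_mul]
  rw [Finset.sum_sub_distrib]
  rcases empTrans_cases st ac N s a with h | h
  · have h1 := sum_mul_mem_Icc (M.trans_nonneg s a) (M.trans_sum s a) hf
    simp only [h.1, zero_mul, Finset.sum_const_zero, zero_sub, abs_neg]
    rw [abs_of_nonneg h1.1, rate_pow_four st ac hγ0, h.2.2, div_one]
    have : 0 ≤ √(vecVar (M.trans s a) f) * rate st ac γ N s a ^ 2 :=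
      mul_nonneg (Real.sqrt_nonneg _) (sq_nonneg _)
    nlinarith [h1.2]
  · have hc := cnt_pos st ac N s a
    have h1 : ∑ s', empTrans st ac N s a s' * f s' - ∑ s', M.trans s a s' * f s'
        = visitDev M st ac f N s a / cnt st ac N s a := by
      rw [sum_empTrans_mul, visitDev, eq_div_iff hc.ne', sub_mul, div_mul_cancel₀ _ hc.ne']
      have e : ∀ i, (if st i = s ∧ ac i = a then f (st (i + 1)) - M.nextMean s a f else 0)
          = (if st i = s ∧ ac i = a then f (st (i + 1)) else 0)
            - (if st i = s ∧ ac i = a then 1 else 0) * M.nextMean s a f := fun i => by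
        split_ifs <;> ring
      simp only [e]
      rw [Finset.sum_sub_distrib, ← Finset.sum_mul, h.2, visits, Finset.card_filter, mul_comm,
        MDP.nextMean]
      push_cast
      rfl
    rw [h1, abs_div, abs_of_pos hc, div_le_iff₀ hc]
    refine (hB N hN s a).trans (le_of_eq ?_)
    have e1 : √(visits st ac (Finset.range N) s a * vecVar (M.trans s a) f * γ)
        = √(vecVar (M.trans s a) f) * rate st ac γ N s a ^ 2 * cnt st ac N s a := by
      rw [← sqrt_mul_div_cnt st ac hγ0, ← h.2]
      nth_rw 3 [← Real.sqrt_sq hc.le]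
      rw [← Real.sqrt_mul' _ (sq_nonneg _)]
      congr 1
      field_simp
    rw [e1, rate_pow_four st ac hγ0]
    field_simp

/-- The consequence of Bernstein's inequality that does not involve the variance. -/
theorem BernsteinBound.abs_sum_le_three (hB : BernsteinBound M st ac γ T f b) (hγ : 1 ≤ γ)
    (hf : ∀ s, 0 ≤ f s ∧ f s ≤ b) {N : ℕ} (hN : N ≤ T) (s : Fin S) (a : Fin A) :
    |∑ s', (empTrans st ac N s a s' - M.trans s a s') * f s'|
      ≤ 3 * b * rate st ac γ N s a ^ 2 := by
  have hb : 0 ≤ b := (hf s).1.trans (hf s).2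
  set q := rate st ac γ N s a with hq
  have hq0 : 0 ≤ q := rate_nonneg _ _ _ _ _
  rcases le_or_gt q 1 with h | h
  · have h1 := hB.abs_sum_le hγ hf hN s a
    have h2 : √(vecVar (M.trans s a) f) ≤ b := by
      rw [Real.sqrt_le_left hb]
      refine vecVar_le_sq (M.trans_nonneg s a) (M.trans_sum s a) fun s s' => abs_le.2 ⟨?_, ?_⟩
      · linarith [(hf s).1, (hf s').2]
      · linarith [(hf s').1, (hf s).2]
    have h3 : q ^ 4 ≤ q ^ 2 := pow_le_pow_of_le_one hq0 h (by norm_num)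
    rw [← hq] at h1
    nlinarith [mul_le_mul_of_nonneg_right h2 (sq_nonneg q), mul_le_mul_of_nonneg_left h3 hb]
  · have h1 := sum_mul_mem_Icc (M.trans_nonneg s a) (M.trans_sum s a) hf
    have h2 := sum_empTrans_mul_mem st ac hf N s a
    simp only [sub_mul]
    rw [Finset.sum_sub_distrib]
    have h3 : 1 ≤ q ^ 2 := one_le_pow₀ h.le
    refine abs_le.2 ⟨?_, ?_⟩ <;> nlinarith [h1.1, h1.2, h2.1, h2.2]

variable {H : ℝ} {h : Fin S → ℝ}

/-- The variances under the true and the empirical transition probabilities are close. -/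
theorem abs_vecVar_sub_le (h1 : BernsteinBound M st ac γ T h H)
    (h2 : BernsteinBound M st ac γ T (fun s => h s ^ 2) (H ^ 2)) (hγ : 1 ≤ γ)
    (hh : ∀ s, 0 ≤ h s ∧ h s ≤ H) {N : ℕ} (hN : N ≤ T) (s : Fin S) (a : Fin A) :
    |vecVar (empTrans st ac N s a) h - vecVar (M.trans s a) h|
      ≤ 9 * H ^ 2 * rate st ac γ N s a ^ 2 := by
  have e1 := h1.abs_sum_le_three hγ hh hN s a
  have e2 := h2.abs_sum_le_three hγ (fun s => ⟨sq_nonneg _, pow_le_pow_left₀ (hh s).1 (hh s).2 2⟩)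
    hN s a
  have m1 := sum_mul_mem_Icc (M.trans_nonneg s a) (M.trans_sum s a) hh
  have m2 := sum_empTrans_mul_mem st ac hh N s a
  simp only [sub_mul] at e1 e2
  rw [Finset.sum_sub_distrib] at e1 e2
  unfold vecVar
  set q := rate st ac γ N s a
  set x := ∑ s', empTrans st ac N s a s' * h s'
  set y := ∑ s', M.trans s a s' * h s'
  have e3 : |x ^ 2 - y ^ 2| ≤ 2 * H * (3 * H * q ^ 2) := by
    rw [sq_sub_sq, abs_mul]
    refine mul_le_mul ?_ e1 (abs_nonneg _) (by linarith [m1.1, m1.2])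
    exact abs_le.2 ⟨by linarith [m1.1, m2.1], by linarith [m1.2, m2.2]⟩
  have e4 := abs_le.1 e2
  have e5 := abs_le.1 e3
  exact abs_le.2 ⟨by linarith [e4.1, e5.2], by linarith [e4.2, e5.1]⟩

theorem sqrt_le_sqrt_add {x y c : ℝ} (hc : 0 ≤ c) (h : x ≤ y + c ^ 2) : √x ≤ √y + c := by
  rw [Real.sqrt_le_left (add_nonneg (Real.sqrt_nonneg _) hc)]
  rcases le_total 0 y with hy | hy
  · nlinarith [Real.sq_sqrt hy, Real.sqrt_nonneg y]
  · nlinarith [Real.sqrt_nonneg y]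

theorem abs_empTrans_sub_le
    (hB : ∀ s', BernsteinBound M st ac γ T (fun x => if x = s' then 1 else 0) 1) (hγ : 1 ≤ γ)
    {N : ℕ} (hN : N ≤ T) (s : Fin S) (a : Fin A) (s' : Fin S) :
    |empTrans st ac N s a s' - M.trans s a s'|
      ≤ 2 * (√(M.trans s a s') * rate st ac γ N s a ^ 2) + rate st ac γ N s a ^ 4 := by
  have h := (hB s').abs_sum_le hγ (fun x => by split_ifs <;> norm_num) hN s a
  simp only [mul_ite, mul_one, mul_zero, Finset.sum_ite_eq', Finset.mem_univ, if_true, one_mul] at h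
  refine h.trans ?_
  have hv : vecVar (M.trans s a) (fun x => if x = s' then (1 : ℝ) else 0) ≤ M.trans s a s' := by
    unfold vecVar
    simp only [ite_pow, mul_ite, one_pow, mul_one, ne_eq, OfNat.ofNat_ne_zero, not_false_eq_true,
      zero_pow, mul_zero, Finset.sum_ite_eq', Finset.mem_univ, if_true]
    nlinarith [sq_nonneg (M.trans s a s')]
  have := mul_le_mul_of_nonneg_right (Real.sqrt_le_sqrt hv) (sq_nonneg (rate st ac γ N s a))
  linarith

/-- The true transition probabilities satisfy the entrywise constraint of `confSet`. -/
theorem abs_trans_sub_empTrans_le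
    (hB : ∀ s', BernsteinBound M st ac γ T (fun x => if x = s' then 1 else 0) 1) (hγ : 1 ≤ γ)
    {N : ℕ} (hN : N ≤ T) (s : Fin S) (a : Fin A) (s' : Fin S) :
    |M.trans s a s' - empTrans st ac N s a s'|
      ≤ 2 * (√(empTrans st ac N s a s') * rate st ac γ N s a ^ 2) + 3 * rate st ac γ N s a ^ 4
        + 4 * rate st ac γ N s a ^ 3 := by
  have h := abs_empTrans_sub_le hB hγ hN s a s'
  rw [abs_sub_comm]
  have hq0 := rate_nonneg st ac (γ := γ) N s a
  set q := rate st ac γ N s a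
  have hP1 : √(M.trans s a s') ≤ 1 := by
    rw [Real.sqrt_le_left zero_le_one, one_pow, ← M.trans_sum s a]
    exact Finset.single_le_sum (fun x _ => M.trans_nonneg s a x) (Finset.mem_univ s')
  have h1 := mul_le_mul_of_nonneg_right hP1 (sq_nonneg q)
  have h2 : √(M.trans s a s') ≤ √(empTrans st ac N s a s') + (2 * q + q ^ 2) := by
    refine sqrt_le_sqrt_add (by positivity) ?_
    have := (abs_le.1 h).1
    nlinarith [pow_nonneg hq0 3, pow_nonneg hq0 2]
  have h3 := mul_le_mul_of_nonneg_right h2 (sq_nonneg q)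
  refine h.trans ?_
  nlinarith [h3]

/-- The true transition probabilities satisfy the `ℓ¹` constraint of `confSet`. -/
theorem sum_abs_trans_sub_empTrans_le
    (hB : ∀ s', BernsteinBound M st ac γ T (fun x => if x = s' then 1 else 0) 1) (hγ : 1 ≤ γ)
    {N : ℕ} (hN : N ≤ T) (s : Fin S) (a : Fin A) :
    ∑ s', |M.trans s a s' - empTrans st ac N s a s'|
      ≤ √(14 * S) * rate st ac γ N s a ^ 2 := by
  set q := rate st ac γ N s a with hq
  have hq0 : 0 ≤ q := rate_nonneg _ _ _ _ _
  have h14 : (3 : ℝ) ≤ √14 := Real.le_sqrt_of_sq_le (by norm_num)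
  have hS : (0 : ℝ) ≤ √S := Real.sqrt_nonneg _
  have hS2 : √(S : ℝ) ^ 2 = S := Real.sq_sqrt (Nat.cast_nonneg _)
  rw [Real.sqrt_mul (by norm_num)]
  rcases le_or_gt (√S * q ^ 2) 1 with h | h
  · have h1 : ∑ s', |M.trans s a s' - empTrans st ac N s a s'|
        ≤ ∑ s', (2 * (√(M.trans s a s') * q ^ 2) + q ^ 4) :=
      Finset.sum_le_sum fun s' _ => by
        rw [abs_sub_comm]; exact abs_empTrans_sub_le hB hγ hN s a s'
    have h2 : ∑ s', √(M.trans s a s') ≤ √S := by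
      have := Real.sum_mul_le_sqrt_mul_sqrt Finset.univ (fun s' => √(M.trans s a s')) fun _ => 1
      simpa [Real.sq_sqrt (M.trans_nonneg s a _), M.trans_sum] using this
    rw [Finset.sum_add_distrib, ← Finset.mul_sum, ← Finset.sum_mul] at h1
    simp only [Finset.sum_const, Finset.card_univ, Fintype.card_fin, nsmul_eq_mul] at h1
    have h3 := mul_le_mul_of_nonneg_right h2 (sq_nonneg q)
    have h4 : (S : ℝ) * q ^ 4 = (√S * q ^ 2) ^ 2 := by rw [mul_pow, hS2]; ring
    have h5 : 0 ≤ √S * q ^ 2 := by positivity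
    nlinarith
  · have h1 : ∑ s', |M.trans s a s' - empTrans st ac N s a s'|
        ≤ ∑ s', (M.trans s a s' + empTrans st ac N s a s') :=
      Finset.sum_le_sum fun s' _ => by
        have g1 := M.trans_nonneg s a s'
        have g2 := empTrans_nonneg st ac N s a s'
        exact abs_le.2 ⟨by linarith, by linarith⟩
    rw [Finset.sum_add_distrib, M.trans_sum] at h1
    have h2 := sum_empTrans_le_one st ac N s a
    nlinarith

/-- The true transition probabilities and the bias function `h` satisfy the third constraint of
`confSet`. -/
theorem abs_sum_trans_sub_empTrans_mul_le (h1 : BernsteinBound M st ac γ T h H)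
    (h2 : BernsteinBound M st ac γ T (fun s => h s ^ 2) (H ^ 2)) (hγ : 1 ≤ γ)
    (hh : ∀ s, 0 ≤ h s ∧ h s ≤ H) {N : ℕ} (hN : N ≤ T) (s : Fin S) (a : Fin A) :
    |∑ s', (M.trans s a s' - empTrans st ac N s a s') * h s'|
      ≤ 2 * (√(vecVar (empTrans st ac N s a) h) * rate st ac γ N s a ^ 2)
        + 12 * H * rate st ac γ N s a ^ 4 + 10 * H * rate st ac γ N s a ^ 3 := by
  have hH : 0 ≤ H := (hh s).1.trans (hh s).2
  have e1 := h1.abs_sum_le hγ hh hN s a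
  have e2 := (abs_le.1 (abs_vecVar_sub_le h1 h2 hγ hh hN s a)).1
  have hq0 := rate_nonneg st ac (γ := γ) N s a
  set q := rate st ac γ N s a
  have e3 : √(vecVar (M.trans s a) h) ≤ √(vecVar (empTrans st ac N s a) h) + 3 * H * q :=
    sqrt_le_sqrt_add (by positivity) (by nlinarith)
  have e4 := mul_le_mul_of_nonneg_right e3 (sq_nonneg q)
  have e5 : |∑ s', (M.trans s a s' - empTrans st ac N s a s') * h s'|
      = |∑ s', (empTrans st ac N s a s' - M.trans s a s') * h s'| := by
    rw [← abs_neg, ← Finset.sum_neg_distrib]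
    congr 1
    exact Finset.sum_congr rfl fun s' _ => by ring
  rw [e5]
  refine e1.trans ?_
  nlinarith [mul_nonneg hH (pow_nonneg hq0 3), mul_nonneg hH (pow_nonneg hq0 4)]

end Empirical

/-! ### Typical trajectories -/

section Typical

variable {S A : ℕ}

/-- `h` solves the optimality equation with gain `ρ` and takes its values in `[0,H]`. -/
structure IsBiasPair (M : MDP S A) (H : ℝ) (h : Fin S → ℝ) (ρ : ℝ) : Prop where
  mem : ∀ s, 0 ≤ h s ∧ h s ≤ H
  bellman : ∀ s, h s + ρ = ⨆ a : Fin A, (M.meanReward s a + M.nextMean s a h)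

/-- The horizon dominates a large power of all other parameters. -/
structure IsLargeHorizon (S A T : ℕ) (H γ : ℝ) : Prop where
  hS : 20 ≤ S
  hA : 20 ≤ A
  hH : 20 ≤ H
  hγ : 1 ≤ γ
  large : 800 * (S * A * H * γ * (1 + Real.log T)) ^ 3 ≤ √(√(T : ℝ))

/-- The martingale bounds that hold on a typical trajectory; `b i` is the bias function, cut off to
`[0,H]`, of the candidate in force at step `i`, and `h` is a true bias function. The last two are
Freedman's inequality with the fixed exponents `√(γ / (HT))` and `T^{-1/4}`, for a total variance that
is bounded only afterwards. -/
structure IsTypical (M : MDP S A) (H γ : ℝ) (T : ℕ) (h : Fin S → ℝ)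
    (st : ℕ → Fin S) (ac : ℕ → Fin A) (rw : ℕ → ℝ) (b : ℕ → Fin S → ℝ) : Prop where
  coord : ∀ s', BernsteinBound M st ac γ T (fun x => if x = s' then 1 else 0) 1
  bias : BernsteinBound M st ac γ T h H
  bias_sq : BernsteinBound M st ac γ T (fun s => h s ^ 2) (H ^ 2)
  mart_bias : ∀ t ≤ T, |∑ i ∈ Finset.range t, (h (st (i + 1)) - M.nextMean (st i) (ac i) h)|
    ≤ 2 * H * √(γ * T)
  mart_reward : ∀ t ≤ T, |∑ i ∈ Finset.range t, (rw i - M.meanReward (st i) (ac i))|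
    ≤ 2 * √(γ * T)
  seg_bias : ∀ s s', ∀ t ≤ T, |∑ i ∈ Finset.range t, {i | inSegment st s s' i}.indicator
    (fun i => h (st (i + 1)) - M.nextMean (st i) (ac i) h) i| ≤ 2 * H * √(γ * T)
  seg_reward : ∀ s s', ∀ t ≤ T, |∑ i ∈ Finset.range t, {i | inSegment st s s' i}.indicator
    (fun i => rw i - M.meanReward (st i) (ac i)) i| ≤ 2 * √(γ * T)
  mart_sq : ∑ i ∈ Finset.range T,
    (M.nextMean (st i) (ac i) (fun s => h s ^ 2) - h (st (i + 1)) ^ 2) ≤ 2 * H ^ 2 * √(γ * T)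
  mart_cand : ∀ t ≤ T, ∑ i ∈ Finset.range t,
    (M.nextMean (st i) (ac i) (b i) - b i (st (i + 1))) ≤ 2 * H * √(γ * T)
  freedman_bias : ∑ i ∈ Finset.range T, (M.nextMean (st i) (ac i) h - h (st (i + 1)))
    ≤ √(γ / (H * T)) * ∑ i ∈ Finset.range T, vecVar (M.trans (st i) (ac i)) h + √(γ * (H * T))
  freedman_diff : ∑ i ∈ Finset.range T, (M.nextMean (st i) (ac i) (fun s => b i s - h s)
      - (b i (st (i + 1)) - h (st (i + 1))))
    ≤ (∑ i ∈ Finset.range T, vecVar (M.trans (st i) (ac i)) (fun s => b i s - h s)) / √(√(T : ℝ))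
      + γ * √(√(T : ℝ))

/-- The trajectory is produced by EBF with the candidates `cand`. -/
structure IsEBFPath (M : MDP S A) (H γ : ℝ) (T : ℕ)
    (st : ℕ → Fin S) (ac : ℕ → Fin A) (rw : ℕ → ℝ) (cand : ℕ → Candidate S A) : Prop where
  ac_eq : ∀ t < T, ac t = (cand t).policy (st t)
  cand_new : ∀ t < T, episodeStart st ac t = t →
    (confSet M.meanReward H γ T st ac rw t).Nonempty →
    cand t ∈ confSet M.meanReward H γ T st ac rw t ∧
      ∀ c ∈ confSet M.meanReward H γ T st ac rw t, c.gain ≤ (cand t).gain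
  cand_same : ∀ t, t + 1 < T → episodeStart st ac (t + 1) ≠ t + 1 → cand (t + 1) = cand t

/-- The bound on `|L₁(h,s,s')|` in the definition of `biasSet`. -/
def biasRadius (S A T : ℕ) (H γ : ℝ) : ℝ :=
  48 * S * √(A * T * γ) * H + (√(2 * γ * T) + 1) * H

namespace IsLargeHorizon

variable {T : ℕ} {H γ : ℝ} (L : IsLargeHorizon S A T H γ)
include L

theorem one_le_T : 1 ≤ T := by
  by_contra hT
  have h0 : T = 0 := by omega
  have h := L.large
  have h1 := L.hS; have h2 := L.hA; have h3 := L.hH; have h4 := L.hγ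
  have h1' : (0 : ℝ) < S := by exact_mod_cast (by omega : 0 < S)
  have h2' : (0 : ℝ) < A := by exact_mod_cast (by omega : 0 < A)
  have h3' : (0 : ℝ) < H := by linarith
  have h4' : (0 : ℝ) < γ := by linarith
  rw [h0] at h
  simp only [CharP.cast_eq_zero, Real.log_zero, add_zero, mul_one, Real.sqrt_zero] at h
  have : 0 < 800 * (S * A * H * γ) ^ 3 := by positivity
  linarith

theorem log_nonneg : 0 ≤ Real.log T := Real.log_nonneg (by exact_mod_cast L.one_le_T)

theorem S_ge : (20 : ℝ) ≤ S := by exact_mod_cast L.hS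

theorem A_ge : (20 : ℝ) ≤ A := by exact_mod_cast L.hA

/-- The consequences of `IsLargeHorizon` in terms of `u = S A H γ (1 + log T)` and `y = T^{1/4}`. -/
theorem exists_scale : ∃ u y ℓ : ℝ, ℓ = 1 + Real.log T ∧ u = S * A * H * γ * ℓ ∧ y = √(√(T : ℝ)) ∧
    1 ≤ ℓ ∧ 1 ≤ u ∧ 0 < y ∧ y ^ 2 = √(T : ℝ) ∧ y ^ 4 = T ∧ 800 * u ^ 3 ≤ y := by
  have hl := L.log_nonneg
  refine ⟨_, _, _, rfl, rfl, rfl, by linarith, ?_, ?_, ?_, ?_, L.large⟩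
  · have e1 := L.S_ge; have e2 := L.A_ge; have e3 := L.hH; have e4 := L.hγ
    have := one_le_mul_of_one_le_of_one_le (by linarith : (1 : ℝ) ≤ S) (by linarith : (1 : ℝ) ≤ A)
    have := one_le_mul_of_one_le_of_one_le this (by linarith : (1 : ℝ) ≤ H)
    have := one_le_mul_of_one_le_of_one_le this e4
    exact one_le_mul_of_one_le_of_one_le this (by linarith)
  · have := L.one_le_T
    have : (0 : ℝ) < T := by exact_mod_cast this
    positivity
  · exact Real.sq_sqrt (Real.sqrt_nonneg _)
  · rw [show (4 : ℕ) = 2 * 2 from rfl, pow_mul, Real.sq_sqrt (Real.sqrt_nonneg _),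
      Real.sq_sqrt (Nat.cast_nonneg _)]

theorem mul_sqrt_le : H * √(γ * T) ≤ H * S * √(A * T * γ) / 80 := by
  have hA4 : (4 : ℝ) ≤ √A := Real.le_sqrt_of_sq_le (by linarith [L.A_ge])
  have e : √(A * T * γ) = √A * √(γ * T) := by
    rw [← Real.sqrt_mul (Nat.cast_nonneg _)]; congr 1; ring
  rw [e]
  have h1 : 0 ≤ H * √(γ * T) := mul_nonneg (by linarith [L.hH]) (Real.sqrt_nonneg _)
  have h2 : (80 : ℝ) ≤ S * √A := by nlinarith [L.S_ge]
  nlinarith [mul_le_mul_of_nonneg_left h2 h1]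

theorem one_le_sqrt : 1 ≤ √(γ * T) := by
  have : (1 : ℝ) ≤ T := by exact_mod_cast L.one_le_T
  exact Real.one_le_sqrt.2 (one_le_mul_of_one_le_of_one_le L.hγ this)

theorem telescope_le : H * (2 * (S * A * (1 + Real.log T)) + 1) ≤ H * S * √(A * T * γ) / 100 := by
  obtain ⟨u, y, ℓ, hℓ, hu, -, h1, h2, h3, h4, h5, h6⟩ := L.exists_scale
  have e1 := L.S_ge; have e2 := L.A_ge; have e3 := L.hH; have e4 := L.hγ
  have hq : y ^ 2 ≤ √(A * T * γ) := by
    rw [h4]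
    refine Real.sqrt_le_sqrt ?_
    have : (T : ℝ) * 1 ≤ T * (A * γ) :=
      mul_le_mul_of_nonneg_left (by nlinarith) (Nat.cast_nonneg _)
    linarith
  have hHS : 1 ≤ H * S := by nlinarith
  have h7 : y ≤ H * S * √(A * T * γ) := by
    have : y ≤ y ^ 2 := by
      have : 1 ≤ u ^ 3 := one_le_pow₀ h2
      nlinarith
    calc y ≤ 1 * y ^ 2 := by linarith
      _ ≤ _ := mul_le_mul hHS hq (sq_nonneg y) (by linarith)
  have h8 : H * (2 * (S * A * ℓ) + 1) ≤ 3 * u := by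
    have hSAl : 1 ≤ S * A * ℓ := by
      have : 1 ≤ (S : ℝ) * A := by nlinarith
      exact one_le_mul_of_one_le_of_one_le this h1
    have h9 : H * (S * A * ℓ) * 1 ≤ H * (S * A * ℓ) * γ :=
      mul_le_mul_of_nonneg_left e4 (by positivity)
    rw [hu]
    nlinarith
  have h9 : u ≤ u ^ 3 := le_self_pow₀ h2 (by norm_num)
  rw [← hℓ]
  linarith

end IsLargeHorizon

section Path

variable {M : MDP S A} {H γ ρ : ℝ} {T : ℕ} {h : Fin S → ℝ} {st : ℕ → Fin S} {ac : ℕ → Fin A}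
  {rw : ℕ → ℝ} {cand : ℕ → Candidate S A} {b : ℕ → Fin S → ℝ}

theorem IsBiasPair.gap_nonneg (B : IsBiasPair M H h ρ) (s : Fin S) (a : Fin A) :
    0 ≤ h s + ρ - M.meanReward s a - M.nextMean s a h := by
  have := le_ciSup (f := fun a : Fin A => M.meanReward s a + M.nextMean s a h)
    (Set.finite_range _).bddAbove a
  rw [B.bellman s]
  linarith

/-- The true transition probabilities, with an optimal policy, form an element of the confidence set
as soon as the bias function satisfies the constraints of `biasSet`. -/
theorem exists_mem_confSet (L : IsLargeHorizon S A T H γ) (B : IsBiasPair M H h ρ)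
    (Y : IsTypical M H γ T h st ac rw b) {N : ℕ} (hN : N ≤ T)
    (hmem : h ∈ biasSet H γ T A st rw N) :
    ∃ c ∈ confSet M.meanReward H γ T st ac rw N, c.gain = ρ := by
  have : Nonempty (Fin A) := ⟨⟨0, by have := L.hA; omega⟩⟩
  have hγ0 : 0 ≤ γ := by linarith [L.hγ]
  have hcomm : ∀ s a, ∑ s', M.trans s a s' * h s' + M.meanReward s a
      = M.meanReward s a + M.nextMean s a h := fun s a => add_comm _ _
  choose p hp using fun s => exists_eq_ciSup_of_finite
    (f := fun a : Fin A => ∑ s', M.trans s a s' * h s' + M.meanReward s a)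
  refine ⟨⟨p, M.trans, h, ρ⟩, ⟨hmem, ?_, ?_, ?_, hp, ?_⟩, rfl⟩
  · intro s a s'
    have e := abs_trans_sub_empTrans_le Y.coord L.hγ hN s a s'
    rw [sqrt_mul_div_cnt st ac hγ0, mul_div_assoc, ← rate_pow_four st ac hγ0, mul_div_assoc,
      ← rate_cube st ac hγ0]
    exact e
  · intro s a
    have e := sum_abs_trans_sub_empTrans_le Y.coord L.hγ hN s a
    rw [sqrt_mul_div_cnt st ac hγ0]
    exact e
  · intro s a
    have e := abs_sum_trans_sub_empTrans_mul_le Y.bias Y.bias_sq L.hγ B.mem hN s a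
    rw [sqrt_mul_div_cnt st ac hγ0, mul_div_assoc, ← rate_pow_four st ac hγ0, mul_div_assoc,
      ← rate_cube st ac hγ0]
    exact e
  · intro s
    simp only [hcomm]
    exact (B.bellman s).symm

/-- At the steps before `n` EBF follows candidates in the confidence set whose gain is at least
`ρ`. -/
def IsOptimistic (M : MDP S A) (H γ ρ : ℝ) (T : ℕ) (st : ℕ → Fin S) (ac : ℕ → Fin A) (rw : ℕ → ℝ)
    (cand : ℕ → Candidate S A) (n : ℕ) : Prop :=
  ∀ t < n, cand t ∈ confSet M.meanReward H γ T st ac rw (episodeStart st ac t) ∧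
    ρ ≤ (cand t).gain

/-- Optimism bounds the regret of a step by the error of the candidate at that step. -/
theorem regret_step_le {t N : ℕ} {c : Candidate S A} (hac : ac t = c.policy (st t))
    (hc : c ∈ confSet M.meanReward H γ T st ac rw N) (hρ : ρ ≤ c.gain) :
    ρ - M.meanReward (st t) (ac t)
      ≤ ∑ s', (c.trans (st t) (ac t) s' - empTrans st ac N (st t) (ac t) s') * c.bias s'
        + ∑ s', (empTrans st ac N (st t) (ac t) s' - M.trans (st t) (ac t) s') * c.bias s'
        + (M.nextMean (st t) (ac t) c.bias - c.bias (st (t + 1)))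
        + (c.bias (st (t + 1)) - c.bias (st t)) := by
  have h1 := hc.2.2.2.2.1 (st t)
  rw [hc.2.2.2.2.2 (st t), ← hac] at h1
  simp only [sub_mul, Finset.sum_sub_distrib, MDP.nextMean]
  linarith

theorem abs_sum_mul_le {x f : Fin S → ℝ} (hf : ∀ s, 0 ≤ f s ∧ f s ≤ H) :
    |∑ s, x s * f s| ≤ H * ∑ s, |x s| := by
  refine (Finset.abs_sum_le_sum_abs _ _).trans ?_
  rw [Finset.mul_sum]
  refine Finset.sum_le_sum fun s _ => ?_
  rw [abs_mul, mul_comm, abs_of_nonneg (hf s).1]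
  exact mul_le_mul_of_nonneg_right (hf s).2 (abs_nonneg _)

theorem sqrt_mul_div_cnt_weight {x : ℝ} (hx : 0 ≤ x) (t : ℕ) :
    √(x / cnt st ac (episodeStart st ac t) (st t) (ac t)) = √x * √(weight st ac t) := by
  rw [div_eq_mul_inv, Real.sqrt_mul hx]; rfl

/-- The first regret bound, of order `H S √(A T γ)`, which follows from the `ℓ¹` constraint alone. -/
theorem sum_regret_le_crude (L : IsLargeHorizon S A T H γ) (Y : IsTypical M H γ T h st ac rw b)
    (E : IsEBFPath M H γ T st ac rw cand)
    (hb : ∀ t < T, (∀ s, 0 ≤ (cand t).bias s ∧ (cand t).bias s ≤ H) → b t = (cand t).bias)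
    {n : ℕ} (hn : n ≤ T) (O : IsOptimistic M H γ ρ T st ac rw cand n) :
    ∑ t ∈ Finset.range n, (ρ - M.meanReward (st t) (ac t)) ≤ 23 * (H * S * √(A * T * γ)) := by
  have hγ0 : 0 ≤ γ := by linarith [L.hγ]
  have hH0 : 0 ≤ H := by linarith [L.hH]
  have hbt : ∀ t < n, b t = (cand t).bias := fun t ht =>
    hb t (ht.trans_le hn) (O t ht).1.1.1
  have h1 : ∀ t ∈ Finset.range n, ρ - M.meanReward (st t) (ac t)
      ≤ 2 * H * √(14 * S * γ) * √(weight st ac t)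
        + (M.nextMean (st t) (ac t) (b t) - b t (st (t + 1)))
        + (b t (st (t + 1)) - b t (st t)) := by
    intro t ht
    have htn := Finset.mem_range.1 ht
    have htT := htn.trans_le hn
    obtain ⟨hc, hρ⟩ := O t htn
    rw [hbt t htn]
    have e1 := regret_step_le (E.ac_eq t htT) hc hρ
    have e2 := (le_abs_self _).trans (abs_sum_mul_le (x := fun s' => (cand t).trans (st t) (ac t) s'
      - empTrans st ac (episodeStart st ac t) (st t) (ac t) s') hc.1.1)
    have e3 := (le_abs_self _).trans (abs_sum_mul_le (x := fun s' =>
      empTrans st ac (episodeStart st ac t) (st t) (ac t) s' - M.trans (st t) (ac t) s') hc.1.1)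
    have e4 := hc.2.2.1 (st t) (ac t)
    have e5 := sum_abs_trans_sub_empTrans_le Y.coord L.hγ
      ((episodeStart_le st ac t).trans htT.le) (st t) (ac t)
    rw [← sqrt_mul_div_cnt st ac hγ0] at e5
    simp only [abs_sub_comm (M.trans _ _ _)] at e5
    rw [sqrt_mul_div_cnt_weight (by positivity)] at e4 e5
    have e6 := mul_le_mul_of_nonneg_left e4 hH0
    have e7 := mul_le_mul_of_nonneg_left e5 hH0
    linarith
  have h2 := Finset.sum_le_sum h1
  rw [Finset.sum_add_distrib, Finset.sum_add_distrib, ← Finset.mul_sum] at h2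
  have h3 := Y.mart_cand n hn
  have h4 := sum_telescope_le st ac hH0 (h := b) hn L.one_le_T
    (fun t ht s => by rw [hbt t ht]; exact (O t ht).1.1.1 s)
    (fun t ht hne => by
      rw [hbt (t + 1) ht, hbt t (by omega), E.cand_same t (by omega) hne])
  have h5 := mul_le_mul_of_nonneg_left (sum_sqrt_weight_le st ac (n := n) hn)
    (show 0 ≤ 2 * H * √(14 * S * γ) by positivity)
  have e14 : √14 ≤ (3.75 : ℝ) := by rw [Real.sqrt_le_left (by norm_num)]; norm_num
  have h6 : √(14 * S * γ) * √(S * A * T) = √14 * (S * √(A * T * γ)) := by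
    rw [← Real.sqrt_mul (by positivity),
      show 14 * (S : ℝ) * γ * (S * A * T) = 14 * ((S : ℝ) ^ 2 * (A * T * γ)) by ring,
      Real.sqrt_mul (by norm_num), Real.sqrt_mul (sq_nonneg _), Real.sqrt_sq (Nat.cast_nonneg S)]
  have h7 : 2 * H * √(14 * S * γ) * (3 * √(S * A * T)) ≤ 22.5 * (H * S * √(A * T * γ)) := by
    calc _ = 6 * H * (√(14 * S * γ) * √(S * A * T)) := by ring
      _ = √14 * (6 * (H * S * √(A * T * γ))) := by rw [h6]; ring
      _ ≤ 3.75 * (6 * (H * S * √(A * T * γ))) :=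
          mul_le_mul_of_nonneg_right e14 (by positivity)
      _ = _ := by ring
  have h8 := L.mul_sqrt_le
  have h9 := L.telescope_le
  have h10 : 0 ≤ H * S * √(A * T * γ) := by positivity
  linarith

/-- The total gap of the actions played before `n` differs from the regret by a martingale and a
telescoping sum. -/
theorem sum_gap_le (B : IsBiasPair M H h ρ) (Y : IsTypical M H γ T h st ac rw b) {n : ℕ}
    (hn : n ≤ T) :
    ∑ t ∈ Finset.range n, (h (st t) + ρ - M.meanReward (st t) (ac t) - M.nextMean (st t) (ac t) h)
      ≤ ∑ t ∈ Finset.range n, (ρ - M.meanReward (st t) (ac t)) + H + 2 * H * √(γ * T) := by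
  have e : ∀ t, h (st t) + ρ - M.meanReward (st t) (ac t) - M.nextMean (st t) (ac t) h
      = (ρ - M.meanReward (st t) (ac t)) + (h (st (t + 1)) - M.nextMean (st t) (ac t) h)
        - (h (st (t + 1)) - h (st t)) := fun t => by ring
  simp only [e]
  rw [Finset.sum_sub_distrib, Finset.sum_add_distrib, Finset.sum_range_sub (fun t => h (st t))]
  have h1 := (abs_le.1 (Y.mart_bias n hn)).2
  have h2 := (B.mem (st n)).1
  have h3 := (B.mem (st 0)).2
  linarith

/-- On a typical trajectory with optimistic candidates the true bias function satisfies the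
constraints of `biasSet`, since the statistic `L₁` is bounded by the regret so far. -/
theorem mem_biasSet (L : IsLargeHorizon S A T H γ) (B : IsBiasPair M H h ρ)
    (Y : IsTypical M H γ T h st ac rw b) (E : IsEBFPath M H γ T st ac rw cand)
    (hb : ∀ t < T, (∀ s, 0 ≤ (cand t).bias s ∧ (cand t).bias s ≤ H) → b t = (cand t).bias)
    {n : ℕ} (hn : n ≤ T) (O : IsOptimistic M H γ ρ T st ac rw cand n) :
    h ∈ biasSet H γ T A st rw n := by
  classical
  refine ⟨B.mem, fun s s' hss => ?_⟩
  obtain ⟨τ, hτ, hsum⟩ := biasStat_eq_sum st hss n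
  rw [hsum]
  set I : Set ℕ := {i | inSegment st s s' i}
  set g : ℕ → ℝ := fun t =>
    h (st t) + ρ - M.meanReward (st t) (ac t) - M.nextMean (st t) (ac t) h with hg
  have hg0 : ∀ t, 0 ≤ g t := fun t => B.gap_nonneg _ _
  have e : ∀ i, (if inSegment st s s' i then
        h (st (i + 1)) - h (st i) + (rw i - empReward rw n) else 0)
      = I.indicator (fun i => h (st (i + 1)) - M.nextMean (st i) (ac i) h) i
        + I.indicator (fun i => rw i - M.meanReward (st i) (ac i)) i
        + I.indicator (fun _ => ρ - empReward rw n) i - I.indicator g i := by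
    intro i
    by_cases hi : inSegment st s s' i
    · have hi' : i ∈ I := hi
      simp only [hi, if_true, Set.indicator_of_mem hi', hg]
      ring
    · have hi' : i ∉ I := hi
      simp [hi, hi']
  -- `L₁` splits into two martingales, the sum of `ρ - ρ̂`, and the sum of the gaps
  simp only [e]
  rw [Finset.sum_sub_distrib, Finset.sum_add_distrib, Finset.sum_add_distrib]
  have h1 := abs_le.1 (Y.seg_bias s s' τ (hτ.trans hn))
  have h2 := abs_le.1 (Y.seg_reward s s' τ (hτ.trans hn))
  have hreg := sum_regret_le_crude L Y E hb hn O
  have hgap := sum_gap_le (ρ := ρ) B Y hn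
  have hrew := abs_le.1 (Y.mart_reward n hn)
  have h3 : 0 ≤ ∑ i ∈ Finset.range τ, I.indicator g i :=
    Finset.sum_nonneg fun i _ => Set.indicator_nonneg (fun t _ => hg0 t) i
  have h4 : ∑ i ∈ Finset.range τ, I.indicator g i ≤ ∑ i ∈ Finset.range n, g i :=
    (Finset.sum_le_sum fun i _ => Set.indicator_le_self' (fun t _ => hg0 t) i).trans
      (Finset.sum_le_sum_of_subset_of_nonneg (Finset.range_subset_range.2 hτ) fun t _ _ => hg0 t)
  have h40 : 0 ≤ ∑ i ∈ Finset.range n, g i := Finset.sum_nonneg fun t _ => hg0 t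
  -- the sum of `ρ - ρ̂` over the segments is at most the observed regret in absolute value
  have h5 : |∑ i ∈ Finset.range τ, I.indicator (fun _ => ρ - empReward rw n) i|
      ≤ |∑ i ∈ Finset.range n, (ρ - rw i)| := by
    have h6 : |∑ i ∈ Finset.range τ, I.indicator (fun _ => ρ - empReward rw n) i|
        ≤ τ * |ρ - empReward rw n| := by
      refine (Finset.abs_sum_le_sum_abs _ _).trans ?_
      calc _ ≤ ∑ _i ∈ Finset.range τ, |ρ - empReward rw n| := by
            refine Finset.sum_le_sum fun i _ => ?_
            by_cases hi : i ∈ I <;> simp [hi]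
        _ = _ := by simp
    rcases Nat.eq_zero_or_pos n with h0 | h0
    · have : τ = 0 := by omega
      subst this
      simp
    · have hn0 : (1 : ℝ) ≤ n := by exact_mod_cast h0
      have h7 : (n : ℝ) * (ρ - empReward rw n) = ∑ i ∈ Finset.range n, (ρ - rw i) := by
        rw [Finset.sum_sub_distrib, empReward, max_eq_left hn0]
        simp only [Finset.sum_const, Finset.card_range, nsmul_eq_mul]
        field_simp
      rw [← h7, abs_mul, abs_of_nonneg (by linarith : (0 : ℝ) ≤ n)]
      exact h6.trans (mul_le_mul_of_nonneg_right (by exact_mod_cast hτ) (abs_nonneg _))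
  have h8 : ∑ i ∈ Finset.range n, (ρ - rw i)
      = ∑ i ∈ Finset.range n, (ρ - M.meanReward (st i) (ac i))
        - ∑ i ∈ Finset.range n, (rw i - M.meanReward (st i) (ac i)) := by
    rw [← Finset.sum_sub_distrib]
    exact Finset.sum_congr rfl fun i _ => by ring
  have hsq : H * 1 ≤ H * √(γ * T) :=
    mul_le_mul_of_nonneg_left L.one_le_sqrt (by linarith [L.hH])
  have hsq2 : 20 * √(γ * T) ≤ H * √(γ * T) :=
    mul_le_mul_of_nonneg_right L.hH (Real.sqrt_nonneg _)
  have h9 : |∑ i ∈ Finset.range n, (ρ - rw i)|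
      ≤ 23 * (H * S * √(A * T * γ)) + H + 2 * H * √(γ * T) + 2 * √(γ * T) := by
    have hQ : 0 ≤ H * S * √(A * T * γ) := by
      have := L.hH
      positivity
    rw [h8]
    exact abs_le.2 ⟨by linarith, by linarith [Real.sqrt_nonneg (γ * T), L.hH]⟩
  have h10 := abs_le.1 (h5.trans h9)
  have h11 := L.mul_sqrt_le
  have h12 : 0 ≤ (√(2 * γ * T) + 1) * H :=
    mul_nonneg (by positivity) (by linarith [L.hH])
  have h13 : 48 * (S : ℝ) * √(A * T * γ) * H = 48 * (H * S * √(A * T * γ)) := by ring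
  rw [h13]
  have h14 := Real.sqrt_nonneg (γ * T)
  exact abs_le.2 ⟨by linarith, by linarith⟩

/-- EBF is optimistic throughout, by induction over the steps. -/
theorem isOptimistic (L : IsLargeHorizon S A T H γ) (B : IsBiasPair M H h ρ)
    (Y : IsTypical M H γ T h st ac rw b) (E : IsEBFPath M H γ T st ac rw cand)
    (hb : ∀ t < T, (∀ s, 0 ≤ (cand t).bias s ∧ (cand t).bias s ≤ H) → b t = (cand t).bias) :
    ∀ n ≤ T, IsOptimistic M H γ ρ T st ac rw cand n := by
  intro n
  induction n with
  | zero => intro _ t ht; exact absurd ht (Nat.not_lt_zero t)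
  | succ n ih =>
    intro hn t ht
    have O := ih (by omega)
    rcases Nat.lt_or_eq_of_le (Nat.lt_succ_iff.1 ht) with h' | h'
    · exact O t h'
    · subst h'
      by_cases hs : episodeStart st ac t = t
      · obtain ⟨c, hc, hcρ⟩ := exists_mem_confSet L B Y (by omega : t ≤ T)
          (mem_biasSet L B Y E hb (by omega) O)
        obtain ⟨g1, g2⟩ := E.cand_new t (by omega) hs ⟨c, hc⟩
        rw [hs]
        exact ⟨g1, hcρ ▸ g2 c hc⟩
      · cases t with
        | zero => exact absurd rfl hs
        | succ t =>
          rw [E.cand_same t (by omega) hs, episodeStart_succ_of_ne st ac hs]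
          exact O t (by omega)

end Path

end Typical

/-! ### The refined regret bound on a typical trajectory -/

section Refined

variable {S A : ℕ} {M : MDP S A} {H γ ρ : ℝ} {T : ℕ} {h : Fin S → ℝ} {st : ℕ → Fin S}
  {ac : ℕ → Fin A} {rw : ℕ → ℝ} {cand : ℕ → Candidate S A} {b : ℕ → Fin S → ℝ}

theorem biasRadius_nonneg (hH : 0 ≤ H) : 0 ≤ biasRadius S A T H γ := by
  unfold biasRadius; positivity

/-- Two functions in `biasSet` have nearly the same increments along frequent transitions, since
`c(s,s')` times the difference of the increments is at most twice the radius of `biasSet`. -/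
theorem empTrans_mul_sq_le {N : ℕ} {f g : Fin S → ℝ} (hf : f ∈ biasSet H γ T A st rw N)
    (hg : g ∈ biasSet H γ T A st rw N) (s : Fin S) (a : Fin A) (s' : Fin S) :
    empTrans st ac N s a s' * ((f s' - f s) - (g s' - g s)) ^ 2
      ≤ 4 * (H * biasRadius S A T H γ / cnt st ac N s a) := by
  have hH : 0 ≤ H := (hf.1 s).1.trans (hf.1 s).2
  have hD := biasRadius_nonneg (S := S) (A := A) (T := T) (γ := γ) hH
  have hc := cnt_pos st ac N s a
  rcases eq_or_ne s s' with hss | hss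
  · subst hss
    simp only [sub_self, ne_eq, OfNat.ofNat_ne_zero, not_false_eq_true, zero_pow, mul_zero]
    positivity
  · set d := (f s' - f s) - (g s' - g s) with hd
    have h1 : (arrivals st N s s' : ℝ) * |d| ≤ 2 * biasRadius S A T H γ := by
      rw [← abs_of_nonneg (Nat.cast_nonneg (arrivals st N s s') : (0 : ℝ) ≤ _), ← abs_mul,
        ← biasStat_sub st rw N f g s s']
      have e1 := abs_le.1 (hf.2 s s' hss)
      have e2 := abs_le.1 (hg.2 s s' hss)
      unfold biasRadius
      exact abs_le.2 ⟨by linarith, by linarith⟩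
    have h2 : |d| ≤ 2 * H := by
      have e1 := hf.1 s; have e2 := hf.1 s'; have e3 := hg.1 s; have e4 := hg.1 s'
      exact abs_le.2 ⟨by linarith, by linarith⟩
    have h3 : empTrans st ac N s a s' * cnt st ac N s a ≤ arrivals st N s s' := by
      rw [empTrans, div_mul_cancel₀ _ hc.ne']
      refine le_trans ?_ (Nat.cast_le.2 (card_transitions_le_arrivals st hss N))
      refine Nat.cast_le.2 (Finset.card_le_card fun i hi => ?_)
      simp only [Finset.mem_filter] at hi ⊢
      exact ⟨hi.1, hi.2.1, hi.2.2.2⟩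
    rw [← mul_div_assoc, le_div_iff₀ hc]
    calc empTrans st ac N s a s' * d ^ 2 * cnt st ac N s a
        = (empTrans st ac N s a s' * cnt st ac N s a) * |d| * |d| := by
          rw [← sq_abs]; ring
      _ ≤ (arrivals st N s s' : ℝ) * |d| * |d| := by gcongr
      _ ≤ (2 * biasRadius S A T H γ) * (2 * H) :=
          mul_le_mul h1 h2 (abs_nonneg _) (by positivity)
      _ = _ := by ring

theorem sum_empTrans_mul_sq_le {N : ℕ} {f g : Fin S → ℝ} (hf : f ∈ biasSet H γ T A st rw N)
    (hg : g ∈ biasSet H γ T A st rw N) (s : Fin S) (a : Fin A) :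
    ∑ s', empTrans st ac N s a s' * ((f s' - f s) - (g s' - g s)) ^ 2
      ≤ S * (4 * (H * biasRadius S A T H γ / cnt st ac N s a)) := by
  refine (Finset.sum_le_sum fun s' _ => empTrans_mul_sq_le hf hg s a s').trans (le_of_eq ?_)
  simp

theorem abs_increment_sub_le {f g : Fin S → ℝ} (hf : ∀ s, 0 ≤ f s ∧ f s ≤ H)
    (hg : ∀ s, 0 ≤ g s ∧ g s ≤ H) (s s' : Fin S) : |(f s' - f s) - (g s' - g s)| ≤ 2 * H := by
  have e1 := hf s; have e2 := hf s'; have e3 := hg s; have e4 := hg s'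
  exact abs_le.2 ⟨by linarith, by linarith⟩

/-- The empirical variance of a function in `biasSet` is at most of the order of the true variance of
`h`. -/
theorem vecVar_candidate_le (Y : IsTypical M H γ T h st ac rw b) (hγ : 1 ≤ γ) {N : ℕ} (hN : N ≤ T)
    {f : Fin S → ℝ} (hf : f ∈ biasSet H γ T A st rw N) (hh : h ∈ biasSet H γ T A st rw N)
    (s : Fin S) (a : Fin A) :
    vecVar (empTrans st ac N s a) f ≤ 2 * vecVar (M.trans s a) h
      + 18 * H ^ 2 * rate st ac γ N s a ^ 2
      + 8 * (S * (H * biasRadius S A T H γ / cnt st ac N s a)) := by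
  have hH : 0 ≤ H := (hf.1 s).1.trans (hf.1 s).2
  have hD := biasRadius_nonneg (S := S) (A := A) (T := T) (γ := γ) hH
  have hc := cnt_pos st ac N s a
  have hV : 0 ≤ vecVar (M.trans s a) h := vecVar_nonneg (M.trans_nonneg s a) (M.trans_sum s a)
  rcases empTrans_cases st ac N s a with h0 | h0
  · have : vecVar (empTrans st ac N s a) f = 0 := by simp [vecVar, h0.1]
    rw [this]
    have : 0 ≤ H * biasRadius S A T H γ / cnt st ac N s a := by positivity
    positivity
  · -- the variance of `f` is at most its second moment about `m + (f s - h s)`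
    set m := ∑ s', empTrans st ac N s a s' * h s' with hm
    have h1 := vecVar_le_sum_sq (f := f) h0.1 (m + (f s - h s))
    have h2 : ∑ s', empTrans st ac N s a s' * (f s' - (m + (f s - h s))) ^ 2
        ≤ ∑ s', (2 * (empTrans st ac N s a s' * (h s' - m) ^ 2)
          + 2 * (empTrans st ac N s a s' * ((f s' - f s) - (h s' - h s)) ^ 2)) := by
      refine Finset.sum_le_sum fun s' _ => ?_
      have e := empTrans_nonneg st ac N s a s'
      have : (f s' - (m + (f s - h s))) ^ 2
          ≤ 2 * (h s' - m) ^ 2 + 2 * ((f s' - f s) - (h s' - h s)) ^ 2 := by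
        nlinarith [sq_nonneg ((h s' - m) - ((f s' - f s) - (h s' - h s)))]
      nlinarith [mul_le_mul_of_nonneg_left this e]
    rw [Finset.sum_add_distrib, ← Finset.mul_sum, ← Finset.mul_sum,
      ← vecVar_eq_centered h0.1] at h2
    have h3 := sum_empTrans_mul_sq_le (ac := ac) hf hh s a
    have h4 := (abs_le.1 (abs_vecVar_sub_le Y.bias Y.bias_sq hγ hh.1 hN s a)).2
    linarith

/-- The estimation error, tested against `f - h`, which may be replaced by the difference of the
increments of `f` and `h` as long as the empirical transition probabilities sum up to `1`. -/
theorem sum_empTrans_sub_mul_sub_le (Y : IsTypical M H γ T h st ac rw b) (hγ : 1 ≤ γ)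
    (hS : 1 ≤ S) {N : ℕ} (hN : N ≤ T) {f : Fin S → ℝ} (hf : f ∈ biasSet H γ T A st rw N)
    (hh : h ∈ biasSet H γ T A st rw N) (s : Fin S) (a : Fin A) :
    ∑ s', (empTrans st ac N s a s' - M.trans s a s') * (f s' - h s')
      ≤ 4 * S * (√(H * biasRadius S A T H γ / cnt st ac N s a) * rate st ac γ N s a ^ 2)
        + 6 * S * H * rate st ac γ N s a ^ 4 + 8 * S * H * rate st ac γ N s a ^ 3 := by
  have hH : 0 ≤ H := (hf.1 s).1.trans (hf.1 s).2
  have hγ0 : 0 ≤ γ := zero_le_one.trans hγ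
  have hS1 : (1 : ℝ) ≤ S := by exact_mod_cast hS
  have hq0 := rate_nonneg st ac (γ := γ) N s a
  have hq4 := rate_pow_four st ac hγ0 N s a
  set r := √(H * biasRadius S A T H γ / cnt st ac N s a) with hr
  have hr0 : 0 ≤ r := Real.sqrt_nonneg _
  rcases empTrans_cases st ac N s a with h0 | h0
  · rw [h0.2.2, div_one] at hq4
    set q := rate st ac γ N s a
    have h1 : ∑ s', (empTrans st ac N s a s' - M.trans s a s') * (f s' - h s')
        ≤ ∑ s', M.trans s a s' * H := by
      refine Finset.sum_le_sum fun s' _ => ?_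
      rw [h0.1 s']
      have e1 := hf.1 s'; have e2 := hh.1 s'
      nlinarith [M.trans_nonneg s a s']
    rw [← Finset.sum_mul, M.trans_sum, one_mul] at h1
    have h2 : H * 1 ≤ (S * H) * q ^ 4 := by
      rw [hq4]
      nlinarith [mul_nonneg hH hγ0]
    have h3 : 0 ≤ 4 * S * (r * q ^ 2) + 5 * S * H * q ^ 4 + 8 * S * H * q ^ 3 := by positivity
    linarith
  · have e : ∑ s', (empTrans st ac N s a s' - M.trans s a s') * (f s' - h s')
        = ∑ s', (empTrans st ac N s a s' - M.trans s a s') * ((f s' - f s) - (h s' - h s)) := by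
      have e1 : ∑ s', (empTrans st ac N s a s' - M.trans s a s') * (f s - h s) = 0 := by
        rw [← Finset.sum_mul, Finset.sum_sub_distrib, h0.1, M.trans_sum, sub_self, zero_mul]
      rw [← sub_zero (∑ s', (empTrans st ac N s a s' - M.trans s a s') * (f s' - h s')), ← e1,
        ← Finset.sum_sub_distrib]
      exact Finset.sum_congr rfl fun s' _ => by ring
    set q := rate st ac γ N s a with hqdef
    have h1 : ∀ s', (empTrans st ac N s a s' - M.trans s a s') * ((f s' - f s) - (h s' - h s))
        ≤ 4 * (r * q ^ 2) + 6 * H * q ^ 4 + 8 * H * q ^ 3 := by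
      intro s'
      have g1 := abs_trans_sub_empTrans_le Y.coord hγ hN s a s'
      rw [abs_sub_comm, ← hqdef] at g1
      have g2 := abs_increment_sub_le hf.1 hh.1 s s'
      set d := (f s' - f s) - (h s' - h s) with hd
      have g3 : √(empTrans st ac N s a s') * |d| ≤ 2 * r := by
        have := Real.sqrt_le_sqrt (empTrans_mul_sq_le (ac := ac) hf hh s a s')
        rw [Real.sqrt_mul (empTrans_nonneg _ _ _ _ _ _), Real.sqrt_sq_eq_abs,
          Real.sqrt_mul (by norm_num), show √(4 : ℝ) = 2 by
            rw [show (4 : ℝ) = 2 ^ 2 by norm_num]; exact Real.sqrt_sq (by norm_num)] at this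
        exact this
      calc _ ≤ |empTrans st ac N s a s' - M.trans s a s'| * |d| := by
            rw [← abs_mul]; exact le_abs_self _
        _ ≤ (2 * (√(empTrans st ac N s a s') * q ^ 2) + 3 * q ^ 4 + 4 * q ^ 3) * |d| :=
            mul_le_mul_of_nonneg_right g1 (abs_nonneg _)
        _ = 2 * (√(empTrans st ac N s a s') * |d|) * q ^ 2 + (3 * q ^ 4 + 4 * q ^ 3) * |d| := by
            ring
        _ ≤ 2 * (2 * r) * q ^ 2 + (3 * q ^ 4 + 4 * q ^ 3) * (2 * H) := by gcongr
        _ = _ := by ring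
    rw [e]
    refine (Finset.sum_le_sum fun s' _ => h1 s').trans (le_of_eq ?_)
    simp only [Finset.sum_const, Finset.card_univ, Fintype.card_fin, nsmul_eq_mul]
    ring

/-- The error of a candidate: the leading term has the variance of the true bias function `h`. -/
theorem candidate_error_le (Y : IsTypical M H γ T h st ac rw b) (hγ : 1 ≤ γ)
    (hS : 1 ≤ S) {N : ℕ} (hN : N ≤ T) {c : Candidate S A}
    (hc : c ∈ confSet M.meanReward H γ T st ac rw N)
    (hh : h ∈ biasSet H γ T A st rw N) (s : Fin S) (a : Fin A) :
    ∑ s', (c.trans s a s' - empTrans st ac N s a s') * c.bias s'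
        + ∑ s', (empTrans st ac N s a s' - M.trans s a s') * c.bias s'
      ≤ 5 * (√(vecVar (M.trans s a) h) * rate st ac γ N s a ^ 2)
        + 27 * S * H * rate st ac γ N s a ^ 3 + 20 * S * H * rate st ac γ N s a ^ 4
        + 10 * S * (√(H * biasRadius S A T H γ / cnt st ac N s a) * rate st ac γ N s a ^ 2) := by
  have hH : 0 ≤ H := (hh.1 s).1.trans (hh.1 s).2
  have hγ0 : 0 ≤ γ := zero_le_one.trans hγ
  have hS1 : (1 : ℝ) ≤ S := by exact_mod_cast hS
  have hD := biasRadius_nonneg (S := S) (A := A) (T := T) (γ := γ) hH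
  have h1 := (le_abs_self _).trans (hc.2.2.2.1 s a)
  rw [sqrt_mul_div_cnt st ac hγ0, mul_div_assoc, ← rate_pow_four st ac hγ0, mul_div_assoc,
      ← rate_cube st ac hγ0] at h1
  have h2 := (le_abs_self _).trans (Y.bias.abs_sum_le hγ hh.1 hN s a)
  have h3 := sum_empTrans_sub_mul_sub_le Y hγ hS hN hc.1 hh s a
  have h4 := vecVar_candidate_le Y hγ hN hc.1 hh s a
  have hq0 := rate_nonneg st ac (γ := γ) N s a
  set q := rate st ac γ N s a
  have hx : 0 ≤ H * biasRadius S A T H γ / cnt st ac N s a :=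
    div_nonneg (mul_nonneg hH hD) (cnt_pos _ _ _ _ _).le
  have hr2 : √(H * biasRadius S A T H γ / cnt st ac N s a) ^ 2
      = H * biasRadius S A T H γ / cnt st ac N s a := Real.sq_sqrt hx
  set r := √(H * biasRadius S A T H γ / cnt st ac N s a)
  have hr0 : 0 ≤ r := Real.sqrt_nonneg _
  rw [← hr2] at h4
  set V := vecVar (M.trans s a) h
  have h5 : √(vecVar (empTrans st ac N s a) c.bias) ≤ 3 / 2 * √V + 17 / 4 * H * q + 3 * S * r := by
    have e1 : vecVar (empTrans st ac N s a) c.bias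
        ≤ (2 * V + (17 / 4 * H * q) ^ 2) + (3 * S * r) ^ 2 := by
      have : (S : ℝ) * r ^ 2 ≤ S ^ 2 * r ^ 2 :=
        mul_le_mul_of_nonneg_right (le_self_pow₀ hS1 (by norm_num)) (sq_nonneg r)
      have : 0 ≤ H ^ 2 * q ^ 2 := by positivity
      nlinarith
    have e2 := sqrt_le_sqrt_add (by positivity) e1
    have e3 : √(2 * V + (17 / 4 * H * q) ^ 2) ≤ √(2 * V) + 17 / 4 * H * q :=
      sqrt_le_sqrt_add (by positivity) le_rfl
    have e4 : √(2 * V) ≤ 3 / 2 * √V := by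
      rw [Real.sqrt_mul (by norm_num)]
      refine mul_le_mul_of_nonneg_right ?_ (Real.sqrt_nonneg _)
      rw [Real.sqrt_le_left (by norm_num)]; norm_num
    linarith
  have h6 := mul_le_mul_of_nonneg_right h5 (sq_nonneg q)
  have e : ∑ s', (empTrans st ac N s a s' - M.trans s a s') * c.bias s'
      = ∑ s', (empTrans st ac N s a s' - M.trans s a s') * h s'
        + ∑ s', (empTrans st ac N s a s' - M.trans s a s') * (c.bias s' - h s') := by
    rw [← Finset.sum_add_distrib]
    exact Finset.sum_congr rfl fun s' _ => by ring
  have e3 : H * q ^ 3 ≤ S * (H * q ^ 3) := le_mul_of_one_le_left (by positivity) hS1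
  have e4 : H * q ^ 4 ≤ S * (H * q ^ 4) := le_mul_of_one_le_left (by positivity) hS1
  have e5 : 0 ≤ S * (H * q ^ 3) := by positivity
  have e6 : 0 ≤ S * (H * q ^ 4) := by positivity
  rw [e]
  linarith

/-- The true variance of `f - h` is small: up to the `ℓ¹` error it is the empirical second moment about
`f s - h s`. -/
theorem vecVar_sub_le (Y : IsTypical M H γ T h st ac rw b) (hγ : 1 ≤ γ)
    {N : ℕ} (hN : N ≤ T) {f : Fin S → ℝ} (hf : f ∈ biasSet H γ T A st rw N)
    (hh : h ∈ biasSet H γ T A st rw N) (s : Fin S) (a : Fin A) :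
    vecVar (M.trans s a) (fun s' => f s' - h s')
      ≤ 4 * H ^ 2 * (√(14 * S) * rate st ac γ N s a ^ 2)
        + S * (4 * (H * biasRadius S A T H γ / cnt st ac N s a)) := by
  have h1 := vecVar_le_sum_sq (f := fun s' => f s' - h s') (M.trans_sum s a) (f s - h s)
  have h2 := sum_empTrans_mul_sq_le (ac := ac) hf hh s a
  have h3 := sum_abs_trans_sub_empTrans_le Y.coord hγ hN s a
  have h4 : ∑ s', M.trans s a s' * (f s' - h s' - (f s - h s)) ^ 2
      ≤ ∑ s', (4 * H ^ 2 * |M.trans s a s' - empTrans st ac N s a s'|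
        + empTrans st ac N s a s' * ((f s' - f s) - (h s' - h s)) ^ 2) := by
    refine Finset.sum_le_sum fun s' _ => ?_
    have g2 := abs_increment_sub_le hf.1 hh.1 s s'
    have e : f s' - h s' - (f s - h s) = (f s' - f s) - (h s' - h s) := by ring
    rw [e]
    set d := (f s' - f s) - (h s' - h s)
    have g3 : d ^ 2 ≤ 4 * H ^ 2 := by
      rw [← sq_abs]
      have := pow_le_pow_left₀ (abs_nonneg d) g2 2
      linarith
    have g4 := le_abs_self (M.trans s a s' - empTrans st ac N s a s')
    nlinarith [mul_le_mul_of_nonneg_right g4 (sq_nonneg d),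
      mul_le_mul_of_nonneg_left g3 (abs_nonneg (M.trans s a s' - empTrans st ac N s a s'))]
  rw [Finset.sum_add_distrib, ← Finset.mul_sum] at h4
  have h5 := mul_le_mul_of_nonneg_left h3 (show 0 ≤ 4 * H ^ 2 by positivity)
  linarith

/-- At a minimum of `h` the optimality equation bounds `ρ` below by a mean reward. -/
theorem IsBiasPair.gain_nonneg (B : IsBiasPair M H h ρ) (hS : 1 ≤ S) (hA : 1 ≤ A) : 0 ≤ ρ := by
  have : Nonempty (Fin S) := ⟨⟨0, hS⟩⟩
  obtain ⟨s, hs⟩ := Finite.exists_min h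
  have h1 := B.gap_nonneg s ⟨0, hA⟩
  have h2 := (EBF.Run.meanReward_mem (M := M) s ⟨0, hA⟩).1
  have h3 := (sum_mul_mem_Icc (M.trans_nonneg s ⟨0, hA⟩) (M.trans_sum s ⟨0, hA⟩)
    (fun s' => ⟨hs s', (B.mem s').2⟩)).1
  rw [MDP.nextMean] at h1
  linarith

theorem IsLargeHorizon.crude_le (L : IsLargeHorizon S A T H γ) :
    H * S * √(A * T * γ) ≤ S * A * H * γ * (1 + Real.log T) * √T := by
  have hl := L.log_nonneg
  have e1 := L.S_ge; have e2 := L.A_ge; have e3 := L.hH; have e4 := L.hγ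
  have h1 : √(A * T * γ) ≤ A * γ * √T := by
    rw [show (A : ℝ) * T * γ = A * γ * T by ring, Real.sqrt_mul (by positivity)]
    refine mul_le_mul_of_nonneg_right ?_ (Real.sqrt_nonneg _)
    have : (1 : ℝ) ≤ A * γ := by nlinarith
    rw [Real.sqrt_le_left (by positivity)]
    exact le_self_pow₀ this (by norm_num)
  calc H * S * √(A * T * γ) ≤ H * S * (A * γ * √T) := by gcongr
    _ = (S * A * H * γ * √T) * 1 := by ring
    _ ≤ (S * A * H * γ * √T) * (1 + Real.log T) :=
        mul_le_mul_of_nonneg_left (by linarith) (by positivity)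
    _ = _ := by ring

/-- The conditional variances of the true bias function sum up to `O(H T)`, instead of the trivial
`O(H² T)`: the increments of `h²` telescope, and the drift of `h` is bounded by `1` plus the gaps. -/
theorem sum_vecVar_le (L : IsLargeHorizon S A T H γ) (B : IsBiasPair M H h ρ)
    (Y : IsTypical M H γ T h st ac rw b)
    (hreg : ∑ t ∈ Finset.range T, (ρ - M.meanReward (st t) (ac t)) ≤ 23 * (H * S * √(A * T * γ))) :
    ∑ t ∈ Finset.range T, vecVar (M.trans (st t) (ac t)) h ≤ 3 * (H * T) := by
  have hS1 : 1 ≤ S := by have := L.hS; omega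
  have hA1 : 1 ≤ A := by have := L.hA; omega
  have hH := L.hH
  have hρ := B.gain_nonneg hS1 hA1
  -- `V(P,h) = (Pᵀh² - h²) + (h - Pᵀh)(h + Pᵀh)`, where `h - Pᵀh = r - ρ + gap ≤ 1 + gap`
  have h1 : ∀ t, vecVar (M.trans (st t) (ac t)) h
      ≤ (M.nextMean (st t) (ac t) (fun s => h s ^ 2) - h (st (t + 1)) ^ 2)
        + (h (st (t + 1)) ^ 2 - h (st t) ^ 2)
        + (2 * H + 2 * H *
          (h (st t) + ρ - M.meanReward (st t) (ac t) - M.nextMean (st t) (ac t) h)) := by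
    intro t
    have g0 := B.gap_nonneg (st t) (ac t)
    have g1 := (EBF.Run.meanReward_mem (M := M) (st t) (ac t)).2
    have g2 := sum_mul_mem_Icc (M.trans_nonneg (st t) (ac t)) (M.trans_sum (st t) (ac t)) B.mem
    have g3 := B.mem (st t)
    change M.nextMean (st t) (ac t) (fun s => h s ^ 2) - M.nextMean (st t) (ac t) h ^ 2 ≤ _
    change 0 ≤ M.nextMean (st t) (ac t) h ∧ M.nextMean (st t) (ac t) h ≤ H at g2
    set x := M.nextMean (st t) (ac t) h
    set gap := h (st t) + ρ - M.meanReward (st t) (ac t) - x with hgap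
    have g4 : (h (st t) - x) * (h (st t) + x) ≤ (1 + gap) * (h (st t) + x) :=
      mul_le_mul_of_nonneg_right (by linarith) (by linarith)
    have g5 : (1 + gap) * (h (st t) + x) ≤ (1 + gap) * (2 * H) :=
      mul_le_mul_of_nonneg_left (by linarith) (by linarith)
    linarith
  have h2 := Finset.sum_le_sum fun t (_ : t ∈ Finset.range T) => h1 t
  rw [Finset.sum_add_distrib, Finset.sum_add_distrib, Finset.sum_add_distrib,
    ← Finset.mul_sum _ _ (2 * H), Finset.sum_range_sub (fun t => h (st t) ^ 2)] at h2
  simp only [Finset.sum_const, Finset.card_range, nsmul_eq_mul] at h2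
  have h3 := Y.mart_sq
  have h4 : h (st T) ^ 2 ≤ H ^ 2 := pow_le_pow_left₀ (B.mem _).1 (B.mem _).2 2
  have h5 := sum_gap_le B Y (n := T) le_rfl
  obtain ⟨u, y, ℓ, hℓ, hu, -, k1, k2, k3, k4, k5, k6⟩ := L.exists_scale
  have h6 := L.mul_sqrt_le
  have h7 : H * 1 ≤ H * √(γ * T) := mul_le_mul_of_nonneg_left L.one_le_sqrt (by linarith)
  have h8 := L.crude_le
  rw [← hℓ, ← hu, ← k4] at h8
  set Q := H * S * √(A * T * γ)
  set Z := H * √(γ * T)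
  have h9 : 48 * (u * y ^ 2) ≤ T := by
    rw [← k5]
    have e1 : u ≤ u ^ 3 := le_self_pow₀ k2 (by norm_num)
    have e2 : 1 ≤ u ^ 3 := one_le_pow₀ k2
    have e3 : y ≤ y ^ 2 := le_self_pow₀ (by linarith) (by norm_num)
    nlinarith [mul_le_mul_of_nonneg_right (show 48 * u ≤ y ^ 2 by linarith) (sq_nonneg y)]
  have h10 : 0 ≤ h (st 0) ^ 2 := sq_nonneg _
  have h11 : ∑ t ∈ Finset.range T, vecVar (M.trans (st t) (ac t)) h
      ≤ 2 * (H * T) + H * (48 * Q) := by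
    have e1 : 2 * H ^ 2 * √(γ * T) = H * (2 * Z) := by ring
    have e2 : 2 * H * √(γ * T) = 2 * Z := by ring
    rw [e1] at h3
    rw [e2] at h5
    have e3 := mul_le_mul_of_nonneg_left h5 (show 0 ≤ 2 * H by linarith)
    have e4 : H * (2 * Z + H + 2 * (23 * Q + H + 2 * Z)) ≤ H * (48 * Q) :=
      mul_le_mul_of_nonneg_left (by linarith) (by linarith)
    have e5 := mul_le_mul_of_nonneg_left hreg (show 0 ≤ 2 * H by linarith)
    nlinarith
  have h12 := mul_le_mul_of_nonneg_left (show 48 * Q ≤ T by linarith) (show 0 ≤ H by linarith)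
  linarith

theorem IsLargeHorizon.biasRadius_le (L : IsLargeHorizon S A T H γ) :
    biasRadius S A T H γ ≤ 49 * (H * S * √(A * T * γ)) := by
  have hH := L.hH
  have h6 := L.mul_sqrt_le
  have h7 : H * 1 ≤ H * √(γ * T) := mul_le_mul_of_nonneg_left L.one_le_sqrt (by linarith)
  have h8 : √(2 * γ * T) ≤ 2 * √(γ * T) := by
    rw [mul_assoc, Real.sqrt_mul (by norm_num)]
    refine mul_le_mul_of_nonneg_right ?_ (Real.sqrt_nonneg _)
    rw [Real.sqrt_le_left (by norm_num)]; norm_num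
  have h9 := mul_le_mul_of_nonneg_left h8 (show 0 ≤ H by linarith)
  have h10 : 0 ≤ H * S * √(A * T * γ) := by positivity
  unfold biasRadius
  linarith

/-- All error terms other than the leading one are of order `u³ T^{1/4}` with `u` as in `exists_scale`,
hence at most `√T`. -/
theorem IsLargeHorizon.lower_order_le (L : IsLargeHorizon S A T H γ) :
    27 * S * H * γ * (√(2 * (S * A * (1 + Real.log T))) * √(3 * √(S * A * T)))
      + (20 * S * H * γ + 10 * S * √(γ * (H * biasRadius S A T H γ)))
        * (2 * (S * A * (1 + Real.log T)))
      + ((4 * H ^ 2 * (√(14 * S) * √γ) * (3 * √(S * A * T))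
        + 4 * S * (H * biasRadius S A T H γ) * (2 * (S * A * (1 + Real.log T)))) / √(√(T : ℝ))
        + γ * √(√(T : ℝ)))
      + H * (2 * (S * A * (1 + Real.log T)) + 1) ≤ √T := by
  have hD0 : 0 ≤ biasRadius S A T H γ := biasRadius_nonneg (by linarith [L.hH])
  have hD := L.biasRadius_le
  have hQ := L.crude_le
  obtain ⟨u, y, ℓ, hℓ, hu, hy, k1, k2, k3, k4, k5, k6⟩ := L.exists_scale
  have e1 := L.S_ge; have e2 := L.A_ge; have e3 := L.hH; have e4 := L.hγ
  rw [← hℓ, ← hu, ← k4] at hQ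
  rw [← hℓ, ← hy, ← k4]
  have f1 : (1 : ℝ) ≤ S := by linarith
  have f2 : (1 : ℝ) ≤ A := by linarith
  have f3 : (1 : ℝ) ≤ H := by linarith
  have hy1 : 1 ≤ y := by
    have : 1 ≤ u ^ 3 := one_le_pow₀ k2
    linarith
  have mono : ∀ {x z : ℝ}, 0 ≤ x → 1 ≤ z → u = x * z → x ≤ u := fun hx hz hxz => by
    rw [hxz]; exact le_mul_of_one_le_right hx hz
  have mul1 : ∀ {x z : ℝ}, 1 ≤ x → 1 ≤ z → 1 ≤ x * z := one_le_mul_of_one_le_of_one_le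
  have g1 : S * H * γ ≤ u := mono (z := A * ℓ) (by positivity) (mul1 f2 k1) (by rw [hu]; ring)
  have g2 : S * A * ℓ ≤ u := mono (z := H * γ) (by positivity) (mul1 f3 e4) (by rw [hu]; ring)
  have g3 : γ * H ≤ u :=
    mono (z := S * A * ℓ) (by positivity) (mul1 (mul1 f1 f2) k1) (by rw [hu]; ring)
  have g4 : (S : ℝ) ≤ u := mono (z := A * H * γ * ℓ) (by positivity)
    (mul1 (mul1 (mul1 f2 f3) e4) k1) (by rw [hu]; ring)
  have g5 : (S : ℝ) * A ≤ u := mono (z := H * γ * ℓ) (by positivity)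
    (mul1 (mul1 f3 e4) k1) (by rw [hu]; ring)
  have g6 : H ≤ u := mono (z := S * A * γ * ℓ) (by positivity)
    (mul1 (mul1 (mul1 f1 f2) e4) k1) (by rw [hu]; ring)
  have g7 : γ ≤ u := mono (z := S * A * H * ℓ) (by positivity)
    (mul1 (mul1 (mul1 f1 f2) f3) k1) (by rw [hu]; ring)
  have g8 : (S : ℝ) * H ≤ u := mono (z := A * γ * ℓ) (by positivity)
    (mul1 (mul1 f2 e4) k1) (by rw [hu]; ring)
  have hD' : biasRadius S A T H γ ≤ 49 * (u * y ^ 2) := by linarith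
  have hu0 : 0 ≤ u := by linarith
  have hk0 : 0 ≤ S * A * ℓ := by positivity
  -- the five groups of terms
  have t1 : 27 * S * H * γ * (√(2 * (S * A * ℓ)) * √(3 * √(S * A * T))) ≤ 108 * (u ^ 3 * y) := by
    have a1 : √(2 * (S * A * ℓ)) ≤ 2 * u := by
      rw [Real.sqrt_le_left (by positivity)]
      nlinarith
    have a2 : √(S * A * T) ≤ u * y ^ 2 := by
      rw [Real.sqrt_le_left (by positivity), mul_pow, ← pow_mul, k5]
      refine mul_le_mul_of_nonneg_right (g5.trans ?_) (Nat.cast_nonneg _)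
      nlinarith
    have a3 : √(3 * √(S * A * T)) ≤ 2 * (u * y) := by
      rw [Real.sqrt_le_left (by positivity)]
      have : u * y ^ 2 ≤ u ^ 2 * y ^ 2 := by
        refine mul_le_mul_of_nonneg_right ?_ (sq_nonneg y)
        nlinarith
      nlinarith
    calc _ = 27 * (S * H * γ) * (√(2 * (S * A * ℓ)) * √(3 * √(S * A * T))) := by ring
      _ ≤ 27 * u * ((2 * u) * (2 * (u * y))) := by gcongr
      _ = _ := by ring
  have t2 : (20 * S * H * γ + 10 * S * √(γ * (H * biasRadius S A T H γ))) * (2 * (S * A * ℓ))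
      ≤ 180 * (u ^ 3 * y) := by
    have a1 : √(γ * (H * biasRadius S A T H γ)) ≤ 7 * (u * y) := by
      rw [Real.sqrt_le_left (by positivity)]
      calc γ * (H * biasRadius S A T H γ) = (γ * H) * biasRadius S A T H γ := by ring
        _ ≤ u * (49 * (u * y ^ 2)) := by gcongr
        _ = _ := by ring
    have a2 : u ^ 2 ≤ u ^ 3 * y := by
      calc u ^ 2 = u ^ 2 * 1 * 1 := by ring
        _ ≤ u ^ 2 * u * y := by gcongr
        _ = _ := by ring
    calc _ = 40 * ((S * H * γ) * (S * A * ℓ))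
          + 20 * (S * √(γ * (H * biasRadius S A T H γ)) * (S * A * ℓ)) := by ring
      _ ≤ 40 * (u * u) + 20 * (u * (7 * (u * y)) * u) := by gcongr
      _ = 40 * u ^ 2 + 140 * (u ^ 3 * y) := by ring
      _ ≤ _ := by linarith
  have t3 : (4 * H ^ 2 * (√(14 * S) * √γ) * (3 * √(S * A * T))
      + 4 * S * (H * biasRadius S A T H γ) * (2 * (S * A * ℓ))) / y ≤ 440 * (u ^ 3 * y) := by
    have e14 : √14 ≤ (3.75 : ℝ) := by rw [Real.sqrt_le_left (by norm_num)]; norm_num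
    have h6 : √(14 * S) * √γ * √(S * A * T) = √14 * (S * √(A * T * γ)) := by
      rw [← Real.sqrt_mul (by positivity), ← Real.sqrt_mul (by positivity),
        show 14 * (S : ℝ) * γ * (S * A * T) = 14 * ((S : ℝ) ^ 2 * (A * T * γ)) by ring,
        Real.sqrt_mul (by norm_num), Real.sqrt_mul (sq_nonneg _), Real.sqrt_sq (Nat.cast_nonneg S)]
    have a1 : 4 * H ^ 2 * (√(14 * S) * √γ) * (3 * √(S * A * T)) ≤ 45 * (u * (u * y ^ 2)) := by
      calc _ = 12 * H * H * (√(14 * S) * √γ * √(S * A * T)) := by ring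
        _ = √14 * (12 * (H * (H * S * √(A * T * γ)))) := by rw [h6]; ring
        _ ≤ 3.75 * (12 * (u * (u * y ^ 2))) := by gcongr
        _ = _ := by ring
    have a2 : 4 * S * (H * biasRadius S A T H γ) * (2 * (S * A * ℓ)) ≤ 392 * (u ^ 3 * y ^ 2) := by
      calc _ = 8 * ((S * H) * biasRadius S A T H γ * (S * A * ℓ)) := by ring
        _ ≤ 8 * (u * (49 * (u * y ^ 2)) * u) := by gcongr
        _ = _ := by ring
    have a3 : u * (u * y ^ 2) ≤ u ^ 3 * y ^ 2 := by
      calc u * (u * y ^ 2) = u ^ 2 * y ^ 2 * 1 := by ring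
        _ ≤ u ^ 2 * y ^ 2 * u := by gcongr
        _ = _ := by ring
    have a4 : 0 ≤ u ^ 3 * y ^ 2 := by positivity
    rw [div_le_iff₀ k3]
    calc _ ≤ 440 * (u ^ 3 * y ^ 2) := by linarith
      _ = _ := by ring
  have t4 : γ * y ≤ u ^ 3 * y :=
    mul_le_mul_of_nonneg_right (g7.trans (le_self_pow₀ k2 (by norm_num))) k3.le
  have t5 : H * (2 * (S * A * ℓ) + 1) ≤ 3 * (u ^ 3 * y) := by
    have a2 : u ^ 2 ≤ u ^ 3 * y := by
      calc u ^ 2 = u ^ 2 * 1 * 1 := by ring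
        _ ≤ u ^ 2 * u * y := by gcongr
        _ = _ := by ring
    calc H * (2 * (S * A * ℓ) + 1) ≤ u * (2 * u + u) := by gcongr
      _ = 3 * u ^ 2 := by ring
      _ ≤ _ := by linarith
  have t6 : 800 * (u ^ 3 * y) ≤ y ^ 2 := by nlinarith
  have t7 : 0 ≤ u ^ 3 * y := by positivity
  linarith

/-- The regret on a typical trajectory: the error bound of `candidate_error_le` is summed over the
steps, and the martingale of the candidates' bias functions `b t` is split into those of `h` and of
`b t - h`. -/
theorem sum_regret_le (L : IsLargeHorizon S A T H γ) (B : IsBiasPair M H h ρ)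
    (Y : IsTypical M H γ T h st ac rw b) (E : IsEBFPath M H γ T st ac rw cand)
    (hb : ∀ t < T, (∀ s, 0 ≤ (cand t).bias s ∧ (cand t).bias s ≤ H) → b t = (cand t).bias) :
    ∑ t ∈ Finset.range T, (ρ - M.meanReward (st t) (ac t)) ≤ 32 * √(S * A * H * T * γ) := by
  have hS1 : 1 ≤ S := by have := L.hS; omega
  have hγ := L.hγ
  have hγ0 : 0 ≤ γ := by linarith
  have hH0 : 0 ≤ H := by linarith [L.hH]
  have O := isOptimistic L B Y E hb T le_rfl
  have hreg := sum_regret_le_crude L Y E hb le_rfl O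
  have hvar := sum_vecVar_le L B Y hreg
  have hbt : ∀ t < T, b t = (cand t).bias := fun t ht => hb t ht (O t ht).1.1.1
  have hmem : ∀ t < T, h ∈ biasSet H γ T A st rw (episodeStart st ac t) := fun t ht => by
    have := episodeStart_le st ac t
    exact mem_biasSet L B Y E hb (by omega) (isOptimistic L B Y E hb _ (by omega))
  set D := biasRadius S A T H γ with hD
  have hD0 : 0 ≤ D := biasRadius_nonneg hH0
  -- the powers of `rate` at step `t` in terms of the weights
  have r2 : ∀ t, rate st ac γ (episodeStart st ac t) (st t) (ac t) ^ 2 = √γ * √(weight st ac t) :=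
    fun t => by rw [rate_sq, sqrt_mul_div_cnt_weight hγ0]
  have r4 : ∀ t, rate st ac γ (episodeStart st ac t) (st t) (ac t) ^ 4 = γ * weight st ac t :=
    fun t => by rw [rate_pow_four st ac hγ0]; rfl
  have r3 : ∀ t, rate st ac γ (episodeStart st ac t) (st t) (ac t) ^ 3
      ≤ γ * √(√(weight st ac t)) ^ 3 := fun t => by
    rw [rate, sqrt_mul_div_cnt_weight hγ0, Real.sqrt_mul (Real.sqrt_nonneg _), mul_pow]
    refine mul_le_mul_of_nonneg_right ?_ (by positivity)
    have e1 : 1 ≤ √(√γ) := Real.one_le_sqrt.2 (Real.one_le_sqrt.2 hγ)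
    calc √(√γ) ^ 3 ≤ √(√γ) ^ 4 := pow_le_pow_right₀ e1 (by norm_num)
      _ = γ := by
        rw [show (4 : ℕ) = 2 * 2 from rfl, pow_mul, Real.sq_sqrt (Real.sqrt_nonneg _),
          Real.sq_sqrt hγ0]
  have rr : ∀ t, √(H * D / cnt st ac (episodeStart st ac t) (st t) (ac t)) *
      rate st ac γ (episodeStart st ac t) (st t) (ac t) ^ 2 = √(γ * (H * D)) * weight st ac t :=
    fun t => by
      rw [r2, sqrt_mul_div_cnt_weight (by positivity), Real.sqrt_mul hγ0]
      calc _ = √γ * √(H * D) * (√(weight st ac t) * √(weight st ac t)) := by ring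
        _ = _ := by rw [Real.mul_self_sqrt (weight_pos st ac t).le]
  have h1 : ∀ t ∈ Finset.range T, ρ - M.meanReward (st t) (ac t)
      ≤ 5 * √γ * (√(weight st ac t) * √(vecVar (M.trans (st t) (ac t)) h))
        + 27 * S * H * γ * √(√(weight st ac t)) ^ 3
        + (20 * S * H * γ + 10 * S * √(γ * (H * D))) * weight st ac t
        + (M.nextMean (st t) (ac t) h - h (st (t + 1)))
        + (M.nextMean (st t) (ac t) (fun s => b t s - h s) - (b t (st (t + 1)) - h (st (t + 1))))
        + (b t (st (t + 1)) - b t (st t)) := by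
    intro t ht
    have htT := Finset.mem_range.1 ht
    obtain ⟨hc, hρ⟩ := O t htT
    have e1 := regret_step_le (E.ac_eq t htT) hc hρ
    have e2 := candidate_error_le Y hγ hS1 ((episodeStart_le st ac t).trans htT.le) hc
      (hmem t htT) (st t) (ac t)
    rw [← hD, rr, r2, r4] at e2
    have e3 := mul_le_mul_of_nonneg_left (r3 t) (show 0 ≤ 27 * S * H by positivity)
    rw [← hbt t htT] at e1 e2
    have e4 : M.nextMean (st t) (ac t) (fun s => b t s - h s)
        = M.nextMean (st t) (ac t) (b t) - M.nextMean (st t) (ac t) h := by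
      simp only [MDP.nextMean, mul_sub, Finset.sum_sub_distrib]
    rw [e4]
    linarith
  have h2 := Finset.sum_le_sum h1
  rw [Finset.sum_add_distrib, Finset.sum_add_distrib, Finset.sum_add_distrib,
    Finset.sum_add_distrib, Finset.sum_add_distrib, ← Finset.mul_sum, ← Finset.mul_sum,
    ← Finset.mul_sum] at h2
  have hdiff : ∑ t ∈ Finset.range T, vecVar (M.trans (st t) (ac t)) (fun s => b t s - h s)
      ≤ 4 * H ^ 2 * (√(14 * S) * √γ) * (3 * √(S * A * T))
        + 4 * S * (H * D) * (2 * (S * A * (1 + Real.log T))) := by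
    have e1 : ∀ t ∈ Finset.range T, vecVar (M.trans (st t) (ac t)) (fun s => b t s - h s)
        ≤ 4 * H ^ 2 * (√(14 * S) * √γ) * √(weight st ac t)
          + 4 * S * (H * D) * weight st ac t := by
      intro t ht
      have htT := Finset.mem_range.1 ht
      have := vecVar_sub_le Y hγ ((episodeStart_le st ac t).trans htT.le) (O t htT).1.1
        (hmem t htT) (st t) (ac t)
      rw [r2, ← hD, ← hbt t htT] at this
      refine this.trans (le_of_eq ?_)
      rw [weight]
      ring
    refine (Finset.sum_le_sum e1).trans ?_
    rw [Finset.sum_add_distrib, ← Finset.mul_sum, ← Finset.mul_sum]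
    exact add_le_add
      (mul_le_mul_of_nonneg_left (sum_sqrt_weight_le st ac le_rfl) (by positivity))
      (mul_le_mul_of_nonneg_left (sum_weight_le st ac le_rfl) (by positivity))
  -- the leading term, by the Cauchy–Schwarz inequality
  have hmain := sum_sqrt_weight_mul_le st ac (g := fun s a => √(vecVar (M.trans s a) h))
    (fun _ _ => Real.sqrt_nonneg _) T
  have hsq : ∀ t, √(vecVar (M.trans (st t) (ac t)) h) ^ 2 = vecVar (M.trans (st t) (ac t)) h :=
    fun t => Real.sq_sqrt (vecVar_nonneg (M.trans_nonneg _ _) (M.trans_sum _ _))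
  simp only [hsq] at hmain
  have hw := sum_weight_le st ac (n := T) le_rfl
  have hw3 := sum_weight_three_quarters_le st ac (n := T) le_rfl
  have htel := sum_telescope_le st ac hH0 (h := b) (n := T) le_rfl L.one_le_T
    (fun t ht s => by rw [hbt t ht]; exact (O t ht).1.1.1 s)
    (fun t ht hne => by
      rw [hbt (t + 1) ht, hbt t (by omega), E.cand_same t ht hne])
  have hfb := Y.freedman_bias
  have hfd := Y.freedman_diff
  have hlow := L.lower_order_le
  rw [← hD] at hlow
  have hT0 : (0 : ℝ) < T := by exact_mod_cast L.one_le_T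
  have hH1 : 0 < H := by linarith [L.hH]
  have hHT : 0 < H * T := by positivity
  have hSA : (1 : ℝ) ≤ S * A := by nlinarith [L.S_ge, L.A_ge]
  set X := √(S * A * H * T * γ) with hX
  have m1 : 5 * √γ * ∑ t ∈ Finset.range T,
      √(weight st ac t) * √(vecVar (M.trans (st t) (ac t)) h) ≤ 27 * X := by
    have e1 : √(S * A * ∑ t ∈ Finset.range T, vecVar (M.trans (st t) (ac t)) h)
        ≤ √(3 * (S * A * (H * T))) := Real.sqrt_le_sqrt (by
      have := mul_le_mul_of_nonneg_left hvar (show (0 : ℝ) ≤ S * A by positivity)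
      linarith)
    have e2 : √γ * √(3 * (S * A * (H * T))) = √3 * X := by
      rw [← Real.sqrt_mul hγ0, hX, ← Real.sqrt_mul (by norm_num)]
      congr 1
      ring
    have e3 : √3 ≤ (9 / 5 : ℝ) := by rw [Real.sqrt_le_left (by norm_num)]; norm_num
    calc _ ≤ 5 * √γ * (3 * √(3 * (S * A * (H * T)))) :=
          mul_le_mul_of_nonneg_left (hmain.trans (by gcongr)) (by positivity)
      _ = 15 * (√γ * √(3 * (S * A * (H * T)))) := by ring
      _ = 15 * √3 * X := by rw [e2]; ring
      _ ≤ 15 * (9 / 5) * X := by gcongr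
      _ = 27 * X := by ring
  have m2 : √(γ / (H * T)) * ∑ i ∈ Finset.range T, vecVar (M.trans (st i) (ac i)) h
      + √(γ * (H * T)) ≤ 4 * √(γ * (H * T)) := by
    have e1 := mul_le_mul_of_nonneg_left hvar (Real.sqrt_nonneg (γ / (H * T)))
    have e2 : √(γ / (H * T)) * (H * T) = √(γ * (H * T)) := by
      nth_rw 2 [← Real.sqrt_sq hHT.le]
      rw [← Real.sqrt_mul (by positivity)]
      congr 1
      field_simp
    linarith
  have m3 : √(γ * (H * T)) ≤ X / 20 := by
    rw [le_div_iff₀ (by norm_num), hX]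
    refine Real.le_sqrt_of_sq_le ?_
    rw [mul_pow, Real.sq_sqrt (by positivity)]
    have : (400 : ℝ) ≤ S * A := by nlinarith [L.S_ge, L.A_ge]
    calc γ * (H * T) * 20 ^ 2 = 400 * (γ * (H * T)) := by ring
      _ ≤ S * A * (γ * (H * T)) := by gcongr
      _ = _ := by ring
  have m4 : √(T : ℝ) ≤ X := by
    rw [hX]
    refine Real.sqrt_le_sqrt ?_
    have : 1 ≤ S * A * H * γ := one_le_mul_of_one_le_of_one_le
      (one_le_mul_of_one_le_of_one_le hSA (by linarith [L.hH])) hγ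
    calc (T : ℝ) = 1 * T := by ring
      _ ≤ S * A * H * γ * T := by gcongr
      _ = _ := by ring
  have m5 := mul_le_mul_of_nonneg_left hw3 (show 0 ≤ 27 * S * H * γ by positivity)
  have m6 := mul_le_mul_of_nonneg_left hw
    (show 0 ≤ 20 * S * H * γ + 10 * S * √(γ * (H * D)) by positivity)
  have m7 : (∑ i ∈ Finset.range T, vecVar (M.trans (st i) (ac i)) (fun s => b i s - h s))
      / √(√(T : ℝ)) ≤ (4 * H ^ 2 * (√(14 * S) * √γ) * (3 * √(S * A * T))
        + 4 * S * (H * D) * (2 * (S * A * (1 + Real.log T)))) / √(√(T : ℝ)) := by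
    gcongr
  refine h2.trans ((add_le_add (add_le_add (add_le_add (add_le_add (add_le_add m1 m5) m6)
    (hfb.trans m2)) (hfd.trans (add_le_add m7 le_rfl))) htel).trans ?_)
  have hX0 : 0 ≤ X := Real.sqrt_nonneg _
  clear_value X
  have hsum : ∀ {x₁ x₂ x₃ x₄ x₅ : ℝ}, x₁ + x₂ + x₃ + x₄ ≤ √T → x₅ ≤ X / 20 →
      27 * X + x₁ + x₂ + 4 * x₅ + x₃ + x₄ ≤ 32 * X := fun h₁ h₂ => by linarith
  exact hsum hlow m3

end Refined

/-! ### Typical trajectories have high probability -/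

/-- The steps before `t` that visit `(s,a)` are its first `n` visits, where `n` is the number of visits
before `t`. This turns the deviation at a random number of visits into one that belongs to a fixed
`n`. -/
theorem sum_visits_truncate {S A : ℕ} (st : ℕ → Fin S) (ac : ℕ → Fin A) (s : Fin S) (a : Fin A)
    {t T : ℕ} (ht : t ≤ T) (x : ℕ → ℝ) :
    (∑ i ∈ Finset.range T, if (st i = s ∧ ac i = a) ∧
        visits st ac (Finset.range i) s a < visits st ac (Finset.range t) s a then x i else 0)
      = ∑ i ∈ Finset.range t, if st i = s ∧ ac i = a then x i else 0 := by
  rw [← Finset.sum_range_add_sum_Ico _ ht]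
  rw [Finset.sum_eq_zero (s := Finset.Ico t T), add_zero]
  · refine Finset.sum_congr rfl fun i hi => ?_
    by_cases h : st i = s ∧ ac i = a
    · have h1 := visits_succ st ac i s a
      rw [if_pos h] at h1
      have h2 := visits_mono st ac (Nat.succ_le_of_lt (Finset.mem_range.1 hi)) s a
      rw [Nat.succ_eq_add_one] at h2
      rw [if_pos ⟨h, by omega⟩, if_pos h]
    · rw [if_neg h, if_neg fun h' => h h'.1]
  · intro i hi
    have := visits_mono st ac (Finset.mem_Ico.1 hi).1 s a
    exact if_neg fun h => absurd h.2 (not_lt.2 this)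

/-- The exponent `√(γ/v)` balances the two terms of Freedman's inequality for total variance `v`. -/
theorem sqrt_div_mul_add {γ v : ℝ} (hγ : 0 < γ) (hv : 0 < v) :
    √(γ / v) * v + γ / √(γ / v) = 2 * √(γ * v) := by
  have h1 : √(γ / v) * v = √(γ * v) := by
    nth_rw 2 [← Real.sqrt_sq hv.le]
    rw [← Real.sqrt_mul (by positivity)]
    congr 1
    field_simp
  have h2 : γ / √(γ / v) = √(γ * v) := by
    rw [div_eq_iff (Real.sqrt_pos.2 (by positivity)).ne', ← Real.sqrt_mul (by positivity)]
    rw [show γ * v * (γ / v) = γ ^ 2 by field_simp, Real.sqrt_sq hγ.le]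
  rw [h1, h2]
  ring

/-- The range condition of the supermartingale for the exponent `√(γ/v)`. -/
theorem sqrt_div_mul_le_one {γ v b : ℝ} (hv : 0 < v) (hb : 0 ≤ b) (h : γ * b ^ 2 ≤ v) :
    √(γ / v) * b ≤ 1 := by
  nth_rw 1 [← Real.sqrt_sq hb]
  rw [← Real.sqrt_mul' _ (sq_nonneg b), Real.sqrt_le_left zero_le_one, one_pow,
    div_mul_eq_mul_div]
  exact (div_le_one hv).2 h

/-- The exponent for Bernstein's inequality with total variance `v` and range `b`: it is `√(γ/v)` if
that is at most `1/b`, and `1/b` otherwise. -/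
theorem exists_bernstein_exponent {γ v b : ℝ} (hγ : 0 < γ) (hv : 0 ≤ v) (hb : 0 < b) :
    ∃ c : ℝ, 0 < c ∧ c * b ≤ 1 ∧ c * v + γ / c ≤ 2 * √(v * γ) + b * γ := by
  rcases le_or_gt (γ * b ^ 2) v with h | h
  · have hv' : 0 < v := lt_of_lt_of_le (by positivity) h
    refine ⟨√(γ / v), Real.sqrt_pos.2 (by positivity), sqrt_div_mul_le_one hv' hb.le h, ?_⟩
    rw [sqrt_div_mul_add hγ hv', mul_comm v γ]
    have : 0 < b * γ := by positivity
    linarith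
  · refine ⟨1 / b, by positivity, by field_simp; exact le_rfl, ?_⟩
    have h1 : v ≤ √(v * γ) * b := by
      rw [← Real.sqrt_sq hb.le, ← Real.sqrt_mul' _ (sq_nonneg _)]
      refine Real.le_sqrt_of_sq_le ?_
      nlinarith
    have h2 : 1 / b * v ≤ √(v * γ) := by
      rw [one_div, inv_mul_le_iff₀ hb]; linarith
    have h3 : γ / (1 / b) = b * γ := by field_simp
    have := Real.sqrt_nonneg (v * γ)
    linarith

namespace Run

variable {S A : ℕ} {M : MDP S A} {s₁ : Fin S} {H δ : ℝ} {T : ℕ} {Ω : Type*}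
  [mΩ : MeasurableSpace Ω] {μ : Measure Ω} (R : Run M s₁ H δ T μ)

theorem sum_incr_le {c γ : ℝ} (hc : 0 < c) {f : ℕ → Ω → Fin S → ℝ} {n : ℕ} {ω : Ω}
    (h : R.freedman c f n ω < γ) : ∑ i ∈ Finset.range n, R.incr f i ω
      ≤ c * ∑ i ∈ Finset.range n, R.condVar f i ω + γ / c := by
  rw [freedman, Finset.sum_sub_distrib, ← Finset.mul_sum, ← Finset.mul_sum] at h
  rw [← sub_le_iff_le_add', le_div_iff₀ hc]
  linarith

theorem neg_sum_incr_le {c γ : ℝ} (hc : 0 < c) {f : ℕ → Ω → Fin S → ℝ} {n : ℕ} {ω : Ω}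
    (h : R.freedman (-c) f n ω < γ) : -∑ i ∈ Finset.range n, R.incr f i ω
      ≤ c * ∑ i ∈ Finset.range n, R.condVar f i ω + γ / c := by
  rw [freedman, Finset.sum_sub_distrib, ← Finset.mul_sum, ← Finset.mul_sum] at h
  rw [← sub_le_iff_le_add', le_div_iff₀ hc]
  linarith

theorem sum_condVar_le {f : ℕ → Ω → Fin S → ℝ} {b : ℝ}
    (hf : ∀ i ω s s', |f i ω s - f i ω s'| ≤ b) {n : ℕ} (hn : n ≤ T) (ω : Ω) :
    ∑ i ∈ Finset.range n, R.condVar f i ω ≤ T * b ^ 2 := by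
  calc _ ≤ ∑ _i ∈ Finset.range n, b ^ 2 := Finset.sum_le_sum fun i _ =>
        vecVar_le_sq (M.trans_nonneg _ _) (M.trans_sum _ _) (hf i ω)
    _ = n * b ^ 2 := by simp
    _ ≤ T * b ^ 2 := by gcongr

/-- The bias function of the candidate at step `i`, cut off to `[0,H]` so that it is bounded on all
trajectories. -/
def clippedBias (i : ℕ) (ω : Ω) (s : Fin S) : ℝ := max 0 (min H ((R.cand i ω).bias s))

theorem clippedBias_mem (hH : 0 ≤ H) (i : ℕ) (ω : Ω) (s : Fin S) :
    0 ≤ R.clippedBias i ω s ∧ R.clippedBias i ω s ≤ H :=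
  ⟨le_max_left _ _, max_le hH (min_le_left _ _)⟩

theorem clippedBias_eq {i : ℕ} {ω : Ω}
    (h : ∀ s, 0 ≤ (R.cand i ω).bias s ∧ (R.cand i ω).bias s ≤ H) :
    R.clippedBias i ω = (R.cand i ω).bias := by
  funext s
  rw [clippedBias, min_eq_right (h s).2, max_eq_right (h s).1]

theorem meas_clippedBias {i : ℕ} (hi : i < T) (s : Fin S) :
    Measurable[R.filt i] fun ω => R.clippedBias i ω s :=
  measurable_const.max (measurable_const.min ((measurable_pi_apply s).comp (R.bias_meas i hi)))

theorem measurableSet_inSegment (s s' : Fin S) {i : ℕ} (hi : i ≤ T) :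
    MeasurableSet[R.filt i] {ω | inSegment (fun j => R.st j ω) s s' i} := by
  induction i with
  | zero => exact (R.st_meas' le_rfl hi) (measurableSet_singleton s)
  | succ i ih =>
    have h1 := R.filt.mono (Nat.le_succ i) _ (ih (by omega))
    have h2 : ∀ x, MeasurableSet[R.filt (i + 1)] {ω | R.st (i + 1) ω = x} := fun x =>
      (R.st_meas' le_rfl hi) (measurableSet_singleton x)
    exact (h2 s).union (h1.inter (h2 s').compl)

theorem meas_visits (s : Fin S) (a : Fin A) {i : ℕ} (hi : i ≤ T) :
    Measurable[R.filt i] fun ω =>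
      visits (fun j => R.st j ω) (fun j => R.ac j ω) (Finset.range i) s a := by
  simp only [visits, Finset.card_filter]
  refine Finset.measurable_sum _ fun j hj => ?_
  have hj' := Finset.mem_range.1 hj
  exact R.meas_st_ac hj'.le hi (hj'.trans_le hi) fun s' a' => if s' = s ∧ a' = a then 1 else 0

open Classical in
/-- The family that equals `g` at the first `n` visits of `(s,a)`, and vanishes otherwise. -/
def visitFamily (g : Fin S → ℝ) (n : ℕ) (s : Fin S) (a : Fin A) (i : ℕ) (ω : Ω) (x : Fin S) : ℝ :=
  if (R.st i ω = s ∧ R.ac i ω = a) ∧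
    visits (fun j => R.st j ω) (fun j => R.ac j ω) (Finset.range i) s a < n then g x else 0

open Classical in
/-- The family that equals `g` within the segments from `s` to `s'`, and vanishes otherwise. -/
def segmentFamily (g : Fin S → ℝ) (s s' : Fin S) (i : ℕ) (ω : Ω) (x : Fin S) : ℝ :=
  if inSegment (fun j => R.st j ω) s s' i then g x else 0

theorem incr_ite (p : ℕ → Ω → Prop) [∀ i ω, Decidable (p i ω)] (g : Fin S → ℝ) (i : ℕ) (ω : Ω) :
    R.incr (fun i ω x => if p i ω then g x else 0) i ω
      = if p i ω then g (R.st (i + 1) ω) - M.nextMean (R.st i ω) (R.ac i ω) g else 0 := by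
  by_cases h : p i ω <;> simp [incr, h, MDP.nextMean]

theorem condVar_ite (p : ℕ → Ω → Prop) [∀ i ω, Decidable (p i ω)] (g : Fin S → ℝ) (i : ℕ) (ω : Ω) :
    R.condVar (fun i ω x => if p i ω then g x else 0) i ω
      = if p i ω then vecVar (M.trans (R.st i ω) (R.ac i ω)) g else 0 := by
  by_cases h : p i ω <;> simp [condVar, h, vecVar]

theorem abs_ite_sub_le (p : Prop) [Decidable p] {g : Fin S → ℝ} {b : ℝ}
    (hg : ∀ s, 0 ≤ g s ∧ g s ≤ b) (s s' : Fin S) :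
    |(if p then g s else 0) - (if p then g s' else 0)| ≤ b := by
  have h1 := hg s; have h2 := hg s'
  split_ifs
  · exact abs_le.2 ⟨by linarith, by linarith⟩
  · simp; linarith

open Classical in
theorem bernsteinBound_of_freedman {γ b : ℝ} {g : Fin S → ℝ} {c : Fin S → Fin A → ℕ → ℝ} {ω : Ω}
    (hc : ∀ s a n, 0 < c s a n ∧ c s a n * (n * vecVar (M.trans s a) g) + γ / c s a n
      ≤ 2 * √(n * vecVar (M.trans s a) g * γ) + b * γ)
    (h : ∀ s a, ∀ n ≤ T, R.freedman (c s a n) (R.visitFamily g n s a) T ω < γ ∧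
      R.freedman (-c s a n) (R.visitFamily g n s a) T ω < γ) :
    BernsteinBound M (fun i => R.st i ω) (fun i => R.ac i ω) γ T g b := by
  intro t ht s a
  set n := visits (fun i => R.st i ω) (fun i => R.ac i ω) (Finset.range t) s a with hn
  have hnT : n ≤ T := (visits_le _ _ t s a).trans ht
  obtain ⟨hc0, hc1⟩ := hc s a n
  have e1 : ∑ i ∈ Finset.range T, R.incr (R.visitFamily g n s a) i ω
      = visitDev M (fun i => R.st i ω) (fun i => R.ac i ω) g t s a := by
    have e := sum_visits_truncate (fun i => R.st i ω) (fun i => R.ac i ω) s a ht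
      (fun i => g (R.st (i + 1) ω) - M.nextMean s a g)
    unfold visitDev
    rw [← e]
    refine Finset.sum_congr rfl fun i _ => ?_
    unfold visitFamily
    rw [R.incr_ite (fun i ω => (R.st i ω = s ∧ R.ac i ω = a) ∧
      visits (fun j => R.st j ω) (fun j => R.ac j ω) (Finset.range i) s a < n) g]
    by_cases hp : (R.st i ω = s ∧ R.ac i ω = a) ∧
      visits (fun j => R.st j ω) (fun j => R.ac j ω) (Finset.range i) s a < n
    · rw [if_pos hp, if_pos hp, hp.1.1, hp.1.2]
    · rw [if_neg hp, if_neg hp]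
  have e2 : ∑ i ∈ Finset.range T, R.condVar (R.visitFamily g n s a) i ω
      = n * vecVar (M.trans s a) g := by
    have e := sum_visits_truncate (fun i => R.st i ω) (fun i => R.ac i ω) s a ht
      (fun _ => vecVar (M.trans s a) g)
    have e' : (n : ℝ) * vecVar (M.trans s a) g = ∑ i ∈ Finset.range t,
        if R.st i ω = s ∧ R.ac i ω = a then vecVar (M.trans s a) g else 0 := by
      rw [hn, visits, ← Finset.sum_filter, Finset.sum_const, nsmul_eq_mul]
    rw [e', ← e]
    refine Finset.sum_congr rfl fun i _ => ?_
    unfold visitFamily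
    rw [R.condVar_ite (fun i ω => (R.st i ω = s ∧ R.ac i ω = a) ∧
      visits (fun j => R.st j ω) (fun j => R.ac j ω) (Finset.range i) s a < n) g]
    by_cases hp : (R.st i ω = s ∧ R.ac i ω = a) ∧
      visits (fun j => R.st j ω) (fun j => R.ac j ω) (Finset.range i) s a < n
    · rw [if_pos hp, if_pos hp, hp.1.1, hp.1.2]
    · rw [if_neg hp, if_neg hp]
  have h1 := R.sum_incr_le hc0 (h s a n hnT).1
  have h2 := R.neg_sum_incr_le hc0 (h s a n hnT).2
  rw [e1, e2] at h1 h2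
  exact abs_le.2 ⟨by linarith, by linarith⟩

/-- The Azuma–Hoeffding bound that follows from Freedman's supermartingale. -/
theorem neg_sum_incr_le_of_freedman {γ b : ℝ} (hγ : 0 < γ) (hT : 1 ≤ T) (hb : 0 < b)
    {f : ℕ → Ω → Fin S → ℝ} (hf : ∀ i ω s s', |f i ω s - f i ω s'| ≤ b) {n : ℕ} (hn : n ≤ T) {ω : Ω}
    (h : R.freedman (-√(γ / (T * b ^ 2))) f n ω < γ) :
    -∑ i ∈ Finset.range n, R.incr f i ω ≤ 2 * b * √(γ * T) := by
  have hT0 : (0 : ℝ) < T := by exact_mod_cast hT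
  have hv : 0 < T * b ^ 2 := by positivity
  have h1 := R.neg_sum_incr_le (Real.sqrt_pos.2 (by positivity)) h
  have h2 := mul_le_mul_of_nonneg_left (R.sum_condVar_le hf hn ω) (Real.sqrt_nonneg (γ / (T * b ^ 2)))
  have h3 := sqrt_div_mul_add hγ hv
  rw [← mul_assoc γ, Real.sqrt_mul (by positivity), Real.sqrt_sq hb.le] at h3
  linarith

theorem abs_sum_incr_le_of_freedman {γ b : ℝ} (hγ : 0 < γ) (hT : 1 ≤ T) (hb : 0 < b)
    {f : ℕ → Ω → Fin S → ℝ} (hf : ∀ i ω s s', |f i ω s - f i ω s'| ≤ b) {n : ℕ} (hn : n ≤ T) {ω : Ω}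
    (h : R.freedman (√(γ / (T * b ^ 2))) f n ω < γ)
    (h' : R.freedman (-√(γ / (T * b ^ 2))) f n ω < γ) :
    |∑ i ∈ Finset.range n, R.incr f i ω| ≤ 2 * b * √(γ * T) := by
  have hT0 : (0 : ℝ) < T := by exact_mod_cast hT
  have hv : 0 < T * b ^ 2 := by positivity
  have h1 := R.sum_incr_le (Real.sqrt_pos.2 (by positivity)) h
  have h2 := mul_le_mul_of_nonneg_left (R.sum_condVar_le hf hn ω) (Real.sqrt_nonneg (γ / (T * b ^ 2)))
  have h3 := sqrt_div_mul_add hγ hv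
  have h4 := R.neg_sum_incr_le_of_freedman hγ hT hb hf hn h'
  rw [← mul_assoc γ, Real.sqrt_mul (by positivity), Real.sqrt_sq hb.le] at h3
  exact abs_le.2 ⟨by linarith, by linarith⟩

theorem abs_sum_reward_le {γ : ℝ} (hγ : 0 < γ) (hT : 1 ≤ T) {J : ℕ → Set Ω} {n : ℕ} (hn : n ≤ T)
    {ω : Ω} (h : R.rewardExponent (√(γ / T)) J n ω < γ)
    (h' : R.rewardExponent (-√(γ / T)) J n ω < γ) :
    |∑ i ∈ Finset.range n, (J i).indicator (R.rewardIncr i) ω| ≤ 2 * √(γ * T) := by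
  have hT0 : (0 : ℝ) < T := by exact_mod_cast hT
  have hc : 0 < √(γ / T) := Real.sqrt_pos.2 (by positivity)
  have h3 := sqrt_div_mul_add hγ hT0
  unfold rewardExponent at h h'
  rw [Finset.sum_sub_distrib, ← Finset.mul_sum] at h h'
  simp only [Finset.sum_const, Finset.card_range, nsmul_eq_mul] at h h'
  set X := ∑ i ∈ Finset.range n, (J i).indicator (R.rewardIncr i) ω
  set c := √(γ / T)
  have hn' : (n : ℝ) * c ^ 2 ≤ T * c ^ 2 := by gcongr
  have e : 2 * √(γ * T) * c = c ^ 2 * T + γ := by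
    rw [← h3]; field_simp
  refine abs_le.2 ⟨?_, ?_⟩
  · refine le_of_mul_le_mul_right ?_ hc
    linarith
  · refine le_of_mul_le_mul_right ?_ hc
    linarith

/-- The path conditions hold along every trajectory of a run. -/
theorem isEBFPath (ω : Ω) : IsEBFPath M H (Real.log (2 / δ)) T (fun i => R.st i ω)
    (fun i => R.ac i ω) (fun i => R.rw i ω) (fun i => R.cand i ω) :=
  ⟨fun t ht => R.ac_eq t ht ω, fun t ht => R.cand_new t ht ω, fun t ht => R.cand_same t ht ω⟩

end Run

theorem IsLargeHorizon.two_mul_le {S A T : ℕ} {H γ : ℝ} (L : IsLargeHorizon S A T H γ) :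
    2 * H ≤ √(√(T : ℝ)) ∧ γ * H ≤ T := by
  obtain ⟨u, y, ℓ, hℓ, hu, hy, k1, k2, k3, k4, k5, k6⟩ := L.exists_scale
  have e1 := L.S_ge; have e2 := L.A_ge; have e3 := L.hH; have e4 := L.hγ
  have hSA : 1 ≤ (S : ℝ) * A := by nlinarith
  have hSAl : 1 ≤ S * A * ℓ := one_le_mul_of_one_le_of_one_le hSA k1
  have g1 : γ * H ≤ u := by
    rw [hu, show S * A * H * γ * ℓ = γ * H * (S * A * ℓ) by ring]
    exact le_mul_of_one_le_right (by positivity) hSAl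
  have g2 : H ≤ γ * H := le_mul_of_one_le_left (by linarith) e4
  have g3 : u ≤ u ^ 3 := le_self_pow₀ k2 (by norm_num)
  have g4 : y ≤ y ^ 4 := le_self_pow₀ (by linarith) (by norm_num)
  rw [← hy, ← k5]
  exact ⟨by linarith, by linarith⟩

theorem measureReal_not_and_le {Ω : Type*} [MeasurableSpace Ω] {μ : Measure Ω} [IsFiniteMeasure μ]
    {p q : Ω → Prop} {a b : ℝ} (hp : μ.real {ω | ¬ p ω} ≤ a) (hq : μ.real {ω | ¬ q ω} ≤ b) :
    μ.real {ω | ¬ (p ω ∧ q ω)} ≤ a + b := by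
  have h : {ω | ¬ (p ω ∧ q ω)} = {ω | ¬ p ω} ∪ {ω | ¬ q ω} := by
    ext ω; exact not_and_or
  rw [h]
  exact (measureReal_union_le _ _).trans (add_le_add hp hq)

namespace Run

variable {S A : ℕ} {M : MDP S A} {s₁ : Fin S} {H δ : ℝ} {T : ℕ} {Ω : Type*}
  [mΩ : MeasurableSpace Ω] {μ : Measure Ω} (R : Run M s₁ H δ T μ)

theorem meas_visitFamily (g : Fin S → ℝ) (n : ℕ) (s : Fin S) (a : Fin A) (i : ℕ) (hi : i < T)
    (x : Fin S) : Measurable[R.filt i] fun ω => R.visitFamily g n s a i ω x := by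
  refine Measurable.ite (MeasurableSet.inter ?_ ?_) measurable_const measurable_const
  · exact ((R.st_meas' le_rfl hi.le) (measurableSet_singleton s)).inter
      ((R.ac_meas hi) (measurableSet_singleton a))
  · exact (R.meas_visits s a hi.le) (measurableSet_Iio (a := n))

theorem meas_segmentFamily (g : Fin S → ℝ) (s s' : Fin S) (i : ℕ) (hi : i < T)
    (x : Fin S) : Measurable[R.filt i] fun ω => R.segmentFamily g s s' i ω x :=
  Measurable.ite (R.measurableSet_inSegment s s' hi.le) measurable_const measurable_const

theorem measureReal_not_forall_bernsteinBound_le [IsProbabilityMeasure μ] {γ : ℝ} (hγ : 0 < γ)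
    {κ : Type*} [Fintype κ] {g : κ → Fin S → ℝ} {β : κ → ℝ} (hg : ∀ k s, 0 ≤ g k s ∧ g k s ≤ β k)
    (hβ : ∀ k, 0 < β k) :
    μ.real {ω | ¬ ∀ k, BernsteinBound M (fun i => R.st i ω) (fun i => R.ac i ω) γ T (g k) (β k)}
      ≤ S * (A * ((T + 1) * (Fintype.card κ * 2))) * Real.exp (-γ) := by
  classical
  choose c hc0 hc1 hc2 using fun (k : κ) (s : Fin S) (a : Fin A) (n : ℕ) =>
    exists_bernstein_exponent (γ := γ) (v := n * vecVar (M.trans s a) (g k)) (b := β k) hγ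
      (mul_nonneg (Nat.cast_nonneg _) (vecVar_nonneg (M.trans_nonneg s a) (M.trans_sum s a))) (hβ k)
  let Y : Fin S × Fin A × Fin (T + 1) × κ × Bool → Ω → ℝ := fun j =>
    R.freedman (if j.2.2.2.2 then c j.2.2.2.1 j.1 j.2.1 j.2.2.1 else -c j.2.2.2.1 j.1 j.2.1 j.2.2.1)
      (R.visitFamily (g j.2.2.2.1) j.2.2.1 j.1 j.2.1) T
  have hY : ∀ j, Integrable (fun ω => Real.exp (Y j ω)) μ ∧ ∫ ω, Real.exp (Y j ω) ∂μ ≤ 1 := by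
    rintro ⟨s, a, n, k, σ⟩
    refine R.integral_exp_freedman_le (R.meas_visitFamily _ _ _ _) (fun i ω x x' => ?_) le_rfl
    have h1 : |if σ then c k s a n else -c k s a n| = c k s a n := by
      cases σ <;> simp [abs_of_pos (hc0 k s a n)]
    rw [h1]
    exact (mul_le_mul_of_nonneg_left (abs_ite_sub_le _ (hg k) x x') (hc0 k s a n).le).trans
      (hc1 k s a n)
  have h := measureReal_exists_ge_le hY γ
  simp only [Fintype.card_prod, Fintype.card_fin, Fintype.card_bool] at h
  push_cast at h
  refine (measureReal_mono fun ω hω => ?_).trans h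
  by_contra hcon
  have hlt : ∀ j, Y j ω < γ := fun j => not_le.1 fun hj => hcon ⟨j, hj⟩
  exact hω fun k => R.bernsteinBound_of_freedman (c := c k)
    (fun s a n => ⟨hc0 k s a n, hc2 k s a n⟩) fun s a n hn =>
      ⟨hlt (s, a, ⟨n, Nat.lt_succ_iff.2 hn⟩, k, true),
        hlt (s, a, ⟨n, Nat.lt_succ_iff.2 hn⟩, k, false)⟩

theorem measureReal_not_forall_abs_sum_incr_le [IsProbabilityMeasure μ] {γ b : ℝ} (hγ : 0 < γ)
    (hT : 1 ≤ T) (hγT : γ ≤ T) (hb : 0 < b) {ι : Type*} [Fintype ι] {f : ι → ℕ → Ω → Fin S → ℝ}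
    (hf : ∀ j, ∀ i < T, ∀ s, Measurable[R.filt i] fun ω => f j i ω s)
    (hfb : ∀ j i ω s s', |f j i ω s - f j i ω s'| ≤ b) :
    μ.real {ω | ¬ ∀ j, ∀ t ≤ T, |∑ i ∈ Finset.range t, R.incr (f j) i ω| ≤ 2 * b * √(γ * T)}
      ≤ Fintype.card ι * ((T + 1) * 2) * Real.exp (-γ) := by
  have hT0 : (0 : ℝ) < T := by exact_mod_cast hT
  set c := √(γ / (T * b ^ 2)) with hc
  let Y : ι × Fin (T + 1) × Bool → Ω → ℝ := fun j =>
    R.freedman (if j.2.2 then c else -c) (f j.1) j.2.1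
  have hY : ∀ j, Integrable (fun ω => Real.exp (Y j ω)) μ ∧ ∫ ω, Real.exp (Y j ω) ∂μ ≤ 1 := by
    rintro ⟨j, t, σ⟩
    refine R.integral_exp_freedman_le (hf j) (fun i ω x x' => ?_) (Nat.lt_succ_iff.1 t.2)
    have h1 : |if σ then c else -c| = c := by
      cases σ <;> simp [hc]
    rw [h1]
    exact (mul_le_mul_of_nonneg_left (hfb j i ω x x') (Real.sqrt_nonneg _)).trans
      (sqrt_div_mul_le_one (by positivity) hb.le (by gcongr))
  have h := measureReal_exists_ge_le hY γ
  simp only [Fintype.card_prod, Fintype.card_fin, Fintype.card_bool] at h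
  push_cast at h
  refine (measureReal_mono fun ω hω => ?_).trans h
  by_contra hcon
  have hlt : ∀ j, Y j ω < γ := fun j => not_le.1 fun hj => hcon ⟨j, hj⟩
  exact hω fun j t ht => R.abs_sum_incr_le_of_freedman hγ hT hb (hfb j) ht
    (hlt (j, ⟨t, Nat.lt_succ_iff.2 ht⟩, true)) (hlt (j, ⟨t, Nat.lt_succ_iff.2 ht⟩, false))

theorem measureReal_not_forall_abs_sum_reward_le [IsProbabilityMeasure μ] {γ : ℝ} (hγ : 0 < γ)
    (hT : 1 ≤ T) {ι : Type*} [Fintype ι] {J : ι → ℕ → Set Ω}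
    (hJ : ∀ j, ∀ i < T, MeasurableSet[R.filt i] (J j i)) :
    μ.real {ω | ¬ ∀ j, ∀ t ≤ T,
        |∑ i ∈ Finset.range t, (J j i).indicator (R.rewardIncr i) ω| ≤ 2 * √(γ * T)}
      ≤ Fintype.card ι * ((T + 1) * 2) * Real.exp (-γ) := by
  let Y : ι × Fin (T + 1) × Bool → Ω → ℝ := fun j =>
    R.rewardExponent (if j.2.2 then √(γ / T) else -√(γ / T)) (J j.1) j.2.1
  have hY : ∀ j, Integrable (fun ω => Real.exp (Y j ω)) μ ∧ ∫ ω, Real.exp (Y j ω) ∂μ ≤ 1 :=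
    fun j => R.integral_exp_rewardExponent_le (hJ j.1) (Nat.lt_succ_iff.1 j.2.1.2)
  have h := measureReal_exists_ge_le hY γ
  simp only [Fintype.card_prod, Fintype.card_fin, Fintype.card_bool] at h
  push_cast at h
  refine (measureReal_mono fun ω hω => ?_).trans h
  by_contra hcon
  have hlt : ∀ j, Y j ω < γ := fun j => not_le.1 fun hj => hcon ⟨j, hj⟩
  exact hω fun j t ht => R.abs_sum_reward_le hγ hT ht
    (hlt (j, ⟨t, Nat.lt_succ_iff.2 ht⟩, true)) (hlt (j, ⟨t, Nat.lt_succ_iff.2 ht⟩, false))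

theorem measureReal_not_neg_sum_incr_le [IsProbabilityMeasure μ] {γ b c : ℝ} (hc : 0 < c)
    (hcb : c * b ≤ 1) {f : ℕ → Ω → Fin S → ℝ}
    (hf : ∀ i < T, ∀ s, Measurable[R.filt i] fun ω => f i ω s)
    (hfb : ∀ i ω s s', |f i ω s - f i ω s'| ≤ b) :
    μ.real {ω | ¬ -∑ i ∈ Finset.range T, R.incr f i ω
      ≤ c * ∑ i ∈ Finset.range T, R.condVar f i ω + γ / c} ≤ Real.exp (-γ) := by
  have hY : ∀ _ : Unit, Integrable (fun ω => Real.exp (R.freedman (-c) f T ω)) μ ∧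
      ∫ ω, Real.exp (R.freedman (-c) f T ω) ∂μ ≤ 1 := fun _ => by
    refine R.integral_exp_freedman_le hf (fun i ω x x' => ?_) le_rfl
    rw [abs_neg, abs_of_pos hc]
    exact (mul_le_mul_of_nonneg_left (hfb i ω x x') hc.le).trans hcb
  have h := measureReal_exists_ge_le hY γ
  rw [Fintype.card_unit, Nat.cast_one, one_mul] at h
  refine (measureReal_mono fun ω hω => ?_).trans h
  by_contra hcon
  exact hω (R.neg_sum_incr_le hc (not_le.1 fun hj => hcon ⟨(), hj⟩))

open Classical in
/-- A union bound over all the martingale bounds in `IsTypical`. -/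
theorem measureReal_not_isTypical_le [IsProbabilityMeasure μ] {γ : ℝ} {h : Fin S → ℝ}
    (L : IsLargeHorizon S A T H γ) (hh : ∀ s, 0 ≤ h s ∧ h s ≤ H) :
    μ.real {ω | ¬ IsTypical M H γ T h (fun i => R.st i ω) (fun i => R.ac i ω) (fun i => R.rw i ω)
      (fun i => R.clippedBias i ω)} ≤ 29 * ((S : ℝ) ^ 2 * A * T) * Real.exp (-γ) := by
  have hT := L.one_le_T
  have hT0 : (0 : ℝ) < T := by exact_mod_cast hT
  have hH0 : 0 < H := by linarith [L.hH]
  have hγ0 : 0 < γ := by linarith [L.hγ]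
  have hy : 0 < √(√(T : ℝ)) := by positivity
  obtain ⟨h2H, hγH⟩ := L.two_mul_le
  have hγT : γ ≤ T := by nlinarith [L.hH]
  -- the functions to which Bernstein's inequality is applied, and their ranges
  let g : Option (Option (Fin S)) → Fin S → ℝ := fun k => match k with
    | none => h
    | some none => fun s => h s ^ 2
    | some (some s') => fun x => if x = s' then 1 else 0
  let β : Option (Option (Fin S)) → ℝ := fun k => match k with
    | none => H
    | some none => H ^ 2
    | some (some _) => 1
  have hg : ∀ k s, 0 ≤ g k s ∧ g k s ≤ β k := by
    rintro (_ | _ | s') s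
    · exact hh s
    · exact ⟨sq_nonneg _, pow_le_pow_left₀ (hh s).1 (hh s).2 2⟩
    · change 0 ≤ (if s = s' then (1 : ℝ) else 0) ∧ (if s = s' then (1 : ℝ) else 0) ≤ 1
      split_ifs <;> norm_num
  have hβ : ∀ k, 0 < β k := by
    rintro (_ | _ | s')
    · exact hH0
    · exact pow_pos hH0 2
    · exact one_pos
  have hspan : ∀ s s', |h s - h s'| ≤ H := fun s s' =>
    abs_le.2 ⟨by linarith [(hh s).1, (hh s').2], by linarith [(hh s').1, (hh s).2]⟩
  have hspan2 : ∀ s s', |h s ^ 2 - h s' ^ 2| ≤ H ^ 2 := fun s s' => by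
    have h1 := hg (some none) s; have h2 := hg (some none) s'
    exact abs_le.2 ⟨by linarith [h1.1, h2.2], by linarith [h2.1, h1.2]⟩
  have hspanc : ∀ i ω s s', |R.clippedBias i ω s - R.clippedBias i ω s'| ≤ H := fun i ω s s' => by
    have h1 := R.clippedBias_mem hH0.le i ω s; have h2 := R.clippedBias_mem hH0.le i ω s'
    exact abs_le.2 ⟨by linarith [h1.1, h2.2], by linarith [h2.1, h1.2]⟩
  have B1 := R.measureReal_not_forall_bernsteinBound_le hγ0 hg hβ
  have B2 := R.measureReal_not_forall_abs_sum_incr_le hγ0 hT hγT hH0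
    (f := fun (_ : Unit) _ _ => h) (fun _ i hi s => measurable_const) fun _ _ _ => hspan
  have B3 := R.measureReal_not_forall_abs_sum_reward_le hγ0 hT
    (J := fun (_ : Unit) _ => Set.univ) fun _ i hi => MeasurableSet.univ
  have B4 := R.measureReal_not_forall_abs_sum_incr_le hγ0 hT hγT hH0
    (f := fun (p : Fin S × Fin S) => R.segmentFamily h p.1 p.2)
    (fun p => R.meas_segmentFamily h p.1 p.2) fun _ _ _ => abs_ite_sub_le _ hh
  have B5 := R.measureReal_not_forall_abs_sum_reward_le hγ0 hT
    (J := fun (p : Fin S × Fin S) i => {ω | inSegment (fun j => R.st j ω) p.1 p.2 i})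
    fun p i hi => R.measurableSet_inSegment p.1 p.2 hi.le
  have B6 := R.measureReal_not_forall_abs_sum_incr_le hγ0 hT hγT (pow_pos hH0 2)
    (f := fun (_ : Unit) _ _ s => h s ^ 2) (fun _ i hi s => measurable_const) fun _ _ _ => hspan2
  have B7 := R.measureReal_not_forall_abs_sum_incr_le hγ0 hT hγT hH0
    (f := fun (_ : Unit) => R.clippedBias) (fun _ i hi s => R.meas_clippedBias hi s) fun _ => hspanc
  have B8 := R.measureReal_not_neg_sum_incr_le (γ := γ) (c := √(γ / (H * T))) (b := H)
    (f := fun _ _ => h) (Real.sqrt_pos.2 (by positivity))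
    (sqrt_div_mul_le_one (by positivity) hH0.le (by nlinarith)) (fun i hi s => measurable_const)
    fun _ _ => hspan
  have B9 := R.measureReal_not_neg_sum_incr_le (γ := γ) (c := (√(√(T : ℝ)))⁻¹) (b := 2 * H)
    (f := fun i ω s => R.clippedBias i ω s - h s) (inv_pos.2 hy)
    (by rw [inv_mul_le_iff₀ hy, mul_one]; exact h2H)
    (fun i hi s => (R.meas_clippedBias hi s).sub measurable_const) fun i ω x x' => by
      have h1 := abs_le.1 (hspanc i ω x x'); have h2 := abs_le.1 (hspan x x')
      exact abs_le.2 ⟨by linarith, by linarith⟩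
  rw [Fintype.card_unit, Nat.cast_one, one_mul] at B2 B3 B6 B7
  rw [Fintype.card_prod, Fintype.card_fin, Nat.cast_mul] at B4 B5
  rw [Fintype.card_option, Fintype.card_option, Fintype.card_fin, Nat.cast_add_one,
    Nat.cast_add_one] at B1
  have B := measureReal_not_and_le B1 <| measureReal_not_and_le B2 <| measureReal_not_and_le B3 <|
    measureReal_not_and_le B4 <| measureReal_not_and_le B5 <| measureReal_not_and_le B6 <|
    measureReal_not_and_le B7 <| measureReal_not_and_le B8 B9
  refine (measureReal_mono fun ω hω => ?_).trans (B.trans ?_)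
  · rintro ⟨c1, c2, c3, c4, c5, c6, c7, c8, c9⟩
    refine hω ⟨fun s' => c1 (some (some s')), c1 none, c1 (some none), c2 (), fun t ht => ?_,
      fun s s' t ht => ?_, fun s s' t ht => ?_, ?_, fun t ht => ?_, ?_, ?_⟩
    · have h3 := c3 () t ht
      simp only [Set.indicator_univ] at h3
      exact h3
    · refine le_trans (le_of_eq ?_) (c4 (s, s') t ht)
      congr 1
      refine Finset.sum_congr rfl fun i _ => ?_
      unfold segmentFamily
      rw [R.incr_ite (fun i ω => inSegment (fun j => R.st j ω) s s' i) h, Set.indicator_apply]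
      rfl
    · exact c5 (s, s') t ht
    · have h3 := (neg_le_abs _).trans (c6 () T le_rfl)
      rw [← Finset.sum_neg_distrib] at h3
      simpa only [incr, neg_sub] using h3
    · have h3 := (neg_le_abs _).trans (c7 () t ht)
      rw [← Finset.sum_neg_distrib] at h3
      simpa only [incr, neg_sub] using h3
    · have h4 : γ / √(γ / (H * T)) = √(γ * (H * T)) := by
        have hHT : 0 < H * T := by positivity
        rw [div_eq_iff (Real.sqrt_pos.2 (by positivity)).ne', ← Real.sqrt_mul (by positivity),
          show γ * (H * T) * (γ / (H * T)) = γ ^ 2 by field_simp, Real.sqrt_sq hγ0.le]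
      rw [h4, ← Finset.sum_neg_distrib] at c8
      simpa only [incr, condVar, neg_sub] using c8
    · rw [← Finset.sum_neg_distrib, div_inv_eq_mul, inv_mul_eq_div] at c9
      simpa only [incr, condVar, neg_sub] using c9
  set E := Real.exp (-γ)
  have e1 := L.S_ge; have e2 := L.A_ge
  have e3 : (1 : ℝ) ≤ T := by exact_mod_cast hT
  have b1 : (S : ℝ) * (A * ((T + 1) * ((S + 1 + 1) * 2))) ≤ 8 * ((S : ℝ) ^ 2 * A * T) := by
    have x1 : (T : ℝ) + 1 ≤ 2 * T := by linarith
    have x2 : (S : ℝ) + 1 + 1 ≤ 2 * S := by linarith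
    calc _ ≤ (S : ℝ) * (A * (2 * T * (2 * S * 2))) := by gcongr
      _ = _ := by ring
  have b2 : (S : ℝ) * S * ((T + 1) * 2) ≤ 4 * ((S : ℝ) ^ 2 * A * T) := by
    calc _ ≤ (S : ℝ) * S * ((T + T) * 2) := by gcongr
      _ = 4 * ((S : ℝ) ^ 2 * 1 * T) := by ring
      _ ≤ _ := by gcongr; linarith
  have b3 : 2 * (T : ℝ) ≤ (S : ℝ) ^ 2 * A * T :=
    mul_le_mul_of_nonneg_right (by nlinarith) (by linarith)
  refine le_trans (le_of_eq ?_) (mul_le_mul_of_nonneg_right (a := E) (b := S * (A * ((T + 1) *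
    ((S + 1 + 1) * 2))) + 2 * (S * S * ((T + 1) * 2)) + 4 * ((T + 1) * 2) + 2) (by linarith)
    (Real.exp_pos _).le)
  ring

end Run

end EBF

/-! ### The optimal average reward -/

namespace MDP

open Matrix

variable {S A : ℕ} (M : MDP S A)

theorem sum_polMatrix_mul (π : StatPolicy S A) (s : Fin S) (f : Fin S → ℝ) :
    (M.polMatrix π *ᵥ f) s = ∑ a, (π s).1 a * M.nextMean s a f := by
  simp only [Matrix.mulVec, dotProduct, polMatrix, nextMean, Finset.sum_mul, Finset.mul_sum,
    mul_assoc]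
  exact Finset.sum_comm

theorem polMatrix_mulVec_le (π : StatPolicy S A) {f g : Fin S → ℝ} (hfg : ∀ s, f s ≤ g s)
    (s : Fin S) : (M.polMatrix π *ᵥ f) s ≤ (M.polMatrix π *ᵥ g) s :=
  Finset.sum_le_sum (s := Finset.univ) (f := fun s' => M.polMatrix π s s' * f s')
    (g := fun s' => M.polMatrix π s s' * g s') fun s' _ => mul_le_mul_of_nonneg_left (hfg s')
    (Finset.sum_nonneg fun a _ => mul_nonneg ((π s).2.1 a) (M.trans_nonneg s a s'))

theorem polMatrix_mulVec_const (π : StatPolicy S A) (c : ℝ) (s : Fin S) :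
    (M.polMatrix π *ᵥ fun _ => c) s = c := by
  rw [sum_polMatrix_mul]
  simp only [nextMean, ← Finset.sum_mul, M.trans_sum, one_mul, (π s).2.2]

end MDP

namespace EBF

open Matrix

variable {S A : ℕ} {M : MDP S A} {H ρ : ℝ} {h : Fin S → ℝ}

/-- Subtracting its minimum moves the values of an optimal bias function to `[0,H]`. -/
theorem exists_isBiasPair (s₀ : Fin S) (hA : 0 < A) (hb : M.IsOptimalBias h) (hH : vecSpan h ≤ H) :
    ∃ (h' : Fin S → ℝ) (ρ : ℝ), IsBiasPair M H h' ρ := by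
  obtain ⟨ρ, hρ⟩ := hb
  have : Nonempty (Fin S) := ⟨s₀⟩
  have : Nonempty (Fin A) := ⟨⟨0, hA⟩⟩
  obtain ⟨m, hm⟩ := Finite.exists_min h
  refine ⟨fun s => h s - h m, ρ, fun s => ⟨sub_nonneg.2 (hm s), ?_⟩, fun s => ?_⟩
  · have h1 : |h s - h m| ≤ vecSpan h :=
      le_ciSup (f := fun p : Fin S × Fin S => |h p.1 - h p.2|) (Set.finite_range _).bddAbove (s, m)
    exact (le_abs_self _).trans (h1.trans hH)
  · have e : ∀ a, M.meanReward s a + M.nextMean s a (fun s => h s - h m)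
        = (M.meanReward s a + ∑ s', M.trans s a s' * h s') - h m := fun a => by
      simp only [MDP.nextMean, mul_sub, Finset.sum_sub_distrib, ← Finset.sum_mul, M.trans_sum]
      ring
    simp only [e]
    rw [← ciSup_sub (Set.finite_range _).bddAbove, ← hρ]
    ring

namespace IsBiasPair

theorem meanReward_add_le (B : IsBiasPair M H h ρ) (s : Fin S) (a : Fin A) :
    M.meanReward s a + M.nextMean s a h ≤ h s + ρ := by
  rw [B.bellman]
  exact le_ciSup (f := fun a => M.meanReward s a + M.nextMean s a h)
    (Set.finite_range _).bddAbove a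

theorem gain_le_one (B : IsBiasPair M H h ρ) (s₀ : Fin S) (hA : 0 < A) : ρ ≤ 1 := by
  have : Nonempty (Fin S) := ⟨s₀⟩
  have : Nonempty (Fin A) := ⟨⟨0, hA⟩⟩
  obtain ⟨m, hm⟩ := Finite.exists_max h
  have h1 : h m + ρ ≤ 1 + h m := by
    rw [B.bellman]
    refine ciSup_le fun a => add_le_add (Run.meanReward_mem m a).2 ?_
    calc M.nextMean m a h ≤ ∑ s', M.trans m a s' * h m :=
          Finset.sum_le_sum fun s' _ => mul_le_mul_of_nonneg_left (hm s') (M.trans_nonneg m a s')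
      _ = h m := by rw [← Finset.sum_mul, M.trans_sum, one_mul]
  linarith

/-- By the optimality equation, the bias function pays for what a policy earns above `ρ`. -/
theorem pow_mulVec_polReward_le (B : IsBiasPair M H h ρ) (π : StatPolicy S A) (t : ℕ) (s : Fin S) :
    ((M.polMatrix π ^ t) *ᵥ M.polReward π) s
      ≤ ρ + ((M.polMatrix π ^ t) *ᵥ h) s - ((M.polMatrix π ^ (t + 1)) *ᵥ h) s := by
  induction t generalizing s with
  | zero =>
    rw [pow_zero, one_mulVec, one_mulVec, zero_add, pow_one, M.sum_polMatrix_mul, MDP.polReward,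
      le_sub_iff_add_le, ← Finset.sum_add_distrib]
    calc _ ≤ ∑ a, (π s).1 a * (h s + ρ) := Finset.sum_le_sum fun a _ => by
          rw [← mul_add]
          exact mul_le_mul_of_nonneg_left (B.meanReward_add_le s a) ((π s).2.1 a)
      _ = ρ + h s := by rw [← Finset.sum_mul, (π s).2.2]; ring
  | succ t ih =>
    have e : ∀ (n : ℕ) (v : Fin S → ℝ), (M.polMatrix π ^ (n + 1)) *ᵥ v
        = M.polMatrix π *ᵥ ((M.polMatrix π ^ n) *ᵥ v) := fun n v => by
      rw [mulVec_mulVec, pow_succ']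
    rw [e t, e t h, e (t + 1) h]
    refine (M.polMatrix_mulVec_le π ih s).trans (le_of_eq ?_)
    have : (fun s => ρ + ((M.polMatrix π ^ t) *ᵥ h) s - ((M.polMatrix π ^ (t + 1)) *ᵥ h) s)
        = (fun _ => ρ) + (M.polMatrix π ^ t) *ᵥ h - (M.polMatrix π ^ (t + 1)) *ᵥ h := rfl
    rw [this, mulVec_sub, mulVec_add, Pi.sub_apply, Pi.add_apply, M.polMatrix_mulVec_const]

theorem expReward_le (B : IsBiasPair M H h ρ) (π : StatPolicy S A) (n : ℕ) (s : Fin S) :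
    M.expReward π n s ≤ n * ρ + H := by
  have h1 : ∀ t s, 0 ≤ ((M.polMatrix π ^ t) *ᵥ h) s := fun t => by
    induction t with
    | zero => intro s; rw [pow_zero, one_mulVec]; exact (B.mem s).1
    | succ t ih =>
      intro s
      rw [pow_succ', ← mulVec_mulVec, ← M.polMatrix_mulVec_const π 0 s]
      exact M.polMatrix_mulVec_le π ih s
  calc M.expReward π n s ≤ ∑ t ∈ Finset.range n,
        (ρ + (((M.polMatrix π ^ t) *ᵥ h) s - ((M.polMatrix π ^ (t + 1)) *ᵥ h) s)) :=
        Finset.sum_le_sum fun t _ => by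
          rw [← add_sub_assoc]; exact B.pow_mulVec_polReward_le π t s
    _ = n * ρ + (h s - ((M.polMatrix π ^ n) *ᵥ h) s) := by
        rw [Finset.sum_add_distrib, Finset.sum_range_sub', pow_zero, one_mulVec]
        simp
    _ ≤ n * ρ + H := by linarith [h1 n s, (B.mem s).2]

/-- The gain of a solution of the optimality equation is an upper bound of the optimal average
reward. -/
theorem optReward_le (B : IsBiasPair M H h ρ) (hρ : 0 ≤ ρ) (s : Fin S) : M.optReward s ≤ ρ := by
  -- `0 ≤ ρ` takes care of the value `0` of suprema of empty and unbounded sets of reals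
  refine Real.iSup_le (fun π => ?_) hρ
  rw [MDP.avgReward, Filter.liminf_eq]
  refine Real.sSup_le (fun x hx => ?_) hρ
  have hlim : Tendsto (fun n : ℕ => ρ + H / n) atTop (nhds ρ) := by
    simpa using (tendsto_const_div_atTop_nhds_zero_nat H).const_add ρ
  refine ge_of_tendsto hlim ?_
  filter_upwards [hx, eventually_gt_atTop 0] with n hn hn0
  have hn0' : (0 : ℝ) < n := by exact_mod_cast hn0
  refine hn.trans ?_
  rw [div_le_iff₀ hn0', add_mul, div_mul_cancel₀ _ hn0'.ne', mul_comm ρ]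
  exact B.expReward_le π n s

end IsBiasPair

namespace Run

variable {s₁ : Fin S} {δ : ℝ} {T : ℕ} {Ω : Type*} [mΩ : MeasurableSpace Ω] {μ : Measure Ω}
  (R : Run M s₁ H δ T μ)

theorem regret_le (B : IsBiasPair M H h ρ) (hρ : 0 ≤ ρ) (ω : Ω) :
    R.regret ω ≤ ∑ t ∈ Finset.range T, (ρ - M.meanReward (R.st t ω) (R.ac t ω)) := by
  rw [Finset.sum_sub_distrib, regret]
  simp only [Finset.sum_const, Finset.card_range, nsmul_eq_mul]
  have := mul_le_mul_of_nonneg_left (B.optReward_le hρ s₁) (Nat.cast_nonneg (α := ℝ) T)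
  linarith

theorem meas_meanReward {t : ℕ} (ht : t < T) :
    Measurable fun ω => M.meanReward (R.st t ω) (R.ac t ω) :=
  (R.meas_st_ac le_rfl ht.le ht M.meanReward).mono (R.filt.le t) le_rfl

theorem integrable_regret [IsFiniteMeasure μ] : Integrable R.regret μ := by
  refine (integrable_const _).sub (integrable_finsetSum _ fun t ht => ?_)
  refine Integrable.of_bound (R.meas_meanReward (Finset.mem_range.1 ht)).aestronglyMeasurable 1
    (Eventually.of_forall fun ω => ?_)
  have h1 := meanReward_mem (M := M) (R.st t ω) (R.ac t ω)
  rw [Real.norm_eq_abs, abs_of_nonneg h1.1]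
  exact h1.2

theorem measurable_regret : Measurable R.regret :=
  measurable_const.sub
    (Finset.measurable_sum _ fun _ ht => R.meas_meanReward (Finset.mem_range.1 ht))

theorem regret_le_horizon (B : IsBiasPair M H h ρ) (hρ : 0 ≤ ρ) (hA : 0 < A) (ω : Ω) :
    R.regret ω ≤ T := by
  refine (R.regret_le B hρ ω).trans ?_
  calc _ ≤ ∑ _t ∈ Finset.range T, (1 : ℝ) := Finset.sum_le_sum fun t _ => by
        have h1 := (meanReward_mem (M := M) (R.st t ω) (R.ac t ω)).1
        have h2 := B.gain_le_one s₁ hA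
        linarith
    _ = T := by simp

theorem measureReal_regret_gt_le [IsProbabilityMeasure μ]
    (L : IsLargeHorizon S A T H (Real.log (2 / δ))) (B : IsBiasPair M H h ρ) :
    μ.real {ω | ¬ R.regret ω ≤ 32 * √(S * A * H * T * Real.log (2 / δ))}
      ≤ 29 * ((S : ℝ) ^ 2 * A * T) * Real.exp (-Real.log (2 / δ)) := by
  have hρ := B.gain_nonneg (by linarith [L.hS]) (by linarith [L.hA])
  refine (measureReal_mono ?_).trans (R.measureReal_not_isTypical_le L B.mem)
  refine fun ω hω hY => hω ?_
  exact (R.regret_le B hρ ω).trans (sum_regret_le L B hY (R.isEBFPath ω)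
    fun t _ hb => R.clippedBias_eq hb)

theorem integral_regret_le [IsProbabilityMeasure μ] (B : IsBiasPair M H h ρ) (hρ : 0 ≤ ρ)
    (hA : 0 < A) {β : ℝ} (hβ : 0 ≤ β) :
    ∫ ω, R.regret ω ∂μ ≤ β + T * μ.real {ω | ¬ R.regret ω ≤ β} := by
  have hE : MeasurableSet {ω | ¬ R.regret ω ≤ β} :=
    (measurableSet_le R.measurable_regret measurable_const).compl
  have hle : ∀ ω, R.regret ω ≤ β + {ω | ¬ R.regret ω ≤ β}.indicator (fun _ => (T : ℝ)) ω := fun ω => by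
    by_cases h1 : R.regret ω ≤ β
    · rw [Set.indicator_of_notMem (by simpa using h1), add_zero]; exact h1
    · rw [Set.indicator_of_mem (by simpa using h1)]
      linarith [R.regret_le_horizon B hρ hA ω]
  have hint : Integrable ({ω | ¬ R.regret ω ≤ β}.indicator fun _ => (T : ℝ)) μ :=
    (integrable_const _).indicator hE
  calc ∫ ω, R.regret ω ∂μ ≤ ∫ ω, (β + {ω | ¬ R.regret ω ≤ β}.indicator (fun _ => (T : ℝ)) ω) ∂μ := by
        exact integral_mono R.integrable_regret ((integrable_const _).add hint) hle
    _ = β + T * μ.real {ω | ¬ R.regret ω ≤ β} := by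
        rw [integral_add (integrable_const _) hint, integral_const, integral_indicator_const _ hE]
        simp [mul_comm]

end Run

/-! ### The size of the horizon -/

/-- The constant in the polynomial lower bound on the horizon. -/
def horizonConst : ℝ := 800 ^ 4 * 12 ^ 12 * 48 ^ 24

theorem one_le_horizonConst : 1 ≤ horizonConst := by
  norm_num [horizonConst]

/-- The logarithmic factors of `isLargeHorizon_of_le` cost half of the power of `T`, by
`1 + x ≤ 48 exp (x / 48)`. -/
theorem one_add_log_pow_le {T : ℝ} (hT : 0 < T) (h : 0 ≤ 1 + Real.log T) :
    (1 + Real.log T) ^ 24 ≤ 48 ^ 24 * √T := by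
  have h1 : 1 + Real.log T ≤ 48 * Real.exp (Real.log T / 48) := by
    linarith [Real.add_one_le_exp (Real.log T / 48)]
  refine (pow_le_pow_left₀ h h1 24).trans (le_of_eq ?_)
  rw [mul_pow, ← Real.exp_nat_mul, Real.sqrt_eq_rpow, Real.rpow_def_of_pos hT]
  congr 2
  push_cast
  ring

section Horizon

variable {S A T : ℕ} {H δ : ℝ}

/-- What the polynomial lower bound on `T` gives; `log (2/δ₀)` is the parameter `γ` of EBF, which is
larger by `log S` than the logarithm in the regret bound. -/
structure HorizonFacts (S A T : ℕ) (H δ : ℝ) : Prop where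
  isLarge : IsLargeHorizon S A T H (Real.log (2 / inputConf S A T δ))
  one_le_log : 1 ≤ Real.log T
  sq_le : 40 * (S : ℝ) ^ 2 * (A : ℝ) ^ 2 ≤ T
  conf_pos : 0 < inputConf S A T δ
  log_conf_le : Real.log (2 / inputConf S A T δ) ≤
    2 * Real.log (40 * (S : ℝ) ^ 2 * (A : ℝ) ^ 2 * T * Real.log T / δ)

theorem horizon_ge {Λ W : ℝ} (hS : 20 ≤ S) (hA : 20 ≤ A) (hH : 20 ≤ H) (hΛ : 0 ≤ Λ)
    (hW : W = S * A * H * (1 + Λ)) (hT : horizonConst ^ 2 * W ^ 48 ≤ T) :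
    8000 ≤ (T : ℝ) ∧ 40 * (S : ℝ) ^ 2 * (A : ℝ) ^ 2 ≤ T := by
  have hS' : (20 : ℝ) ≤ S := by exact_mod_cast hS
  have hA' : (20 : ℝ) ≤ A := by exact_mod_cast hA
  have hSA : 400 ≤ (S : ℝ) * A := by nlinarith
  have hSAH : (S : ℝ) * A * 20 ≤ S * A * H := mul_le_mul_of_nonneg_left hH (by positivity)
  have hW1 : (S : ℝ) * A * 20 ≤ W := by
    rw [hW]
    exact hSAH.trans (le_mul_of_one_le_right (by positivity) (by linarith))
  have hWT : W ^ 2 ≤ T :=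
    calc W ^ 2 ≤ W ^ 48 := pow_le_pow_right₀ (by linarith) (by norm_num)
      _ ≤ horizonConst ^ 2 * W ^ 48 :=
        le_mul_of_one_le_left (by positivity) (one_le_pow₀ one_le_horizonConst)
      _ ≤ T := hT
  have h1 := pow_le_pow_left₀ (by positivity) hW1 2
  have h2 := pow_le_pow_left₀ (by norm_num) hSA 2
  clear hT hW
  constructor <;> linarith

theorem two_div_inputConf (hS : 20 ≤ S) : 2 / inputConf S A T δ
    = 40 * (S : ℝ) ^ 2 * (A : ℝ) ^ 2 * T * Real.log T / δ * S := by
  have hS0 : (S : ℝ) ≠ 0 := by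
    have : S ≠ 0 := by omega
    exact_mod_cast this
  rw [inputConf, div_div_eq_mul_div]
  ring

theorem log_le_of_horizon (hS : 20 ≤ S) (hA : 20 ≤ A) (hδ : 0 < δ) (hδ1 : δ < 1) (hT : 8000 ≤ (T : ℝ))
    (hl : 1 ≤ Real.log T) : Real.log (40 * (S : ℝ) ^ 2 * (A : ℝ) ^ 2 * T * Real.log T / δ)
      ≤ 6 * (S * A * (1 + Real.log (1 / δ)) * (1 + Real.log T)) := by
  have hS' : (20 : ℝ) ≤ S := by exact_mod_cast hS
  have hA' : (20 : ℝ) ≤ A := by exact_mod_cast hA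
  have hΛ0 : 0 ≤ Real.log (1 / δ) := Real.log_nonneg (by rw [le_div_iff₀ hδ]; linarith)
  have hlog : Real.log (40 * (S : ℝ) ^ 2 * (A : ℝ) ^ 2 * T * Real.log T / δ)
      = Real.log 40 + 2 * Real.log S + 2 * Real.log A + Real.log T + Real.log (Real.log T)
        + Real.log (1 / δ) := by
    have hl0 : Real.log T ≠ 0 := by linarith
    have hT0 : (T : ℝ) ≠ 0 := by linarith
    rw [div_eq_mul_one_div, Real.log_mul (by positivity) (by positivity),
      Real.log_mul (by positivity) hl0, Real.log_mul (by positivity) hT0,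
      Real.log_mul (by positivity) (by positivity), Real.log_mul (by positivity) (by positivity),
      Real.log_pow, Real.log_pow]
    push_cast
    ring
  have l1 := Real.log_le_sub_one_of_pos (show (0 : ℝ) < 40 by norm_num)
  have l2 := Real.log_le_sub_one_of_pos (show (0 : ℝ) < S by linarith)
  have l3 := Real.log_le_sub_one_of_pos (show (0 : ℝ) < A by linarith)
  have l4 := Real.log_le_sub_one_of_pos (show 0 < Real.log T by linarith)
  rw [hlog]
  generalize Real.log (1 / δ) = Λ at *
  generalize Real.log T = x at *
  have hSAS : (S : ℝ) * 20 ≤ S * A := by gcongr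
  have hSAA : 20 * (A : ℝ) ≤ S * A := by gcongr
  have g1 : (S : ℝ) * A * 1 ≤ S * A * ((1 + Λ) * (1 + x)) :=
    mul_le_mul_of_nonneg_left (one_le_mul_of_one_le_of_one_le (by linarith) (by linarith))
      (by positivity)
  have g2 : 1 * ((1 + Λ) * (1 + x)) ≤ S * A * ((1 + Λ) * (1 + x)) :=
    mul_le_mul_of_nonneg_right (by linarith) (by positivity)
  have g3 : 0 ≤ Λ * x := by positivity
  linarith

/-- For `W = SAH(1 + Λ)` and `ℓ = 1 + log T` the quantity `u = SAHγℓ` is at most `12W²ℓ²`; the fourth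
power of `800u³` is then at most `K W²⁴ √T` with `K = horizonConst`, whence the bound `K² W⁴⁸ ≤ T`. -/
theorem isLargeHorizon_of_le {γ Λ W : ℝ} (hS : 20 ≤ S) (hA : 20 ≤ A) (hH : 20 ≤ H) (hΛ : 0 ≤ Λ)
    (hγ1 : 1 ≤ γ) (hT8 : 8000 ≤ (T : ℝ)) (hl : 1 ≤ Real.log T)
    (hγ : γ ≤ 12 * (S * A * (1 + Λ) * (1 + Real.log T)))
    (hW : W = S * A * H * (1 + Λ)) (hT : horizonConst ^ 2 * W ^ 48 ≤ T) : IsLargeHorizon S A T H γ := by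
  refine ⟨hS, hA, hH, hγ1, ?_⟩
  have hT0 : (0 : ℝ) < T := by linarith
  have hℓT : (1 + Real.log T) ^ 24 ≤ 48 ^ 24 * √T := one_add_log_pow_le hT0 (by linarith)
  have hℓ0 : 0 ≤ 1 + Real.log T := by linarith
  generalize 1 + Real.log T = ℓ at *
  have hK : 0 ≤ horizonConst := zero_le_one.trans one_le_horizonConst
  have hW0 : 0 ≤ W := by rw [hW]; positivity
  have hSAW : (S : ℝ) * A * 1 * 1 ≤ W := by
    rw [hW]; gcongr <;> linarith
  have hu : S * A * H * γ * ℓ ≤ 12 * W ^ 2 * ℓ ^ 2 := by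
    calc S * A * H * γ * ℓ ≤ S * A * H * (12 * (S * A * (1 + Λ) * ℓ)) * ℓ := by gcongr
      _ = 12 * (W * (S * A * 1 * 1)) * ℓ ^ 2 := by rw [hW]; ring
      _ ≤ 12 * (W * W) * ℓ ^ 2 := by gcongr
      _ = _ := by ring
  have hKW : horizonConst * W ^ 24 ≤ √T := by
    refine Real.le_sqrt_of_sq_le (le_trans (le_of_eq ?_) hT)
    rw [mul_pow, ← pow_mul]
  clear hW hT
  refine Real.le_sqrt_of_sq_le (Real.le_sqrt_of_sq_le ?_)
  calc ((800 * (S * A * H * γ * ℓ) ^ 3) ^ 2) ^ 2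
      ≤ ((800 * (12 * W ^ 2 * ℓ ^ 2) ^ 3) ^ 2) ^ 2 := by gcongr
    _ = 800 ^ 4 * 12 ^ 12 * (W ^ 24 * ℓ ^ 24) := by ring
    _ ≤ 800 ^ 4 * 12 ^ 12 * (W ^ 24 * (48 ^ 24 * √T)) := by gcongr
    _ = horizonConst * W ^ 24 * √T := by rw [horizonConst]; ring
    _ ≤ √T * √T := by gcongr
    _ = T := Real.mul_self_sqrt hT0.le

theorem horizonFacts (hS : 20 ≤ S) (hA : 20 ≤ A) (hH : 20 ≤ H) (hδ : 0 < δ) (hδ1 : δ < 1)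
    {W : ℝ} (hW : W = S * A * H * (1 + Real.log (1 / δ))) (hT : horizonConst ^ 2 * W ^ 48 ≤ T) :
    HorizonFacts S A T H δ := by
  have hS' : (20 : ℝ) ≤ S := by exact_mod_cast hS
  have hA' : (20 : ℝ) ≤ A := by exact_mod_cast hA
  have hS0 : (0 : ℝ) < S := by linarith
  have hΛ0 : 0 ≤ Real.log (1 / δ) := Real.log_nonneg (by rw [le_div_iff₀ hδ]; linarith)
  obtain ⟨hT8, hsq⟩ := horizon_ge hS hA hH hΛ0 hW hT
  have hlog : 1 ≤ Real.log T := by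
    rw [Real.le_log_iff_exp_le (by linarith)]
    linarith [Real.exp_one_lt_d9]
  have hlogX := log_le_of_horizon hS hA hδ hδ1 hT8 hlog
  have e2 := two_div_inputConf (A := A) (T := T) (δ := δ) hS
  set X := 40 * (S : ℝ) ^ 2 * (A : ℝ) ^ 2 * T * Real.log T / δ with hX
  have hXS : S ≤ X := by
    rw [hX, le_div_iff₀ hδ]
    have h1 : (1 : ℝ) ≤ 40 * S * A ^ 2 * T * Real.log T := by
      have : (1 : ℝ) ≤ A ^ 2 := one_le_pow₀ (by linarith)
      have := one_le_mul_of_one_le_of_one_le (by linarith : (1 : ℝ) ≤ 40 * S) this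
      have := one_le_mul_of_one_le_of_one_le this (by linarith : (1 : ℝ) ≤ T)
      exact one_le_mul_of_one_le_of_one_le this hlog
    calc (S : ℝ) * δ ≤ S * 1 := by gcongr
      _ ≤ S * (40 * S * A ^ 2 * T * Real.log T) := by gcongr
      _ = _ := by ring
  have hX0 : 0 < X := by linarith
  have hγX : Real.log (2 / inputConf S A T δ) = Real.log X + Real.log S := by
    rw [e2, Real.log_mul hX0.ne' hS0.ne']
  have hSX := Real.log_le_log hS0 hXS
  have hS1 : 1 ≤ Real.log S := by
    rw [Real.le_log_iff_exp_le hS0]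
    linarith [Real.exp_one_lt_d9]
  refine ⟨isLargeHorizon_of_le hS hA hH hΛ0 (by linarith) hT8 hlog (by linarith) hW hT, hlog, hsq, ?_,
    by linarith⟩
  have hT0 : (0 : ℝ) < T := by linarith
  unfold inputConf
  positivity

end Horizon

namespace Run

variable {S A : ℕ} {M : MDP S A} {s₁ : Fin S} {H ρ δ : ℝ} {h : Fin S → ℝ} {T : ℕ} {Ω : Type*}
  [mΩ : MeasurableSpace Ω] {μ : Measure Ω} (R : Run M s₁ H (inputConf S A T δ) T μ)

/-- The failure probability `29 S²AT exp (-γ)` is at most `δ`, as `exp (-γ) = δ₀/2`. -/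
theorem measureReal_regret_gt_le_conf [IsProbabilityMeasure μ] (hδ : 0 < δ)
    (F : HorizonFacts S A T H δ) (B : IsBiasPair M H h ρ) :
    μ.real {ω | ¬ R.regret ω ≤ 490 * √(S * A * H * T *
      Real.log (40 * (S : ℝ) ^ 2 * (A : ℝ) ^ 2 * T * Real.log T / δ))} ≤ δ := by
  have L := F.isLarge
  have hS := L.S_ge
  have hA := L.A_ge
  have hH := L.hH
  have hl := F.one_le_log
  have hT : (1 : ℝ) ≤ T := by exact_mod_cast L.one_le_T
  set γ' := Real.log (40 * (S : ℝ) ^ 2 * (A : ℝ) ^ 2 * T * Real.log T / δ)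
  have h1 : 32 * √(S * A * H * T * Real.log (2 / inputConf S A T δ))
      ≤ 490 * √(S * A * H * T * γ') := by
    have h2 : √(S * A * H * T * Real.log (2 / inputConf S A T δ))
        ≤ √(2 ^ 2 * (S * A * H * T * γ')) := by
      refine Real.sqrt_le_sqrt ?_
      have h3 := mul_le_mul_of_nonneg_left F.log_conf_le
        (show 0 ≤ S * A * H * T by positivity)
      have h4 : 0 ≤ S * A * H * T * γ' := by
        have : 0 ≤ γ' := by linarith [L.hγ, F.log_conf_le]
        positivity
      linarith
    rw [Real.sqrt_mul (by norm_num : (0 : ℝ) ≤ 2 ^ 2), Real.sqrt_sq (by norm_num)] at h2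
    linarith [Real.sqrt_nonneg (S * A * H * T * γ')]
  refine (measureReal_mono fun ω hω => ?_).trans
    ((R.measureReal_regret_gt_le L B).trans (le_of_eq_of_le (b := 29 / 40 * δ / (S * A * Real.log T))
      ?_ ?_))
  · exact fun h2 => hω (h2.trans h1)
  · rw [Real.exp_neg, Real.exp_log (div_pos two_pos F.conf_pos), inputConf]
    field_simp
    ring
  · rw [div_le_iff₀ (by positivity)]
    have : 1 ≤ S * A * Real.log T :=
      one_le_mul_of_one_le_of_one_le (by nlinarith) hl
    nlinarith

/-- On the exceptional event, of probability at most `1/T`, the regret is at most `T`. -/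
theorem integral_regret_le_sqrt [IsProbabilityMeasure μ] (hδ : δ = 1 / T)
    (F : HorizonFacts S A T H δ) (B : IsBiasPair M H h ρ) :
    ∫ ω, R.regret ω ∂μ ≤ 981 * √(S * A * H * T) * Real.log T := by
  have L := F.isLarge
  have hS := L.S_ge
  have hA := L.A_ge
  have hH := L.hH
  have hl := F.one_le_log
  have hT : (1 : ℝ) ≤ T := by exact_mod_cast L.one_le_T
  have hT0 : (0 : ℝ) < T := by linarith
  have hδ0 : 0 < δ := by rw [hδ]; positivity
  have hρ := B.gain_nonneg (by linarith [L.hS]) (by linarith [L.hA])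
  have hP := R.measureReal_regret_gt_le_conf hδ0 F B
  set γ' := Real.log (40 * (S : ℝ) ^ 2 * (A : ℝ) ^ 2 * T * Real.log T / δ) with hγ'
  have hle := R.integral_regret_le B hρ (by linarith [L.hA]) (β := 490 * √(S * A * H * T * γ'))
    (by positivity)
  have h1 : T * μ.real {ω | ¬ R.regret ω ≤ 490 * √(S * A * H * T * γ')} ≤ 1 := by
    calc _ ≤ T * δ := mul_le_mul_of_nonneg_left hP hT0.le
      _ = 1 := by rw [hδ, mul_one_div_cancel hT0.ne']
  have h2 : γ' ≤ 4 * Real.log T := by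
    have e : (4 : ℝ) * Real.log T = Real.log (T ^ 4) := by rw [Real.log_pow]; norm_num
    rw [e, hγ']
    refine Real.log_le_log (by positivity) ?_
    rw [hδ, div_div_eq_mul_div, div_one]
    calc 40 * (S : ℝ) ^ 2 * (A : ℝ) ^ 2 * T * Real.log T * T ≤ T * T * T * T := by
          gcongr
          · exact F.sq_le
          · exact Real.log_le_self hT0.le
      _ = _ := by ring
  have h3 : √(S * A * H * T * γ') ≤ √(S * A * H * T) * (2 * Real.log T) := by
    rw [Real.sqrt_mul (by positivity)]
    refine mul_le_mul_of_nonneg_left ?_ (Real.sqrt_nonneg _)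
    refine Real.sqrt_le_iff.2 ⟨by positivity, ?_⟩
    nlinarith
  have h4 : 1 ≤ √(S * A * H * T) * Real.log T := by
    refine one_le_mul_of_one_le_of_one_le (Real.one_le_sqrt.2 ?_) hl
    have := one_le_mul_of_one_le_of_one_le (by linarith : (1 : ℝ) ≤ S) (by linarith : (1 : ℝ) ≤ A)
    have := one_le_mul_of_one_le_of_one_le this (by linarith : (1 : ℝ) ≤ H)
    exact one_le_mul_of_one_le_of_one_le this hT
  linarith

end Run

end EBF

end

theorem theorem1 :
    ∃ p₁ : MvPolynomial (Fin 4) ℝ,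
      (∀ (S A T : ℕ) (H δ : ℝ), 20 ≤ S → 20 ≤ A → 20 ≤ H → 0 < δ → δ < 1 →
        MvPolynomial.eval ![(S : ℝ), (A : ℝ), H, Real.log (1 / δ)] p₁ ≤ (T : ℝ) →
        ∀ M : MDP S A, M.IsWeaklyCommunicating →
        ∀ h : Fin S → ℝ, M.IsOptimalBias h → vecSpan h ≤ H →
        ∀ (s₁ : Fin S) (Ω : Type*) [MeasurableSpace Ω] (μ : Measure Ω) [IsProbabilityMeasure μ]
          (R : EBF.Run M s₁ H (EBF.inputConf S A T δ) T μ),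
          1 - δ ≤ μ.real {ω | R.regret ω ≤
            490 * √(S * A * H * T *
              Real.log (40 * (S : ℝ) ^ 2 * (A : ℝ) ^ 2 * T * Real.log T / δ))}) ∧
      (∃ (C : ℝ) (m : ℕ), ∀ (S A T : ℕ) (H : ℝ), 20 ≤ S → 20 ≤ A → 20 ≤ H →
        MvPolynomial.eval ![(S : ℝ), (A : ℝ), H, Real.log T] p₁ ≤ (T : ℝ) →
        ∀ M : MDP S A, M.IsWeaklyCommunicating →
        ∀ h : Fin S → ℝ, M.IsOptimalBias h → vecSpan h ≤ H →
        ∀ (s₁ : Fin S) (Ω : Type*) [MeasurableSpace Ω] (μ : Measure Ω) [IsProbabilityMeasure μ]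
          (R : EBF.Run M s₁ H (EBF.inputConf S A T (1 / (T : ℝ))) T μ),
          ∫ ω, R.regret ω ∂μ ≤ C * √(S * A * H * T) * Real.log T ^ m) := by
  let p₁ : MvPolynomial (Fin 4) ℝ := MvPolynomial.C (EBF.horizonConst ^ 2) *
    (MvPolynomial.X 0 * MvPolynomial.X 1 * MvPolynomial.X 2 * (1 + MvPolynomial.X 3)) ^ 48
  have hp : ∀ x y z w : ℝ, MvPolynomial.eval ![x, y, z, w] p₁
      = EBF.horizonConst ^ 2 * (x * y * z * (1 + w)) ^ 48 := fun x y z w => by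
    simp only [p₁, map_mul, map_pow, map_add, map_one, MvPolynomial.eval_C, MvPolynomial.eval_X]
    rfl
  refine ⟨p₁, ?_, 981, 1, ?_⟩
  · intro S A T H δ hS hA hH hδ hδ1 hT M _ h hb hsp s₁ Ω _ μ _ R
    rw [hp] at hT
    obtain ⟨h', ρ, B⟩ := EBF.exists_isBiasPair s₁ (by omega) hb hsp
    have F := EBF.horizonFacts hS hA hH hδ hδ1 rfl hT
    clear hT
    have h1 := R.measureReal_regret_gt_le_conf hδ F B
    have h2 := probReal_compl_eq_one_sub (μ := μ)
      (measurableSet_le R.measurable_regret (measurable_const (a := 490 * √(S * A * H * T *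
              Real.log (40 * (S : ℝ) ^ 2 * (A : ℝ) ^ 2 * T * Real.log T / δ)))))
    rw [Set.compl_ofPred] at h2
    linarith
  · intro S A T H hS hA hH hT M _ h hb hsp s₁ Ω _ μ _ R
    rw [hp] at hT
    obtain ⟨h', ρ, B⟩ := EBF.exists_isBiasPair s₁ (by omega) hb hsp
    have hT1 : (1 : ℝ) < T :=
      lt_of_lt_of_le (by norm_num) (EBF.horizon_ge hS hA hH (Real.log_natCast_nonneg T) rfl hT).1
    have F : EBF.HorizonFacts S A T H (1 / T) := EBF.horizonFacts hS hA hH (one_div_pos.2 (zero_lt_one.trans hT1))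
      (by rwa [div_lt_one (zero_lt_one.trans hT1)]) rfl (by rwa [one_div_one_div])
    rw [pow_one]
    exact R.integral_regret_le_sqrt rfl F B
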